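/- Let $n\ge 1$ and let $q,t$ be indeterminates; polynomials have variables $x_1,\dots,x_n$ and coefficients in $\mathbb{Q}(q,t)$. Let the hat denote the involution of this polynomial ring sending $x_i\mapsto x_{n-i+1}$, $q\mapsto q^{-1}$, $t\mapsto t^{-1}$, i.e. $\hat f(x;q,t)=f(x_n,\dots,x_1;q^{-1},t^{-1})$; for a linear operator $A$ on polynomials let $\hat A$ be the operator with $\hat A\hat f=\widehat{Af}$. For $1\le i\le n-1$ let $s_i$ interchange $x_i$ and $x_{i+1}$ and let $T_i=t+\frac{tx_i-x_{i+1}}{x_i-x_{i+1}}(s_i-1)$. For $\sigma\in S_n$ with a reduced decomposition $\sigma=s_{i_1}\cdots s_{i_p}$ put $T_\sigma=T_{i_1}\cdots T_{i_p}$, let $l(\sigma)=\#\{(i,j): i<j,\ \sigma_i>\sigma_j\}$, and $$U^+=\sum_{\sigma\in S_n}T_\sigma,\qquad U^-=\sum_{\sigma\in S_n}(-t)^{-l(\sigma)}T_\sigma .$$ Let $\tau_1$ replace $x_1$ by $qx_1$, let $\omega=s_{n-1}\cdots s_1\tau_1$ and $Y_i=t^{-n+i}T_i\cdots T_{n-1}\,\omega\,T_1^{-1}\cdots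 T_{i-1}^{-1}$ for $1\le i\le n$. For an $n$-tuple $\kappa$ of nonnegative integers put $e_\kappa=\sum_{i=1}^n q^{\kappa_i}t^{-l'_\kappa(i)}$, where $l'_\kappa(i)=\#\{k<i:\kappa_k\ge\kappa_i\}+\#\{k>i:\kappa_k>\kappa_i\}$. Let $<$ be the (strict) dominance order on partitions of equal modulus with at most $n$ parts (written as $n$-tuples), let $m_\kappa$ be the monomial symmetric polynomial, and $m'_\kappa=U^-x^\kappa$. For a partition $\kappa=(\kappa_1\ge\dots\ge\kappa_n\ge 0)$ the symmetric Macdonald polynomial $P_\kappa(x;q,t)$ is the unique polynomial with $$\Big(\sum_{i=1}^n Y_i\Big)P_\kappa=e_\kappa P_\kappa,\qquad P_\kappa=m_\kappa+\sum_{\mu<\kappa}u_{\kappa\mu}m_\mu .$$ For a partition with non-repeating parts, $\kappa_1>\dots>\kappa_n\ge 0$, the $q$-antisymmetric Macdonald polynomial $S_\kappa(x;q,t)$ is the unique polynomial with $$\Big(\sum_{i=1}^n Y_i\Big)S_\kappa=e_\kappa S_\kappa,\qquad S_\kappa=m'_\kappa+\sum_{\mu<\kappa}v_{\kappa\mu}m'_\mu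 ,$$ the sum being over $\mu$ with non-repeating parts. Then $P_\kappa$ and $S_\kappa$ are well defined (such polynomials exist and are unique), and: 1. $\hat U^+=t^{-n(n-1)/2}\,U^+$ and $\hat U^-=t^{n(n-1)/2}\,U^-$ as operators on polynomials. 2. For every partition $\kappa$ with at most $n$ parts, $P_\kappa(x;q,t)=\hat P_\kappa(x;q,t)=P_\kappa(x;q^{-1},t^{-1})$. 3. For every partition $\kappa$ with non-repeating parts ($\kappa_1>\dots>\kappa_n\ge0$), $S_\kappa(x;q,t)=(-t)^{-n(n-1)/2}\,\hat S_\kappa(x;q,t)$. -/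

import Mathlib

noncomputable section

namespace Macdonald

open MvPolynomial

/-! ### The coefficient field `ℚ(q,t)` and its involution -/

/-- The field `ℚ(q,t)` of rational functions in two indeterminates `q` and `t`. -/
abbrev QT : Type := FractionRing (MvPolynomial (Fin 2) ℚ)

/-- The indeterminate `q` of `ℚ(q,t)`. -/
def q : QT := algebraMap (MvPolynomial (Fin 2) ℚ) QT (X 0)

/-- The indeterminate `t` of `ℚ(q,t)`. -/
def t : QT := algebraMap (MvPolynomial (Fin 2) ℚ) QT (X 1)

theorem q_ne_zero : q ≠ 0 := by
  intro h
  have h' := (IsFractionRing.injective (MvPolynomial (Fin 2) ℚ) QT) (h.trans (map_zero _).symm)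
  exact X_ne_zero (R := ℚ) (0 : Fin 2) h'

theorem t_ne_zero : t ≠ 0 := by
  intro h
  have h' := (IsFractionRing.injective (MvPolynomial (Fin 2) ℚ) QT) (h.trans (map_zero _).symm)
  exact X_ne_zero (R := ℚ) (1 : Fin 2) h'

/-- The substitution `q ↦ q⁻¹`, `t ↦ t⁻¹` on the polynomial ring `ℚ[q,t]`. -/
def barPoly : MvPolynomial (Fin 2) ℚ →ₐ[ℚ] QT := aeval ![q⁻¹, t⁻¹]

theorem barPoly_injective : Function.Injective barPoly := by
  have hinj : Function.Injective (algebraMap ℚ QT) := (algebraMap ℚ QT).injective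
  have hf := (faithfulSMul_iff_algebraMap_injective ℚ QT).mpr hinj
  let v : Fin 2 → QT := ![q⁻¹, t⁻¹]
  let D := Algebra.adjoin ℚ (Set.range v)
  have hmem : ∀ i, v i ∈ D := fun i => Algebra.subset_adjoin ⟨i, rfl⟩
  have hv : ∀ i, IsAlgebraic D (v i) := fun i =>
    isAlgebraic_algebraMap (⟨v i, hmem i⟩ : D)
  have hX : ∀ i : Fin 2, IsAlgebraic D (algebraMap (MvPolynomial (Fin 2) ℚ) QT (X i)) := by
    intro i
    fin_cases i
    · have := (hv 0).inv
      simpa [v, q] using this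
    · have := (hv 1).inv
      simpa [v, t] using this
  have hp : ∀ p : MvPolynomial (Fin 2) ℚ,
      IsAlgebraic D (algebraMap (MvPolynomial (Fin 2) ℚ) QT p) := by
    intro p
    induction p using MvPolynomial.induction_on with
    | C a =>
      have h1 : algebraMap (MvPolynomial (Fin 2) ℚ) QT (C a) = algebraMap D QT (algebraMap ℚ D a) := by
        rw [← IsScalarTower.algebraMap_apply ℚ D QT, ← MvPolynomial.algebraMap_eq,
          ← IsScalarTower.algebraMap_apply ℚ (MvPolynomial (Fin 2) ℚ) QT]
      rw [h1]
      exact isAlgebraic_algebraMap _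
    | add a b ha hb => rw [map_add]; exact ha.add hb
    | mul_X a i ha => rw [map_mul]; exact ha.mul (hX i)
  have halg : Algebra.IsAlgebraic D QT := by
    refine ⟨fun x => ?_⟩
    obtain ⟨a, b, _, rfl⟩ := IsFractionRing.div_surjective (A := MvPolynomial (Fin 2) ℚ) x
    rw [div_eq_mul_inv]
    exact (hp a).mul (hp b).inv
  have hind : AlgebraicIndependent ℚ
      (fun i : Fin 2 => algebraMap (MvPolynomial (Fin 2) ℚ) QT (X i)) := by
    have h0 : (aeval (fun i : Fin 2 => algebraMap (MvPolynomial (Fin 2) ℚ) QT (X i)) :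
        MvPolynomial (Fin 2) ℚ →ₐ[ℚ] QT) = IsScalarTower.toAlgHom ℚ (MvPolynomial (Fin 2) ℚ) QT := by
      ext i
      simp
    unfold AlgebraicIndependent
    rw [h0]
    exact IsFractionRing.injective (MvPolynomial (Fin 2) ℚ) QT
  have hle : Cardinal.mk (Fin 2) ≤ Algebra.trdeg ℚ QT := hind.cardinalMk_le_trdeg
  exact (Algebra.IsAlgebraic.isTranscendenceBasis_of_le_trdeg_of_finite ℚ v hle).1

/-- The automorphism of the field `ℚ(q,t)` with `q ↦ q⁻¹` and `t ↦ t⁻¹`. -/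
def bar : QT →+* QT :=
  IsFractionRing.lift (A := MvPolynomial (Fin 2) ℚ) (g := barPoly.toRingHom) barPoly_injective

theorem bar_q : bar q = q⁻¹ := by
  simp [bar, q, IsFractionRing.lift_algebraMap, barPoly]

theorem bar_t : bar t = t⁻¹ := by
  simp [bar, t, IsFractionRing.lift_algebraMap, barPoly]

theorem bar_bar (c : QT) : bar (bar c) = c := by
  have h : bar.comp bar = RingHom.id QT := by
    apply IsLocalization.ringHom_ext (nonZeroDivisors (MvPolynomial (Fin 2) ℚ))
    apply MvPolynomial.ringHom_ext
    · intro r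
      let c : ℚ →+* QT := (algebraMap (MvPolynomial (Fin 2) ℚ) QT).comp C
      exact congrArg (fun g : ℚ →+* QT => g r) (Subsingleton.elim ((bar.comp bar).comp c) c)
    · intro i
      fin_cases i
      · change bar (bar q) = q
        rw [bar_q, map_inv₀, bar_q, inv_inv]
      · change bar (bar t) = t
        rw [bar_t, map_inv₀, bar_t, inv_inv]
  exact congrArg (fun g : QT →+* QT => g c) h

/-! ### Polynomials in `x₁, …, xₙ` and the hat involution

The variable `xᵢ` is `X (i-1)`: indices are shifted to start at `0`. -/

variable {n : ℕ}

/-- The ring of polynomials in `n` variables over `ℚ(q,t)`. -/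
abbrev Poly (n : ℕ) : Type := MvPolynomial (Fin n) QT

/-- `f(x;q,t) ↦ f(x;q⁻¹,t⁻¹)`. -/
def invertParams : Poly n →+* Poly n := MvPolynomial.map bar

/-- The hat involution `f(x₁,…,xₙ;q,t) ↦ f(xₙ,…,x₁;q⁻¹,t⁻¹)`. -/
def hat : Poly n →+* Poly n :=
  (rename (Fin.rev : Fin n → Fin n) : Poly n →ₐ[QT] Poly n).toRingHom.comp invertParams

theorem hat_C (c : QT) : hat (C c : Poly n) = C (bar c) := by
  simp [hat, invertParams]

theorem hat_X (i : Fin n) : hat (X i : Poly n) = X i.rev := by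
  simp [hat, invertParams]

theorem hat_smul (c : QT) (f : Poly n) : hat (c • f) = bar c • hat f := by
  rw [smul_eq_C_mul, map_mul, hat_C, ← smul_eq_C_mul]

theorem hat_hat (f : Poly n) : hat (hat f) = f := by
  have h : hat.comp hat = RingHom.id (Poly n) := by
    apply MvPolynomial.ringHom_ext
    · intro c
      simp [hat_C, bar_bar]
    · intro i
      simp [hat_X]
  exact congrArg (fun g : Poly n →+* Poly n => g f) h

/-- The `ℚ(q,t)`-linear operators on polynomials; multiplication is composition. -/
abbrev Op (n : ℕ) : Type := Module.End QT (Poly n)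

/-- The hat of an operator `A`. -/
def hatOp (A : Op n) : Op n where
  toFun f := hat (A (hat f))
  map_add' f g := by simp
  map_smul' c f := by simp [hat_smul, bar_bar]

/-- The operator `hatOp A` is characterised by `Â f̂ = (A f)^`. -/
theorem hatOp_hat (A : Op n) (f : Poly n) : hatOp A (hat f) = hat (A f) := by
  change hat (A (hat (hat f))) = _
  rw [hat_hat]

/-! ### Demazure–Lustig operators -/

/-- The position `i` (of `x_{i+1}` in `1`-based notation). -/
def lo (i : Fin (n - 1)) : Fin n := ⟨i, by omega⟩

/-- The position `i + 1`. -/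
def hi (i : Fin (n - 1)) : Fin n := ⟨i + 1, by omega⟩

theorem lo_ne_hi (i : Fin (n - 1)) : lo i ≠ hi i := by
  simp [lo, hi, Fin.ext_iff]

/-- The adjacent transposition `sᵢ`. -/
def adjSwap (i : Fin (n - 1)) : Equiv.Perm (Fin n) := Equiv.swap (lo i) (hi i)

/-- The operator `sᵢ` on polynomials, interchanging two adjacent variables. -/
def sOp (i : Fin (n - 1)) : Op n :=
  (rename (adjSwap i) : Poly n →ₐ[QT] Poly n).toLinearMap

theorem sOp_X_sub (i : Fin (n - 1)) :
    sOp i (X (lo i) - X (hi i) : Poly n) = -(X (lo i) - X (hi i)) := by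
  simp [sOp, adjSwap]

theorem sOp_mul (i : Fin (n - 1)) (f g : Poly n) : sOp i (f * g) = sOp i f * sOp i g := by
  simp [sOp]

theorem sOp_sOp (i : Fin (n - 1)) (f : Poly n) : sOp i (sOp i f) = f := by
  have h : ⇑(adjSwap i) ∘ ⇑(adjSwap i) = id := by
    funext x
    simp [adjSwap]
  simp only [sOp, AlgHom.toLinearMap_apply, rename_rename, h]
  exact rename_id_apply f

theorem X_sub_X_ne_zero (i : Fin (n - 1)) : (X (lo i) - X (hi i) : Poly n) ≠ 0 := by
  intro h
  exact lo_ne_hi i (MvPolynomial.X_injective (sub_eq_zero.mp h))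

theorem X_sub_X_dvd (i : Fin (n - 1)) (f : Poly n) :
    (X (lo i) - X (hi i) : Poly n) ∣ sOp i f - f := by
  rw [← Ideal.mem_span_singleton, ← Ideal.Quotient.mk_eq_mk_iff_sub_mem]
  set I : Ideal (Poly n) := Ideal.span {(X (lo i) - X (hi i) : Poly n)} with hI
  have hlh : Ideal.Quotient.mk I (X (lo i)) = Ideal.Quotient.mk I (X (hi i)) := by
    rw [Ideal.Quotient.mk_eq_mk_iff_sub_mem]
    exact Ideal.subset_span rfl
  have h : (Ideal.Quotient.mkₐ QT I).comp (rename (adjSwap i) : Poly n →ₐ[QT] Poly n)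
      = Ideal.Quotient.mkₐ QT I := by
    apply MvPolynomial.algHom_ext
    intro j
    simp only [AlgHom.comp_apply, rename_X, Ideal.Quotient.mkₐ_eq_mk, adjSwap]
    rcases eq_or_ne j (lo i) with rfl | h1
    · rw [Equiv.swap_apply_left]; exact hlh.symm
    rcases eq_or_ne j (hi i) with rfl | h2
    · rw [Equiv.swap_apply_right]; exact hlh
    · rw [Equiv.swap_apply_of_ne_of_ne h1 h2]
  exact congrArg (fun g : Poly n →ₐ[QT] Poly n ⧸ I => g f) h

/-- The divided difference `(xᵢ - xᵢ₊₁)⁻¹ (sᵢ f - f)`, which is a polynomial. -/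
def divDiffFun (i : Fin (n - 1)) (f : Poly n) : Poly n := (X_sub_X_dvd i f).choose

theorem mul_divDiffFun (i : Fin (n - 1)) (f : Poly n) :
    (X (lo i) - X (hi i)) * divDiffFun i f = sOp i f - f :=
  (X_sub_X_dvd i f).choose_spec.symm

/-- The operator `(xᵢ - xᵢ₊₁)⁻¹ (sᵢ - 1)`. -/
def divDiff (i : Fin (n - 1)) : Op n where
  toFun := divDiffFun i
  map_add' f g := by
    apply mul_left_cancel₀ (X_sub_X_ne_zero i)
    rw [mul_add, mul_divDiffFun, mul_divDiffFun, mul_divDiffFun, map_add]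
    ring
  map_smul' c f := by
    apply mul_left_cancel₀ (X_sub_X_ne_zero i)
    rw [RingHom.id_apply, mul_smul_comm, mul_divDiffFun, mul_divDiffFun, map_smul, smul_sub]

theorem mul_divDiff (i : Fin (n - 1)) (f : Poly n) :
    (X (lo i) - X (hi i)) * divDiff i f = sOp i f - f :=
  mul_divDiffFun i f

/-- The Demazure–Lustig operator
`Tᵢ = t + (t xᵢ - xᵢ₊₁) / (xᵢ - xᵢ₊₁) (sᵢ - 1)`. -/
def T (i : Fin (n - 1)) : Op n :=
  t • 1 + LinearMap.mulLeft QT (C t * X (lo i) - X (hi i) : Poly n) * divDiff i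

theorem T_apply (i : Fin (n - 1)) (f : Poly n) :
    T i f = C t * f + (C t * X (lo i) - X (hi i)) * divDiff i f := by
  simp [T, smul_eq_C_mul]

theorem T_quadratic (i : Fin (n - 1)) : T i * T i = (t - 1) • T i + t • 1 := by
  refine LinearMap.ext fun f => ?_
  have hs : ∀ g : Poly n, (X (lo i) - X (hi i)) * T i g
      = C t * (X (lo i) - X (hi i)) * g
        + (C t * X (lo i) - X (hi i)) * (sOp i g - g) := by
    intro g
    rw [T_apply, ← mul_divDiff]
    ring
  have hlo : sOp i (X (lo i) : Poly n) = X (hi i) := by simp [sOp, adjSwap]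
  have hhi : sOp i (X (hi i) : Poly n) = X (lo i) := by simp [sOp, adjSwap]
  have hC : sOp i (C t : Poly n) = C t := by simp [sOp]
  have h1 := hs f
  have h2 := hs (T i f)
  have h3 := congrArg (sOp i) h1
  simp only [sOp_mul, map_add, map_sub, hlo, hhi, hC, sOp_sOp] at h3
  apply mul_left_cancel₀ (X_sub_X_ne_zero i)
  apply mul_left_cancel₀ (X_sub_X_ne_zero i)
  simp only [Module.End.mul_apply, LinearMap.add_apply, LinearMap.smul_apply,
    Module.End.one_apply, smul_eq_C_mul, map_sub, map_one]
  linear_combination (X (lo i) - X (hi i)) * h2 - (C t * X (lo i) - X (hi i)) * h3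
    + (C t * (X (lo i) - X (hi i)) - (C t * X (lo i) - X (hi i))
      - (C t - 1) * (X (lo i) - X (hi i))) * h1

/-- The operator `Tᵢ⁻¹ = t⁻¹ - 1 + t⁻¹ Tᵢ`. -/
def Tinv (i : Fin (n - 1)) : Op n := (t⁻¹ - 1) • 1 + t⁻¹ • T i

theorem T_mul_Tinv (i : Fin (n - 1)) : T i * Tinv i = 1 := by
  have ht := t_ne_zero
  rw [Tinv, mul_add, mul_smul_comm, mul_one, mul_smul_comm, T_quadratic, smul_add, smul_smul,
    smul_smul, inv_mul_cancel₀ ht, one_smul, ← add_assoc, ← add_smul]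
  have : t⁻¹ - 1 + t⁻¹ * (t - 1) = 0 := by field_simp; ring
  rw [this, zero_smul, zero_add]

theorem Tinv_mul_T (i : Fin (n - 1)) : Tinv i * T i = 1 := by
  rw [← T_mul_Tinv i, Tinv, mul_add, add_mul, smul_mul_assoc, smul_mul_assoc, one_mul,
    mul_smul_comm, mul_one, mul_smul_comm]

/-! ### The operators `T_σ`, `U⁺` and `U⁻` -/

/-- The word `w = [i₁, …, i_p]` is a decomposition `σ = s_{i₁} ⋯ s_{i_p}` of minimal length. -/
def IsReducedWord (w : List (Fin (n - 1))) (σ : Equiv.Perm (Fin n)) : Prop :=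
  (w.map adjSwap).prod = σ ∧
    ∀ w' : List (Fin (n - 1)), (w'.map adjSwap).prod = σ → w.length ≤ w'.length

theorem exists_word (σ : Equiv.Perm (Fin n)) :
    ∃ w : List (Fin (n - 1)), (w.map adjSwap).prod = σ := by
  cases n with
  | zero => exact ⟨[], Subsingleton.elim _ _⟩
  | succ m =>
    have h : σ ∈ Submonoid.closure
        (Set.range fun i : Fin m => Equiv.swap i.castSucc i.succ) := by
      rw [Equiv.Perm.mclosure_swap_castSucc_succ]
      trivial
    induction h using Submonoid.closure_induction with
    | mem x hx =>
      obtain ⟨i, rfl⟩ := hx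
      exact ⟨[i], by simp [adjSwap, lo, hi]; rfl⟩
    | one => exact ⟨[], rfl⟩
    | mul x y _ _ hx hy =>
      obtain ⟨u, hu⟩ := hx
      obtain ⟨v, hv⟩ := hy
      exact ⟨u ++ v, by rw [List.map_append, List.prod_append, hu, hv]⟩

theorem exists_reducedWord (σ : Equiv.Perm (Fin n)) :
    ∃ w : List (Fin (n - 1)), IsReducedWord w σ := by
  classical
  have h : ∃ k, ∃ w : List (Fin (n - 1)), (w.map adjSwap).prod = σ ∧ w.length = k := by
    obtain ⟨w, hw⟩ := exists_word σ
    exact ⟨_, w, hw, rfl⟩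
  obtain ⟨w, hw, hl⟩ := Nat.find_spec h
  exact ⟨w, hw, fun w' hw' => hl ▸ Nat.find_min' h ⟨w', hw', rfl⟩⟩

/-- A reduced word of `σ`. -/
def reducedWord (σ : Equiv.Perm (Fin n)) : List (Fin (n - 1)) := (exists_reducedWord σ).choose

theorem reducedWord_spec (σ : Equiv.Perm (Fin n)) : IsReducedWord (reducedWord σ) σ :=
  (exists_reducedWord σ).choose_spec

/-- `T_σ = T_{i₁} ⋯ T_{i_p}` for a reduced decomposition `σ = s_{i₁} ⋯ s_{i_p}`. -/
def Tperm (σ : Equiv.Perm (Fin n)) : Op n := ((reducedWord σ).map T).prod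

/-- The length `l(σ) = #{(i,j) | i < j, σᵢ > σⱼ}`. -/
def len (σ : Equiv.Perm (Fin n)) : ℕ :=
  (Finset.univ.filter fun p : Fin n × Fin n => p.1 < p.2 ∧ σ p.2 < σ p.1).card

/-- `U⁺ = ∑_σ T_σ`. -/
def Uplus (n : ℕ) : Op n := ∑ σ : Equiv.Perm (Fin n), Tperm σ

/-- `U⁻ = ∑_σ (-t)^{-l(σ)} T_σ`. -/
def Uminus (n : ℕ) : Op n := ∑ σ : Equiv.Perm (Fin n), (-t) ^ (-(len σ : ℤ)) • Tperm σ

/-! ### Cherednik operators -/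

/-- The `q`-shift `τᵢ`, which replaces `xᵢ` by `q xᵢ`. -/
def tau (i : Fin n) : Op n :=
  (aeval (Function.update (X : Fin n → Poly n) i (C q * X i)) :
    Poly n →ₐ[QT] Poly n).toLinearMap

/-- `ω = s_{n-1} ⋯ s₂ s₁ τ₁`. -/
def omega [NeZero n] : Op n :=
  ((List.finRange (n - 1)).reverse.map sOp).prod * tau 0

/-- `Yᵢ = t^{-n+i} Tᵢ ⋯ T_{n-1} ω T₁⁻¹ ⋯ T_{i-1}⁻¹` for `1 ≤ i ≤ n`; with indices starting at `0`
the exponent is `-n+i+1`, the first product is over the indices `≥ i` and the second over the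
indices `< i`, both in increasing order. -/
def Y [NeZero n] (i : Fin n) : Op n :=
  t ^ (-(n : ℤ) + (i : ℤ) + 1) •
    ((((List.finRange (n - 1)).filter fun k : Fin (n - 1) => (i : ℕ) ≤ (k : ℕ)).map T).prod * omega *
      (((List.finRange (n - 1)).filter fun k : Fin (n - 1) => (k : ℕ) < (i : ℕ)).map Tinv).prod)

/-! ### Symmetric and `q`-antisymmetric Macdonald polynomials -/

/-- The leg colength `l'_η(i) = #{k < i | η_k ≥ η_i} + #{k > i | η_k > η_i}`. -/
def legColength (η : Fin n → ℕ) (i : Fin n) : ℕ :=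
  (Finset.univ.filter fun k : Fin n => k < i ∧ η i ≤ η k).card +
    (Finset.univ.filter fun k : Fin n => i < k ∧ η i < η k).card

/-- The eigenvalue `t^{η̄ᵢ} = q^{ηᵢ} t^{-l'_η(i)}`. -/
def eigval (η : Fin n → ℕ) (i : Fin n) : QT := q ^ η i * t ^ (-(legColength η i : ℤ))

/-- The strict dominance order `μ < κ` on `n`-tuples with equal sums. -/
def DomLT (μ κ : Fin n → ℕ) : Prop :=
  μ ≠ κ ∧ ∑ i, μ i = ∑ i, κ i ∧ ∀ p : Fin n, ∑ i ∈ Finset.Iic p, μ i ≤ ∑ i ∈ Finset.Iic p, κ i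

/-- The monomial `x^η`. -/
def xpow (η : Fin n → ℕ) : Poly n := ∏ i, X i ^ η i

/-- The monomial symmetric polynomial `m_κ`: the sum of the distinct monomials `x^η` with `η` a
rearrangement of `κ`. -/
def msymm (κ : Fin n → ℕ) : Poly n :=
  ∑ η ∈ Finset.univ.image fun σ : Equiv.Perm (Fin n) => κ ∘ σ, xpow η

/-- The `q`-antisymmetric monomial `m'_κ = U⁻ x^κ`. -/
def masymm (κ : Fin n → ℕ) : Poly n := Uminus n (xpow κ)

/-- `P` satisfies the defining conditions of the symmetric Macdonald polynomial `P_κ(x;q,t)` of the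
partition `κ` (a weakly decreasing `n`-tuple): it is an eigenfunction of `∑ᵢ Yᵢ` with eigenvalue
`∑ᵢ t^{κ̄ᵢ}`, and `P = m_κ + ∑_{μ<κ} u_{κμ} m_μ`, the sum being over partitions `μ`. -/
structure IsSymmMacdonald [NeZero n] (κ : Fin n → ℕ) (P : Poly n) : Prop where
  eigen : (∑ i, Y i) P = (∑ i, eigval κ i) • P
  triangular : P - msymm κ ∈
    Submodule.span QT {f : Poly n | ∃ μ : Fin n → ℕ, Antitone μ ∧ DomLT μ κ ∧ f = msymm μ}

/-- `S` satisfies the defining conditions of the `q`-antisymmetric Macdonald polynomial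
`S_κ(x;q,t)` of the partition `κ` with non-repeating parts (a strictly decreasing `n`-tuple): it is
an eigenfunction of `∑ᵢ Yᵢ` with eigenvalue `∑ᵢ t^{κ̄ᵢ}`, and
`S = m'_κ + ∑_{μ<κ} v_{κμ} m'_μ`, the sum being over partitions `μ` with non-repeating parts. -/
structure IsAsymmMacdonald [NeZero n] (κ : Fin n → ℕ) (S : Poly n) : Prop where
  eigen : (∑ i, Y i) S = (∑ i, eigval κ i) • S
  triangular : S - masymm κ ∈
    Submodule.span QT {f : Poly n | ∃ μ : Fin n → ℕ, StrictAnti μ ∧ DomLT μ κ ∧ f = masymm μ}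

end Macdonald

end

noncomputable section

namespace Macdonald

open MvPolynomial

variable {n : ℕ}

/-! ### Lengths and reduced words -/

/-! The hat carries the Hecke algebra to itself: reversing the variables sends `sᵢ` to its mirror
image, and inverting `t` then turns `Tᵢ` into the inverse of the mirrored generator (`hatOp_T`).
Likewise the hat of `ω` is `ω⁻¹` (`hatOp_omega_mul_omega`).

For the symmetrizers, let `U` be `U⁺` or `U⁻`. Every `Tᵢ` acts on `U`, from either side, by a scalar
`χ`, equal to `t` or `-1`. Both values satisfy `(bar χ)⁻¹ = χ`, so the hat of `U` has the same left
property. Evaluating the product of `U` with its hat by absorbing the left factor, then by absorbing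
the right one, shows that the two are proportional. The constant is a quotient of Poincaré
polynomials (`IsCharPair.symmetrizer_hat`), made explicit by the symmetry of the length under
multiplication by the longest permutation.

For the Macdonald polynomials put `D = ∑ Yᵢ`. Modulo smaller monomials, `Yᵢ` is diagonal on a
monomial with increasing exponents (`Y_xpow_of_monotone`). Since `D` commutes with `U`, symmetrizing
makes `D` triangular on the `m_κ` and on the `m'_κ` (`sumY_msymm`, `sumY_masymm`). Its diagonal
entries are distinct (`sum_eigval_injective`), whence existence and uniqueness.

The hat of an eigenfunction of `D` is an eigenfunction of the hat of `D`, not visibly of `D`. The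
bridge is that the two operators commute on polynomials where the `Tᵢ` act by `χ`
(`IsCharPair.sumY_hatOp_sumY`): there `D` is a multiple of `U ω`, its hat is a multiple of `U ω⁻¹`,
and `D` commutes with `U` and, on such polynomials, with `ω⁻¹`. Commutation and triangularity force
the hat of `P_κ`, or the rescaled hat of `S_κ`, to be an eigenfunction of `D`
(`eigen_of_hat_eigen`). Its leading term is the right one, so uniqueness identifies it. -/

theorem adjSwap_mul_self (i : Fin (n - 1)) : adjSwap i * adjSwap i = 1 :=
  Equiv.swap_mul_self _ _

theorem adjSwap_lo (i : Fin (n - 1)) : adjSwap i (lo i) = hi i := Equiv.swap_apply_left _ _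

theorem adjSwap_hi (i : Fin (n - 1)) : adjSwap i (hi i) = lo i := Equiv.swap_apply_right _ _

theorem adjSwap_adjSwap (i : Fin (n - 1)) (a : Fin n) : adjSwap i (adjSwap i a) = a :=
  Equiv.swap_apply_self _ _ _

theorem adjSwap_of_ne {i : Fin (n - 1)} {a : Fin n} (h : a ≠ lo i) (h' : a ≠ hi i) :
    adjSwap i a = a := Equiv.swap_apply_of_ne_of_ne h h'

theorem lo_lt_hi (i : Fin (n - 1)) : lo i < hi i := by simp [lo, hi, Fin.lt_def]

theorem adjSwap_val (i : Fin (n - 1)) (a : Fin n) :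
    (adjSwap i a : ℕ) = if (a : ℕ) = i then (i : ℕ) + 1 else if (a : ℕ) = i + 1 then (i : ℕ)
      else a := by
  simp only [adjSwap, Equiv.swap_apply_def, lo, hi, Fin.ext_iff]
  split_ifs <;> rfl

theorem adjSwap_lt {i : Fin (n - 1)} {a b : Fin n} (h : a < b) (h' : ¬(a = lo i ∧ b = hi i)) :
    adjSwap i a < adjSwap i b := by
  simp only [Fin.lt_def, adjSwap_val, lo, hi, Fin.ext_iff] at *
  split_ifs <;> omega

theorem adjSwap_lt_iff {i : Fin (n - 1)} {a b : Fin n} (h : ¬(a = lo i ∧ b = hi i))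
    (h' : ¬(a = hi i ∧ b = lo i)) : adjSwap i a < adjSwap i b ↔ a < b := by
  refine ⟨fun hab => ?_, fun hab => adjSwap_lt hab h⟩
  have := adjSwap_lt (i := i) hab (by
    rintro ⟨h1, h2⟩
    refine h' ⟨?_, ?_⟩
    · rw [← adjSwap_adjSwap i a, h1, adjSwap_lo]
    · rw [← adjSwap_adjSwap i b, h2, adjSwap_hi])
  rwa [adjSwap_adjSwap, adjSwap_adjSwap] at this

/-- An adjacent transposition reverses the order of a single pair of positions. Applied to both
coordinates it therefore carries the inversions of `σ` to inversions of the product, and the pair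
`(lo i, hi i)` is the only new one. -/
theorem len_mul_adjSwap {σ : Equiv.Perm (Fin n)} {i : Fin (n - 1)} (h : σ (lo i) < σ (hi i)) :
    len (σ * adjSwap i) = len σ + 1 := by
  classical
  have key : (Finset.univ.filter fun p : Fin n × Fin n =>
      p.1 < p.2 ∧ (σ * adjSwap i) p.2 < (σ * adjSwap i) p.1) =
      insert (lo i, hi i) ((Finset.univ.filter fun p : Fin n × Fin n =>
        p.1 < p.2 ∧ σ p.2 < σ p.1).map
          ((adjSwap i).prodCongr (adjSwap i)).toEmbedding) := by
    ext ⟨a, b⟩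
    rw [Finset.mem_filter, Finset.mem_insert, Finset.mem_map]
    simp only [Finset.mem_filter, Finset.mem_univ, true_and, Prod.mk.injEq, Prod.exists,
      Equiv.coe_toEmbedding, Equiv.prodCongr_apply, Prod.map_apply, Equiv.Perm.mul_apply]
    constructor
    · rintro ⟨hab, hs⟩
      by_cases hc : a = lo i ∧ b = hi i
      · exact Or.inl hc
      · exact Or.inr ⟨adjSwap i a, adjSwap i b, ⟨adjSwap_lt hab hc, hs⟩,
          adjSwap_adjSwap _ _, adjSwap_adjSwap _ _⟩
    · rintro (⟨rfl, rfl⟩ | ⟨a', b', ⟨hab, hs⟩, rfl, rfl⟩)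
      · exact ⟨lo_lt_hi i, by rwa [adjSwap_lo, adjSwap_hi]⟩
      · refine ⟨adjSwap_lt hab ?_, by rwa [adjSwap_adjSwap, adjSwap_adjSwap]⟩
        rintro ⟨rfl, rfl⟩
        exact lt_asymm h hs
  rw [len, key, Finset.card_insert_of_notMem, Finset.card_map, len]
  simp only [Finset.mem_map, Finset.mem_filter, Finset.mem_univ, true_and, Prod.exists,
    Equiv.coe_toEmbedding, Equiv.prodCongr_apply, Prod.map_apply, Prod.mk.injEq, not_exists,
    not_and, and_imp]
  intro a b hab _ ha hb
  have ha' : a = hi i := by rw [← adjSwap_adjSwap i a, ha, adjSwap_lo]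
  have hb' : b = lo i := by rw [← adjSwap_adjSwap i b, hb, adjSwap_hi]
  subst ha' hb'
  exact lt_asymm hab (lo_lt_hi i)

theorem len_mul_adjSwap_of_gt {σ : Equiv.Perm (Fin n)} {i : Fin (n - 1)}
    (h : σ (hi i) < σ (lo i)) : len (σ * adjSwap i) + 1 = len σ := by
  have := len_mul_adjSwap (σ := σ * adjSwap i) (i := i) (by simpa [adjSwap_lo, adjSwap_hi] using h)
  rw [← this, mul_assoc, adjSwap_mul_self, mul_one]

theorem lt_or_gt_adj (σ : Equiv.Perm (Fin n)) (i : Fin (n - 1)) :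
    σ (lo i) < σ (hi i) ∨ σ (hi i) < σ (lo i) :=
  lt_or_gt_of_ne fun h => lo_ne_hi i (σ.injective h)

theorem len_mul_adjSwap_le (σ : Equiv.Perm (Fin n)) (i : Fin (n - 1)) :
    len (σ * adjSwap i) ≤ len σ + 1 := by
  rcases lt_or_gt_adj σ i with h | h
  · exact (len_mul_adjSwap h).le
  · have := len_mul_adjSwap_of_gt h
    omega

theorem len_one : len (1 : Equiv.Perm (Fin n)) = 0 := by
  rw [len, Finset.card_eq_zero, Finset.filter_eq_empty_iff]
  rintro ⟨a, b⟩ _ ⟨h, h'⟩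
  exact lt_asymm h h'

theorem len_inv (σ : Equiv.Perm (Fin n)) : len σ⁻¹ = len σ := by
  refine Finset.card_bij' (fun p _ => (σ⁻¹ p.2, σ⁻¹ p.1)) (fun p _ => (σ p.2, σ p.1)) ?_ ?_ ?_ ?_ <;>
    simp +contextual

theorem eq_one_of_forall_lt {σ : Equiv.Perm (Fin n)} (h : ∀ i, σ (lo i) < σ (hi i)) : σ = 1 := by
  have hm : StrictMono σ := by
    cases n with
    | zero => exact fun a => a.elim0
    | succ m => exact Fin.strictMono_iff_lt_succ.mpr fun i => h i
  have : hm.orderIsoOfSurjective σ σ.surjective = OrderIso.refl _ := Subsingleton.elim _ _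
  ext x
  exact congrArg (fun e : Fin n ≃o Fin n => (e x : ℕ)) this

/-- Cancelling a descent on the right lowers the length by one, and only the identity has no
descent. -/
theorem exists_word_length_eq_len (σ : Equiv.Perm (Fin n)) :
    ∃ w : List (Fin (n - 1)), (w.map adjSwap).prod = σ ∧ w.length = len σ := by
  induction hk : len σ generalizing σ with
  | zero =>
    refine ⟨[], ?_, rfl⟩
    rw [eq_one_of_forall_lt (σ := σ) fun i => ?_]
    · rfl
    · refine (lt_or_gt_adj σ i).resolve_right fun h => ?_
      have := len_mul_adjSwap_of_gt h
      omega
  | succ k ih =>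
    have : ∃ i, σ (hi i) < σ (lo i) := by
      by_contra! hc
      have := eq_one_of_forall_lt (σ := σ) fun i =>
        (lt_or_gt_adj σ i).resolve_right (hc i).not_gt
      rw [this, len_one] at hk
      omega
    obtain ⟨i, hi⟩ := this
    have h1 := len_mul_adjSwap_of_gt hi
    obtain ⟨w, hw, hl⟩ := ih (σ * adjSwap i) (by omega)
    refine ⟨w ++ [i], ?_, by simp [hl]⟩
    rw [List.map_append, List.prod_append, hw]
    simp [mul_assoc, adjSwap_mul_self]

theorem len_prod_le (w : List (Fin (n - 1))) : len (w.map adjSwap).prod ≤ w.length := by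
  induction w using List.reverseRecOn with
  | nil => simp [len_one]
  | append_singleton w i ih =>
    simp only [List.map_append, List.map_cons, List.map_nil, List.prod_append, List.prod_singleton,
      List.length_append, List.length_singleton]
    exact (len_mul_adjSwap_le _ _).trans (by omega)

/-- A letter changes the number of inversions by at most one, so that number is a lower bound for
all words, and it is attained. Minimality thereby becomes an equation of numbers. -/
theorem isReducedWord_iff {w : List (Fin (n - 1))} {σ : Equiv.Perm (Fin n)} :
    IsReducedWord w σ ↔ (w.map adjSwap).prod = σ ∧ w.length = len σ := by
  constructor
  · rintro ⟨h, hmin⟩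
    obtain ⟨v, hv, hl⟩ := exists_word_length_eq_len σ
    refine ⟨h, le_antisymm (hl ▸ hmin v hv) ?_⟩
    rw [← h]
    exact len_prod_le w
  · rintro ⟨h, hl⟩
    refine ⟨h, fun v hv => ?_⟩
    rw [hl, ← hv]
    exact len_prod_le v

theorem IsReducedWord.init {w : List (Fin (n - 1))} {i : Fin (n - 1)} {σ : Equiv.Perm (Fin n)}
    (h : IsReducedWord (w ++ [i]) σ) :
    IsReducedWord w (σ * adjSwap i) ∧ σ (hi i) < σ (lo i) := by
  rw [isReducedWord_iff] at h ⊢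
  obtain ⟨h, hl⟩ := h
  simp only [List.map_append, List.map_cons, List.map_nil, List.prod_append, List.prod_singleton,
      List.length_append, List.length_singleton] at h hl
  have hw : (w.map adjSwap).prod = σ * adjSwap i := by
    rw [← h, mul_assoc, adjSwap_mul_self, mul_one]
  have h1 := len_prod_le w
  rw [hw] at h1
  rcases lt_or_gt_adj σ i with h2 | h2
  · have := len_mul_adjSwap h2
    omega
  · have := len_mul_adjSwap_of_gt h2
    exact ⟨⟨hw, by omega⟩, h2⟩

theorem IsReducedWord.snoc {w : List (Fin (n - 1))} {i : Fin (n - 1)} {σ : Equiv.Perm (Fin n)}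
    (h : IsReducedWord w (σ * adjSwap i)) (hi : σ (hi i) < σ (lo i)) :
    IsReducedWord (w ++ [i]) σ := by
  rw [isReducedWord_iff] at h ⊢
  have := len_mul_adjSwap_of_gt hi
  refine ⟨?_, by simp [h.2, this]⟩
  rw [List.map_append, List.prod_append, h.1]
  simp [mul_assoc, adjSwap_mul_self]

theorem adjSwap_comm {i j : Fin (n - 1)} (h : (i : ℕ) + 1 < j) :
    adjSwap i * adjSwap j = adjSwap j * adjSwap i := by
  ext x
  simp only [Equiv.Perm.mul_apply, adjSwap_val]
  split_ifs <;> omega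

theorem adjSwap_braid {i j : Fin (n - 1)} (h : (j : ℕ) = i + 1) :
    adjSwap i * adjSwap j * adjSwap i = adjSwap j * adjSwap i * adjSwap j := by
  ext x
  simp only [Equiv.Perm.mul_apply, adjSwap_val, h]
  split_ifs <;> omega

/-- **Matsumoto's theorem** for the symmetric group. -/
theorem prod_map_eq_of_isReducedWord {M : Type*} [Monoid M] (F : Fin (n - 1) → M)
    (hbraid : ∀ i j : Fin (n - 1), (j : ℕ) = i + 1 → F i * F j * F i = F j * F i * F j)
    (hcomm : ∀ i j : Fin (n - 1), (i : ℕ) + 1 < j → F i * F j = F j * F i)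
    {σ : Equiv.Perm (Fin n)} {w w' : List (Fin (n - 1))}
    (hw : IsReducedWord w σ) (hw' : IsReducedWord w' σ) : (w.map F).prod = (w'.map F).prod := by
  induction hk : len σ generalizing σ w w' with
  | zero =>
    rw [isReducedWord_iff] at hw hw'
    rw [List.length_eq_zero_iff.mp (hw.2.trans hk), List.length_eq_zero_iff.mp (hw'.2.trans hk)]
  | succ k ih =>
    have hne : w ≠ [] := by
      rintro rfl
      have := (isReducedWord_iff.mp hw).2
      simp_all
    have hne' : w' ≠ [] := by
      rintro rfl
      have := (isReducedWord_iff.mp hw').2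
      simp_all
    obtain ⟨u, i, rfl⟩ := (List.eq_nil_or_concat' w).resolve_left hne
    obtain ⟨u', j, rfl⟩ := (List.eq_nil_or_concat' w').resolve_left hne'
    clear hne hne'
    obtain ⟨hu, hi'⟩ := hw.init
    obtain ⟨hu', hj'⟩ := hw'.init
    have hl := len_mul_adjSwap_of_gt hi'
    have hl' := len_mul_adjSwap_of_gt hj'
    simp only [List.map_append, List.map_cons, List.map_nil, List.prod_append, List.prod_singleton]
    -- Distant descents can be cancelled together: with `v` reduced for `σ sᵢ sⱼ`, both `v j i` and
    -- `v i j` are reduced for `σ`. Induction compares `u` with `v j` and `u'` with `v i`, and the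
    -- commutation relation joins them.
    have far : ∀ (i j : Fin (n - 1)) (u u' : List (Fin (n - 1))), (i : ℕ) + 1 < j →
        IsReducedWord u (σ * adjSwap i) → IsReducedWord u' (σ * adjSwap j) →
        σ (hi i) < σ (lo i) → σ (hi j) < σ (lo j) →
        (u.map F).prod * F i = (u'.map F).prod * F j := by
      intro i j u u' hij hu hu' hi' hj'
      have hl := len_mul_adjSwap_of_gt hi'
      have hl' := len_mul_adjSwap_of_gt hj'
      obtain ⟨v, hv⟩ := exists_reducedWord (σ * adjSwap i * adjSwap j)
      have h1 : IsReducedWord (v ++ [j]) (σ * adjSwap i) := hv.snoc (by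
        rw [Equiv.Perm.mul_apply, Equiv.Perm.mul_apply, adjSwap_of_ne, adjSwap_of_ne]
        · exact hj'
        all_goals simp only [lo, hi, ne_eq, Fin.ext_iff]; omega)
      have h2 : IsReducedWord (v ++ [i]) (σ * adjSwap j) := by
        rw [mul_assoc, adjSwap_comm hij, ← mul_assoc] at hv
        refine hv.snoc ?_
        rw [Equiv.Perm.mul_apply, Equiv.Perm.mul_apply, adjSwap_of_ne, adjSwap_of_ne]
        · exact hi'
        all_goals simp only [lo, hi, ne_eq, Fin.ext_iff]; omega
      rw [ih hu h1 (by omega), ih hu' h2 (by omega)]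
      simp [mul_assoc, hcomm i j hij]
    -- Two adjacent descents make `σ` decreasing on three consecutive positions, so `sᵢ sⱼ sᵢ` can
    -- be split off entirely. The words `v i j i` and `v j i j` are then both reduced for `σ`, and
    -- the braid relation joins them.
    have near : ∀ (i j : Fin (n - 1)) (u u' : List (Fin (n - 1))), (j : ℕ) = i + 1 →
        IsReducedWord u (σ * adjSwap i) → IsReducedWord u' (σ * adjSwap j) →
        σ (hi i) < σ (lo i) → σ (hi j) < σ (lo j) →
        (u.map F).prod * F i = (u'.map F).prod * F j := by
      intro i j u u' hij hu hu' hi' hj'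
      have hl := len_mul_adjSwap_of_gt hi'
      have hl' := len_mul_adjSwap_of_gt hj'
      have hlj : lo j = hi i := by simp [lo, hi, hij]
      have hi1 : adjSwap i (hi j) = hi j := adjSwap_of_ne
        (by simp only [lo, hi, ne_eq, Fin.ext_iff]; omega)
        (by simp only [hi, ne_eq, Fin.ext_iff]; omega)
      have hj1 : adjSwap j (lo i) = lo i := adjSwap_of_ne
        (by simp only [lo, ne_eq, Fin.ext_iff]; omega)
        (by simp only [lo, hi, ne_eq, Fin.ext_iff]; omega)
      have hj2 : adjSwap j (hi i) = hi j := by rw [← hlj, adjSwap_lo]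
      rw [hlj] at hj'
      obtain ⟨v, hv⟩ := exists_reducedWord (σ * adjSwap i * adjSwap j * adjSwap i)
      have h1 : IsReducedWord (v ++ [i] ++ [j]) (σ * adjSwap i) := by
        refine IsReducedWord.snoc (IsReducedWord.snoc hv ?_) ?_
        · simpa [hj1, hj2, hi1, adjSwap_lo] using hj'
        · simpa [hlj, hi1, adjSwap_hi] using hj'.trans hi'
      have h2 : IsReducedWord (v ++ [j] ++ [i]) (σ * adjSwap j) := by
        rw [mul_assoc, mul_assoc, ← mul_assoc (adjSwap i), adjSwap_braid hij, ← mul_assoc,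
          ← mul_assoc] at hv
        refine IsReducedWord.snoc (IsReducedWord.snoc hv ?_) ?_
        · have : adjSwap j (hi j) = hi i := by rw [adjSwap_hi, hlj]
          simpa [hlj, hi1, adjSwap_hi, this, hj1] using hi'
        · simpa [hj1, hj2] using hj'.trans hi'
      rw [ih hu h1 (by omega), ih hu' h2 (by omega)]
      simp only [List.map_append, List.map_cons, List.map_nil, List.prod_append,
        List.prod_singleton, mul_assoc]
      rw [← mul_assoc (F i), hbraid i j hij, mul_assoc]
    rcases lt_trichotomy (i : ℕ) (j : ℕ) with h | h | h
    · rcases (Nat.succ_le_of_lt h).eq_or_lt with h | h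
      · exact near i j u u' h.symm hu hu' hi' hj'
      · exact far i j u u' h hu hu' hi' hj'
    · obtain rfl := Fin.ext h
      rw [ih hu hu' (by omega)]
    · rcases (Nat.succ_le_of_lt h).eq_or_lt with h | h
      · exact (near j i u' u h.symm hu' hu hj' hi').symm
      · exact (far j i u' u h hu' hu hj' hi').symm

/-! ### The reversal permutation and complementary lengths. -/

theorem card_pairs_lt : (Finset.univ.filter fun p : Fin n × Fin n => p.1 < p.2).card
    = n * (n - 1) / 2 := by
  rw [Finset.card_filter, Fintype.sum_prod_type_right]
  have h : ∀ j : Fin n, (∑ i : Fin n, if i < j then 1 else 0) = (j : ℕ) := by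
    intro j
    rw [← Finset.card_filter, show (Finset.univ.filter fun i => i < j) = Finset.Iio j by ext; simp,
      Fin.card_Iio]
  simp only [h]
  rw [Fin.sum_univ_eq_sum_range (fun j => j), Finset.sum_range_id]

/-- Reversing the values exchanges inversions and non-inversions. -/
theorem len_rev_mul (σ : Equiv.Perm (Fin n)) :
    len (Fin.revPerm * σ) + len σ = n * (n - 1) / 2 := by
  rw [← card_pairs_lt, len, len, add_comm,
    ← Finset.card_filter_add_card_filter_not (s := Finset.univ.filter fun p : Fin n × Fin n =>
      p.1 < p.2) (fun p => σ p.2 < σ p.1), Finset.filter_filter, Finset.filter_filter]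
  congr 2
  ext ⟨a, b⟩
  simp only [Equiv.Perm.mul_apply, Fin.revPerm_apply, Fin.rev_lt_rev, Finset.mem_filter,
    Finset.mem_univ, true_and, not_lt]
  refine and_congr_right fun hab => ⟨le_of_lt, fun h => h.lt_of_ne fun h => ?_⟩
  exact hab.ne (σ.injective h)

theorem len_rev : len (Fin.revPerm : Equiv.Perm (Fin n)) = n * (n - 1) / 2 := by
  have := len_rev_mul (1 : Equiv.Perm (Fin n))
  rwa [mul_one, len_one, add_zero] at this

/-! ### Relations between the Demazure–Lustig operators -/

/-- The form of `T` free of divided differences. Relations between these operators are checked after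
multiplying by such factors, which are cancelled afterwards. -/
theorem X_sub_mul_T (i : Fin (n - 1)) (g : Poly n) :
    (X (lo i) - X (hi i)) * T i g
      = (1 - C t) * X (hi i) * g + (C t * X (lo i) - X (hi i)) * sOp i g := by
  rw [T_apply]
  linear_combination (C t * X (lo i) - X (hi i)) * mul_divDiff i g

theorem sOp_X (i : Fin (n - 1)) (j : Fin n) : sOp i (X j : Poly n) = X (adjSwap i j) := by
  simp [sOp]

theorem sOp_C (i : Fin (n - 1)) (c : QT) : sOp i (C c : Poly n) = C c := by
  simp [sOp]

theorem sOp_one (i : Fin (n - 1)) : sOp i (1 : Poly n) = 1 := by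
  simp [sOp]

theorem sOp_comm {i j : Fin (n - 1)} (h : (i : ℕ) + 1 < j) (f : Poly n) :
    sOp i (sOp j f) = sOp j (sOp i f) := by
  have := congrArg (fun σ : Equiv.Perm (Fin n) => rename σ f) (adjSwap_comm h)
  simpa [sOp, rename_rename, Equiv.Perm.coe_mul] using this

theorem sOp_braid {i j : Fin (n - 1)} (h : (j : ℕ) = i + 1) (f : Poly n) :
    sOp i (sOp j (sOp i f)) = sOp j (sOp i (sOp j f)) := by
  have := congrArg (fun σ : Equiv.Perm (Fin n) => rename σ f) (adjSwap_braid h)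
  simpa [sOp, rename_rename, Equiv.Perm.coe_mul, Function.comp_assoc] using this

theorem T_comm {i j : Fin (n - 1)} (h : (i : ℕ) + 1 < j) : T i * T j = T j * T i := by
  refine LinearMap.ext fun f => ?_
  have e1 : adjSwap i (lo j) = lo j :=
    adjSwap_of_ne (by simp [lo, Fin.ext_iff]; omega) (by simp [lo, hi, Fin.ext_iff]; omega)
  have e2 : adjSwap i (hi j) = hi j :=
    adjSwap_of_ne (by simp [hi, lo, Fin.ext_iff]; omega) (by simp [hi, Fin.ext_iff]; omega)
  have e3 : adjSwap j (lo i) = lo i :=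
    adjSwap_of_ne (by simp [lo, Fin.ext_iff]; omega) (by simp [lo, hi, Fin.ext_iff]; omega)
  have e4 : adjSwap j (hi i) = hi i :=
    adjSwap_of_ne (by simp [hi, lo, Fin.ext_iff]; omega) (by simp [hi, Fin.ext_iff]; omega)
  have h1 := X_sub_mul_T i (T j f)
  have h2 := X_sub_mul_T j f
  have h3 := congrArg (sOp i) h2
  have k1 := X_sub_mul_T j (T i f)
  have k2 := X_sub_mul_T i f
  have k3 := congrArg (sOp j) k2
  simp only [sOp_mul, map_add, map_sub, sOp_X, sOp_C, sOp_one, e1, e2] at h3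
  simp only [sOp_mul, map_add, map_sub, sOp_X, sOp_C, sOp_one, e3, e4] at k3
  rw [sOp_comm h] at h3
  apply mul_left_cancel₀ (X_sub_X_ne_zero i)
  apply mul_left_cancel₀ (X_sub_X_ne_zero j)
  simp only [Module.End.mul_apply]
  linear_combination (X (lo j) - X (hi j)) * h1 + (1 - C t) * X (hi i) * h2
    + (C t * X (lo i) - X (hi i)) * h3 - (X (lo i) - X (hi i)) * k1 - (1 - C t) * X (hi j) * k2
    - (C t * X (lo j) - X (hi j)) * k3

/-- The braid relation as an identity of rational functions. The subscripts of `f` list the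
transpositions applied to it, so `f₁₂` is `s₁ s₂ f`. The chain `h`, `g`, `l` stands for `T₁ f`, `T₂
T₁ f`, `T₁ T₂ T₁ f`, and `k`, `m`, `r` for the opposite chain. Both ends expand over the six
permuted copies of `f` with equal coefficients. -/
theorem braid_identity {K : Type*} [Field K] {x y z : K} (hxy : x - y ≠ 0) (hyz : y - z ≠ 0)
    (hxz : x - z ≠ 0) (t f f₁ f₂ f₁₂ f₂₁ f₁₂₁ : K) {h h₁ h₂ h₁₂ g g₁ l k k₁ k₂ k₂₁ m m₂ r : K}
    (eh : (x - y) * h = (1 - t) * y * f + (t * x - y) * f₁)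
    (eh₁ : (y - x) * h₁ = (1 - t) * x * f₁ + (t * y - x) * f)
    (eh₂ : (x - z) * h₂ = (1 - t) * z * f₂ + (t * x - z) * f₂₁)
    (eh₁₂ : (y - z) * h₁₂ = (1 - t) * z * f₁₂ + (t * y - z) * f₁₂₁)
    (eg : (y - z) * g = (1 - t) * z * h + (t * y - z) * h₂)
    (eg₁ : (x - z) * g₁ = (1 - t) * z * h₁ + (t * x - z) * h₁₂)
    (el : (x - y) * l = (1 - t) * y * g + (t * x - y) * g₁)
    (ek : (y - z) * k = (1 - t) * z * f + (t * y - z) * f₂)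
    (ek₂ : (z - y) * k₂ = (1 - t) * y * f₂ + (t * z - y) * f)
    (ek₁ : (x - z) * k₁ = (1 - t) * z * f₁ + (t * x - z) * f₁₂)
    (ek₂₁ : (x - y) * k₂₁ = (1 - t) * y * f₂₁ + (t * x - y) * f₁₂₁)
    (em : (x - y) * m = (1 - t) * y * k + (t * x - y) * k₁)
    (em₂ : (x - z) * m₂ = (1 - t) * z * k₂ + (t * x - z) * k₂₁)
    (er : (y - z) * r = (1 - t) * z * m + (t * y - z) * m₂) : l = r := by
  have hyx : y - x ≠ 0 := fun hh => hxy (by linear_combination -hh)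
  have hzy : z - y ≠ 0 := fun hh => hyz (by linear_combination -hh)
  rw [mul_comm, ← eq_div_iff (by assumption)] at eh eh₁ eh₂ eh₁₂ eg eg₁ el ek ek₂ ek₁ ek₂₁ em em₂ er
  subst eh eh₁ eh₂ eh₁₂ ek ek₁ ek₂ ek₂₁ 
  subst eg eg₁ em em₂
  subst el er
  have e1 : y - x = -(x - y) := by ring
  have e2 : z - y = -(y - z) := by ring
  rw [e1, e2]
  field_simp
  ring

theorem T_braid {i j : Fin (n - 1)} (h : (j : ℕ) = i + 1) :
    T i * T j * T i = T j * T i * T j := by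
  refine LinearMap.ext fun f => ?_
  have hlj : lo j = hi i := by simp [lo, hi, h]
  have e1 : adjSwap i (hi j) = hi j :=
    adjSwap_of_ne (by simp [hi, lo, Fin.ext_iff]; omega) (by simp [hi, Fin.ext_iff]; omega)
  have e2 : adjSwap j (lo i) = lo i :=
    adjSwap_of_ne (by simp [lo, Fin.ext_iff]; omega) (by simp [lo, hi, Fin.ext_iff]; omega)
  have e3 : adjSwap j (hi i) = hi j := by rw [← hlj, adjSwap_lo]
  have e4 : adjSwap j (hi j) = hi i := by rw [adjSwap_hi, hlj]
  have hne : lo i ≠ hi j := by simp [hi, lo, Fin.ext_iff]; omega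
  -- All defining equations, together with their images under the transpositions, are moved to the
  -- field of fractions, where the differences of variables can be inverted.
  let φ := algebraMap (Poly n) (FractionRing (Poly n))
  have hφ : Function.Injective φ := IsFractionRing.injective _ _
  have ne : ∀ {a b : Fin n}, a ≠ b → φ (X a) - φ (X b) ≠ 0 := by
    intro a b hab h0
    exact hab (MvPolynomial.X_injective (hφ (sub_eq_zero.mp h0)))
  have Ti := fun g => congrArg φ (X_sub_mul_T i g)
  have Tj := fun g => congrArg φ (X_sub_mul_T j g)
  have sTi := fun (k : Fin (n - 1)) g => congrArg (fun p => φ (sOp k p)) (X_sub_mul_T i g)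
  have sTj := fun (k : Fin (n - 1)) g => congrArg (fun p => φ (sOp k p)) (X_sub_mul_T j g)
  have ssTi := fun g => congrArg (fun p => φ (sOp i (sOp j p))) (X_sub_mul_T i g)
  have ssTj := fun g => congrArg (fun p => φ (sOp j (sOp i p))) (X_sub_mul_T j g)
  simp only [hlj, map_mul, map_add, map_sub, map_one, sOp_mul, sOp_X, sOp_C, sOp_one, e1, e2, e3,
    e4] at Ti Tj sTi sTj ssTi ssTj
  have sTii := sTi i
  have sTij := sTi j
  have sTji := sTj i
  have sTjj := sTj j
  simp only [e1, e2, e3, e4, adjSwap_lo, adjSwap_hi, sOp_sOp] at sTii sTij sTji sTjj ssTi ssTj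
  apply hφ
  simp only [Module.End.mul_apply]
  exact braid_identity (ne (lo_ne_hi i)) (ne (hlj ▸ lo_ne_hi j)) (ne hne) (φ (C t)) _ _ _ _ _ _
    (Ti f) (sTii f) (sTij f) (ssTi f) (Tj _) (sTji _) (Ti _) (Tj f) (sTjj f) (sTji f)
    (by rw [sOp_braid h]; exact ssTj f) (Ti _) (sTij _) (Tj _)

theorem Tperm_eq {w : List (Fin (n - 1))} {σ : Equiv.Perm (Fin n)} (hw : IsReducedWord w σ) :
    Tperm σ = (w.map T).prod :=
  prod_map_eq_of_isReducedWord T (fun _ _ => T_braid) (fun _ _ => T_comm)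
    (reducedWord_spec σ) hw

theorem Tperm_mul_T {σ : Equiv.Perm (Fin n)} {i : Fin (n - 1)} (h : σ (lo i) < σ (hi i)) :
    Tperm σ * T i = Tperm (σ * adjSwap i) := by
  have hw : IsReducedWord (reducedWord σ ++ [i]) (σ * adjSwap i) := by
    refine IsReducedWord.snoc ?_ (by simpa [adjSwap_lo, adjSwap_hi] using h)
    rw [mul_assoc, adjSwap_mul_self, mul_one]
    exact reducedWord_spec σ
  rw [Tperm_eq hw, Tperm, List.map_append, List.prod_append]
  simp

theorem adjSwap_inv (i : Fin (n - 1)) : (adjSwap i)⁻¹ = adjSwap i := Equiv.swap_inv _ _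

theorem T_mul_Tperm {σ : Equiv.Perm (Fin n)} {i : Fin (n - 1)}
    (h : len (adjSwap i * σ) = len σ + 1) : T i * Tperm σ = Tperm (adjSwap i * σ) := by
  have hs := isReducedWord_iff.mp (reducedWord_spec σ)
  have hw : IsReducedWord (i :: reducedWord σ) (adjSwap i * σ) := by
    rw [isReducedWord_iff]
    exact ⟨by rw [List.map_cons, List.prod_cons, hs.1], by rw [List.length_cons, hs.2, h]⟩
  rw [Tperm_eq hw, Tperm, List.map_cons, List.prod_cons]

theorem len_adjSwap_mul_or (i : Fin (n - 1)) (σ : Equiv.Perm (Fin n)) :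
    len (adjSwap i * σ) = len σ + 1 ∨ len σ = len (adjSwap i * σ) + 1 := by
  rw [← len_inv (adjSwap i * σ), ← len_inv σ, mul_inv_rev, adjSwap_inv]
  exact (lt_or_gt_adj σ⁻¹ i).imp len_mul_adjSwap fun h => (len_mul_adjSwap_of_gt h).symm

/-! ### The symmetrizers `∑_σ a^{l(σ)} T_σ` -/

/-- The operator `∑_σ a^{l(σ)} T_σ`. -/
def symmetrizer (n : ℕ) (a : QT) : Op n := ∑ σ : Equiv.Perm (Fin n), a ^ len σ • Tperm σ

theorem Uplus_eq : Uplus n = symmetrizer n 1 := by simp [Uplus, symmetrizer]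

theorem Uminus_eq : Uminus n = symmetrizer n (-t)⁻¹ := by
  simp only [Uminus, symmetrizer, zpow_neg, zpow_natCast, inv_pow]

/-- The pair `(a, χ)` is `(1, t)` or `(-t⁻¹, -1)`: the symmetrizer with parameter `a` spans the
one-dimensional representation of the Hecke algebra in which every `Tᵢ` acts by `χ`. -/
def IsCharPair (a χ : QT) : Prop := (a = 1 ∧ χ = t) ∨ (a = (-t)⁻¹ ∧ χ = -1)

theorem IsCharPair.eq_mul {a χ : QT} (h : IsCharPair a χ) : χ = a * t := by
  have := t_ne_zero
  rcases h with ⟨rfl, rfl⟩ | ⟨rfl, rfl⟩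
  · simp
  · field_simp

theorem IsCharPair.eq_add {a χ : QT} (h : IsCharPair a χ) : 1 + a * (t - 1) = χ * a := by
  have := t_ne_zero
  rcases h with ⟨rfl, rfl⟩ | ⟨rfl, rfl⟩
  · ring
  · field_simp
    ring

theorem IsCharPair.ne_zero {a χ : QT} (h : IsCharPair a χ) : χ ≠ 0 := by
  rcases h with ⟨rfl, rfl⟩ | ⟨rfl, rfl⟩
  · exact t_ne_zero
  · simp

theorem IsCharPair.bar {a χ : QT} (h : IsCharPair a χ) : (bar χ)⁻¹ = χ := by
  rcases h with ⟨rfl, rfl⟩ | ⟨rfl, rfl⟩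
  · simp [bar_t]
  · simp

theorem isCharPair_plus : IsCharPair 1 t := Or.inl ⟨rfl, rfl⟩

theorem isCharPair_minus : IsCharPair (-t)⁻¹ (-1) := Or.inr ⟨rfl, rfl⟩

/-- Permutations are paired by `σ ↦ σ sᵢ`. By the quadratic relation each pair contributes a
combination of `T_σ` and `T_σ Tᵢ`, whose two coefficients vanish exactly by `IsCharPair.eq_mul` and
`IsCharPair.eq_add`. -/
theorem IsCharPair.symmetrizer_mul_T {a χ : QT} (h : IsCharPair a χ) (i : Fin (n - 1)) :
    symmetrizer n a * T i = χ • symmetrizer n a := by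
  rw [← sub_eq_zero, symmetrizer, Finset.sum_mul, Finset.smul_sum]
  refine (Finset.sum_sub_distrib (fun σ : Equiv.Perm (Fin n) => a ^ len σ • Tperm σ * T i)
    (fun σ => χ • a ^ len σ • Tperm σ)).symm.trans ?_
  have key : ∀ σ : Equiv.Perm (Fin n), σ (lo i) < σ (hi i) →
      (a ^ len σ • Tperm σ * T i - χ • a ^ len σ • Tperm σ) +
        (a ^ len (σ * adjSwap i) • Tperm (σ * adjSwap i) * T i
          - χ • a ^ len (σ * adjSwap i) • Tperm (σ * adjSwap i)) = 0 := by
    intro σ hσ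
    rw [len_mul_adjSwap hσ, ← Tperm_mul_T hσ]
    have h1 : Tperm σ * T i * T i = (t - 1) • (Tperm σ * T i) + t • Tperm σ := by
      rw [mul_assoc, T_quadratic, mul_add, mul_smul_comm, mul_smul_comm, mul_one]
    simp only [smul_mul_assoc, h1]
    have e1 := h.eq_add
    have e2 := h.eq_mul
    have e3 : a ^ len σ + a ^ (len σ + 1) * (t - 1) - χ * a ^ (len σ + 1) = 0 := by
      linear_combination a ^ len σ * e1
    have e4 : -(χ * a ^ len σ) + a ^ (len σ + 1) * t = 0 := by
      linear_combination -a ^ len σ * e2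
    have e5 := congrArg (C : QT → Poly n) e3
    have e6 := congrArg (C : QT → Poly n) e4
    refine LinearMap.ext fun f => ?_
    simp only [map_add, map_sub, map_mul, map_neg, map_pow, map_one, map_zero] at e5 e6
    simp only [LinearMap.add_apply, LinearMap.sub_apply, LinearMap.smul_apply,
      LinearMap.zero_apply, smul_eq_C_mul, map_sub, map_pow, map_one]
    linear_combination e5 * (Tperm σ * T i) f + e6 * Tperm σ f
  refine Finset.sum_involution (fun σ _ => σ * adjSwap i) ?_ ?_ ?_ ?_
  · intro σ _
    rcases lt_or_gt_adj σ i with hσ | hσ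
    · exact key σ hσ
    · have := key (σ * adjSwap i) (by simpa [adjSwap_lo, adjSwap_hi] using hσ)
      rwa [mul_assoc, adjSwap_mul_self, mul_one, add_comm] at this
  · intro σ _ _ hσ
    have := congrArg (fun τ : Equiv.Perm (Fin n) => τ (lo i)) hσ
    simp only [Equiv.Perm.mul_apply, adjSwap_lo] at this
    exact lo_ne_hi i (σ.injective this).symm
  · simp
  · intro σ _
    rw [mul_assoc, adjSwap_mul_self, mul_one]

theorem IsCharPair.T_mul_symmetrizer {a χ : QT} (h : IsCharPair a χ) (i : Fin (n - 1)) :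
    T i * symmetrizer n a = χ • symmetrizer n a := by
  rw [← sub_eq_zero, symmetrizer, Finset.mul_sum, Finset.smul_sum]
  refine (Finset.sum_sub_distrib (fun σ : Equiv.Perm (Fin n) => T i * a ^ len σ • Tperm σ)
    (fun σ => χ • a ^ len σ • Tperm σ)).symm.trans ?_
  have key : ∀ σ : Equiv.Perm (Fin n), len (adjSwap i * σ) = len σ + 1 →
      (T i * a ^ len σ • Tperm σ - χ • a ^ len σ • Tperm σ) +
        (T i * a ^ len (adjSwap i * σ) • Tperm (adjSwap i * σ)
          - χ • a ^ len (adjSwap i * σ) • Tperm (adjSwap i * σ)) = 0 := by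
    intro σ hσ
    rw [hσ, ← T_mul_Tperm hσ]
    have h1 : T i * (T i * Tperm σ) = (t - 1) • (T i * Tperm σ) + t • Tperm σ := by
      rw [← mul_assoc, T_quadratic, add_mul, smul_mul_assoc, smul_mul_assoc, one_mul]
    simp only [mul_smul_comm, h1]
    have e1 := h.eq_add
    have e2 := h.eq_mul
    have e3 : a ^ len σ + a ^ (len σ + 1) * (t - 1) - χ * a ^ (len σ + 1) = 0 := by
      linear_combination a ^ len σ * e1
    have e4 : -(χ * a ^ len σ) + a ^ (len σ + 1) * t = 0 := by
      linear_combination -a ^ len σ * e2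
    have e5 := congrArg (C : QT → Poly n) e3
    have e6 := congrArg (C : QT → Poly n) e4
    refine LinearMap.ext fun f => ?_
    simp only [map_add, map_sub, map_mul, map_neg, map_pow, map_one, map_zero] at e5 e6
    simp only [LinearMap.add_apply, LinearMap.sub_apply, LinearMap.smul_apply,
      LinearMap.zero_apply, smul_eq_C_mul, map_sub, map_pow, map_one]
    linear_combination e5 * (T i * Tperm σ) f + e6 * Tperm σ f
  refine Finset.sum_involution (fun σ _ => adjSwap i * σ) ?_ ?_ ?_ ?_
  · intro σ _
    rcases len_adjSwap_mul_or i σ with hσ | hσ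
    · exact key σ hσ
    · have := key (adjSwap i * σ) (by rw [← mul_assoc, adjSwap_mul_self, one_mul, hσ])
      rwa [← mul_assoc, adjSwap_mul_self, one_mul, add_comm] at this
  · intro σ _ _ hσ
    rcases len_adjSwap_mul_or i σ with h | h <;> rw [hσ] at h <;> omega
  · simp
  · intro σ _
    rw [← mul_assoc, adjSwap_mul_self, one_mul]

/-! ### Hats of operators -/

theorem hatOp_apply (A : Op n) (f : Poly n) : hatOp A f = hat (A (hat f)) := rfl

theorem hatOp_mul (A B : Op n) : hatOp (A * B) = hatOp A * hatOp B := by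
  refine LinearMap.ext fun f => ?_
  simp [hatOp_apply, hat_hat]

theorem hatOp_one : hatOp (1 : Op n) = 1 := by
  refine LinearMap.ext fun f => ?_
  simp [hatOp_apply, hat_hat]

theorem hatOp_smul (c : QT) (A : Op n) : hatOp (c • A) = bar c • hatOp A := by
  refine LinearMap.ext fun f => ?_
  simp [hatOp_apply, hat_smul]

theorem hatOp_sum {ι : Type*} (s : Finset ι) (A : ι → Op n) :
    hatOp (∑ i ∈ s, A i) = ∑ i ∈ s, hatOp (A i) := by
  refine LinearMap.ext fun f => ?_
  simp [hatOp_apply, LinearMap.sum_apply]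

theorem hatOp_hatOp (A : Op n) : hatOp (hatOp A) = A := by
  refine LinearMap.ext fun f => ?_
  simp [hatOp_apply, hat_hat]

theorem hatOp_list_prod (l : List (Op n)) : hatOp l.prod = (l.map hatOp).prod := by
  induction l with
  | nil => exact hatOp_one
  | cons A l ih => rw [List.prod_cons, hatOp_mul, ih, List.map_cons, List.prod_cons]

theorem rev_lo (i : Fin (n - 1)) : (lo i).rev = hi i.rev := by
  simp only [lo, hi, Fin.ext_iff, Fin.val_rev]; omega

theorem rev_hi (i : Fin (n - 1)) : (hi i).rev = lo i.rev := by
  simp only [lo, hi, Fin.ext_iff, Fin.val_rev]; omega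

theorem rev_adjSwap (i : Fin (n - 1)) (a : Fin n) :
    (adjSwap i a).rev = adjSwap i.rev a.rev := by
  simp only [Fin.ext_iff, Fin.val_rev, adjSwap_val]
  split_ifs <;> omega

theorem hat_sOp (i : Fin (n - 1)) (f : Poly n) : hat (sOp i f) = sOp i.rev (hat f) := by
  have h : (hat.comp (rename (adjSwap i) : Poly n →ₐ[QT] Poly n).toRingHom : Poly n →+* Poly n) =
      (rename (adjSwap i.rev) : Poly n →ₐ[QT] Poly n).toRingHom.comp hat := by
    apply MvPolynomial.ringHom_ext
    · intro c
      simp [hat_C]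
    · intro a
      simp [hat_X, rev_adjSwap]
  exact congrArg (fun g : Poly n →+* Poly n => g f) h

/-- Reversal exchanges the roles of the two variables involved. Together with `t ↦ t⁻¹` this turns
the formula for `T` into the one for the inverse given by the quadratic relation. -/
theorem hatOp_T (i : Fin (n - 1)) : hatOp (T i) = Tinv i.rev := by
  refine LinearMap.ext fun f => ?_
  have h1 := congrArg hat (X_sub_mul_T i (hat f))
  have h2 := X_sub_mul_T i.rev f
  have ht : (C t : Poly n) * C t⁻¹ = 1 := by
    rw [← C_mul, mul_inv_cancel₀ t_ne_zero, C_1]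
  simp only [map_mul, map_add, map_sub, map_one, hat_X, hat_C, bar_t, rev_lo, rev_hi, hat_sOp,
    hat_hat] at h1
  rw [hatOp_apply]
  apply mul_left_cancel₀ (X_sub_X_ne_zero i.rev)
  simp only [Tinv, LinearMap.add_apply, LinearMap.smul_apply, Module.End.one_apply,
    smul_eq_C_mul, map_sub, map_one]
  linear_combination -h1 - C t⁻¹ * h2 - (sOp i.rev f * X (lo i.rev) - X (hi i.rev) * f) * ht

theorem hatOp_Tinv (i : Fin (n - 1)) : hatOp (Tinv i) = T i.rev := by
  rw [← hatOp_hatOp (T i.rev), hatOp_T, Fin.rev_rev]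

theorem smul_Tinv_eq {χ : QT} (hχ : χ ≠ 0) {A : Op n} {i : Fin (n - 1)}
    (h : T i * A = χ • A) : Tinv i * A = χ⁻¹ • A := by
  rw [← inv_smul_smul₀ hχ (Tinv i * A), ← mul_smul_comm, ← h, ← mul_assoc, Tinv_mul_T, one_mul]

theorem mul_Tinv_eq {χ : QT} (hχ : χ ≠ 0) {A : Op n} {i : Fin (n - 1)}
    (h : A * T i = χ • A) : A * Tinv i = χ⁻¹ • A := by
  rw [← inv_smul_smul₀ hχ (A * Tinv i), ← smul_mul_assoc, ← h, mul_assoc, T_mul_Tinv, mul_one]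

theorem Tperm_mul_eq {χ : QT} {A : Op n} (h : ∀ i, T i * A = χ • A) (σ : Equiv.Perm (Fin n)) :
    Tperm σ * A = χ ^ len σ • A := by
  rw [Tperm, ← (isReducedWord_iff.mp (reducedWord_spec σ)).2]
  induction reducedWord σ with
  | nil => simp
  | cons i w ih =>
    rw [List.map_cons, List.prod_cons, mul_assoc, ih, mul_smul_comm, h, smul_smul,
      List.length_cons, pow_succ]

theorem mul_hatOp_Tperm_eq {χ : QT} (hχ : χ ≠ 0) {A : Op n} (h : ∀ i, A * T i = χ • A)
    (σ : Equiv.Perm (Fin n)) : A * hatOp (Tperm σ) = χ⁻¹ ^ len σ • A := by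
  rw [Tperm, hatOp_list_prod, ← (isReducedWord_iff.mp (reducedWord_spec σ)).2]
  induction reducedWord σ with
  | nil => simp
  | cons i w ih =>
    rw [List.map_cons, List.map_cons, List.prod_cons, ← mul_assoc, hatOp_T,
      mul_Tinv_eq hχ (h i.rev), smul_mul_assoc, ih, smul_smul, List.length_cons, pow_succ']

/-- The Poincaré polynomial `∑_σ c^{l(σ)}`. -/
def poincare (n : ℕ) (c : QT) : QT := ∑ σ : Equiv.Perm (Fin n), c ^ len σ

/-- At `t = 1` the Poincaré polynomial takes the value `n!`. -/
theorem poincare_t_ne_zero : poincare n t ≠ 0 := by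
  intro h
  have h1 : poincare n t = algebraMap (MvPolynomial (Fin 2) ℚ) QT
      (∑ σ : Equiv.Perm (Fin n), X 1 ^ len σ) := by
    simp [poincare, t]
  rw [h1] at h
  have h2 := IsFractionRing.injective (MvPolynomial (Fin 2) ℚ) QT (h.trans (map_zero _).symm)
  have h3 := congrArg (eval fun _ => (1 : ℚ)) h2
  simp [Fintype.card_perm, Nat.factorial_ne_zero] at h3

/-- Left multiplication by the longest permutation replaces each length by its complement. -/
theorem poincare_t_inv : poincare n t⁻¹ = (t ^ (n * (n - 1) / 2))⁻¹ * poincare n t := by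
  rw [poincare, poincare, Finset.mul_sum, ← Equiv.sum_comp (Equiv.mulLeft Fin.revPerm)]
  refine Finset.sum_congr rfl fun σ _ => ?_
  rw [← len_rev_mul σ, Equiv.coe_mulLeft, pow_add, inv_pow]
  have := t_ne_zero
  field_simp

theorem IsCharPair.symmetrizer_mul_eq {a χ : QT} {A : Op n} (h : ∀ i, T i * A = χ • A) :
    symmetrizer n a * A = poincare n (a * χ) • A := by
  simp only [symmetrizer, poincare, Finset.sum_mul, Finset.sum_smul, smul_mul_assoc,
    Tperm_mul_eq h, smul_smul, mul_pow]

/-- Both sides are the product of the symmetrizer with its hat. The `T_σ` of the left factor act on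
the hat by powers of `χ`. The hats of the `T_σ` in the right factor are products of inverse
generators and act on the symmetrizer by powers of `χ⁻¹`. -/
theorem IsCharPair.symmetrizer_hat {a χ : QT} (h : IsCharPair a χ) :
    poincare n (a * χ) • hatOp (symmetrizer n a)
      = poincare n (Macdonald.bar a * χ⁻¹) • symmetrizer n a := by
  rw [← symmetrizer_mul_eq (a := a)]
  · conv_lhs => enter [2]; rw [symmetrizer]
    simp only [hatOp_sum, hatOp_smul, Finset.mul_sum, mul_smul_comm,
      mul_hatOp_Tperm_eq h.ne_zero h.symmetrizer_mul_T, smul_smul, poincare, Finset.sum_smul,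
      mul_pow, map_pow]
  · intro i
    rw [← Fin.rev_rev i, ← hatOp_Tinv, ← hatOp_mul,
      smul_Tinv_eq h.ne_zero (h.T_mul_symmetrizer _), hatOp_smul, map_inv₀, h.bar]

theorem hatOp_Uplus : hatOp (Uplus n) = t ^ (-((n * (n - 1) / 2 : ℕ) : ℤ)) • Uplus n := by
  have h := isCharPair_plus.symmetrizer_hat (n := n)
  rw [map_one, one_mul, one_mul, poincare_t_inv, mul_comm, mul_smul] at h
  rw [Uplus_eq, zpow_neg, zpow_natCast]
  exact smul_right_injective _ poincare_t_ne_zero h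

theorem hatOp_Uminus : hatOp (Uminus n) = t ^ (n * (n - 1) / 2) • Uminus n := by
  have h := isCharPair_minus.symmetrizer_hat (n := n)
  have h1 : (-t)⁻¹ * (-1) = t⁻¹ := by rw [inv_neg, neg_mul_neg, mul_one]
  have h2 : bar (-t)⁻¹ * (-1 : QT)⁻¹ = t := by
    rw [map_inv₀, map_neg, bar_t, inv_neg, inv_inv, inv_neg, inv_one, neg_mul_neg, mul_one]
  rw [h1, h2, poincare_t_inv] at h
  rw [Uminus_eq]
  apply smul_right_injective _ poincare_t_ne_zero
  have ht := t_ne_zero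
  simp only
  rw [smul_comm, ← h, smul_smul, ← mul_assoc, mul_inv_cancel₀ (pow_ne_zero _ ht), one_mul]

/-! ### Ordered products over initial and final segments -/

/-- The product of the `F j` with `j < k`, in increasing order. -/
def belowProd {M : Type*} [Monoid M] (F : Fin (n - 1) → M) (k : ℕ) : M :=
  (((List.finRange (n - 1)).filter fun j : Fin (n - 1) => (j : ℕ) < k).map F).prod

/-- The product of the `F j` with `k ≤ j`, in increasing order. -/
def aboveProd {M : Type*} [Monoid M] (F : Fin (n - 1) → M) (k : ℕ) : M :=
  (((List.finRange (n - 1)).filter fun j : Fin (n - 1) => k ≤ (j : ℕ)).map F).prod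

section Products

variable {M : Type*} [Monoid M] (F : Fin (n - 1) → M)

theorem belowProd_zero : belowProd F 0 = 1 := by simp [belowProd]

theorem belowProd_top {k : ℕ} (hk : n - 1 ≤ k) :
    belowProd F k = ((List.finRange (n - 1)).map F).prod := by
  rw [belowProd, List.filter_eq_self.mpr]
  intro a _
  simp only [decide_eq_true_eq]
  omega

theorem aboveProd_top {k : ℕ} (hk : n - 1 ≤ k) : aboveProd F k = 1 := by
  rw [aboveProd, List.filter_eq_nil_iff.mpr]
  · rfl
  · intro a _
    simp only [decide_eq_true_eq]
    omega

theorem belowProd_succ (k : Fin (n - 1)) {l : ℕ} (hl : l = k + 1) :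
    belowProd F l = belowProd F k * F k := by
  subst hl
  have : (List.finRange (n - 1)).filter (fun j : Fin (n - 1) => (j : ℕ) < k + 1) =
      (List.finRange (n - 1)).filter (fun j : Fin (n - 1) => (j : ℕ) < k) ++ [k] := by
    apply List.Subset.antisymm_of_sortedLT
    · intro a
      simp only [List.mem_filter, List.mem_finRange, true_and, decide_eq_true_eq, List.mem_append,
        List.mem_singleton, Fin.ext_iff]
      omega
    · intro a
      simp only [List.mem_filter, List.mem_finRange, true_and, decide_eq_true_eq, List.mem_append,
        List.mem_singleton, Fin.ext_iff]
      omega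
    · exact ((List.pairwise_lt_finRange _).filter _).sortedLT
    · refine List.Pairwise.sortedLT ?_
      rw [List.pairwise_append]
      refine ⟨(List.pairwise_lt_finRange _).filter _, List.pairwise_singleton _ _, ?_⟩
      intro a ha b hb
      rw [List.mem_singleton.mp hb]
      exact Fin.lt_def.mpr (by simpa using ha)
  rw [belowProd, this, List.map_append, List.prod_append]
  simp [belowProd]

theorem aboveProd_eq (k : Fin (n - 1)) {l : ℕ} (hl : l = k + 1) :
    aboveProd F k = F k * aboveProd F l := by
  subst hl
  have : (List.finRange (n - 1)).filter (fun j : Fin (n - 1) => (k : ℕ) ≤ j) =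
      k :: (List.finRange (n - 1)).filter (fun j : Fin (n - 1) => (k : ℕ) + 1 ≤ j) := by
    apply List.Subset.antisymm_of_sortedLT
    · intro a
      simp only [List.mem_filter, List.mem_finRange, true_and, decide_eq_true_eq, List.mem_cons,
        Fin.ext_iff]
      omega
    · intro a
      simp only [List.mem_filter, List.mem_finRange, true_and, decide_eq_true_eq, List.mem_cons,
        Fin.ext_iff]
      omega
    · exact ((List.pairwise_lt_finRange _).filter _).sortedLT
    · refine List.Pairwise.sortedLT ?_
      rw [List.pairwise_cons]
      refine ⟨?_, (List.pairwise_lt_finRange _).filter _⟩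
      intro a ha
      exact Fin.lt_def.mpr (by simpa using ha)
  rw [aboveProd, this, List.map_cons, List.prod_cons, aboveProd]

theorem belowProd_mul_aboveProd {k : ℕ} (hk : k ≤ n - 1) :
    belowProd F k * aboveProd F k = aboveProd F 0 := by
  induction k with
  | zero => rw [belowProd_zero, one_mul]
  | succ k ih =>
    rw [← ih (by omega), belowProd_succ F ⟨k, hk⟩ rfl, mul_assoc, ← aboveProd_eq F ⟨k, hk⟩ rfl]

theorem belowProd_induction {p : M → Prop} (h1 : p 1) (hmul : ∀ a b, p a → p b → p (a * b))
    (k : ℕ) (hF : ∀ j : Fin (n - 1), (j : ℕ) < k → p (F j)) : p (belowProd F k) := by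
  apply List.prod_induction p hmul h1
  intro a ha
  obtain ⟨j, hj, rfl⟩ := List.mem_map.mp ha
  exact hF j (by simpa using hj)

theorem aboveProd_induction {p : M → Prop} (h1 : p 1) (hmul : ∀ a b, p a → p b → p (a * b))
    (k : ℕ) (hF : ∀ j : Fin (n - 1), k ≤ j → p (F j)) : p (aboveProd F k) := by
  apply List.prod_induction p hmul h1
  intro a ha
  obtain ⟨j, hj, rfl⟩ := List.mem_map.mp ha
  exact hF j (by simpa using hj)

theorem commute_belowProd {A : M} {k : ℕ} (hF : ∀ j : Fin (n - 1), (j : ℕ) < k → Commute A (F j)) :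
    Commute A (belowProd F k) :=
  belowProd_induction F (p := Commute A) (Commute.one_right A) (fun _ _ => Commute.mul_right) k hF

theorem commute_aboveProd {A : M} {k : ℕ} (hF : ∀ j : Fin (n - 1), k ≤ j → Commute A (F j)) :
    Commute A (aboveProd F k) :=
  aboveProd_induction F (p := Commute A) (Commute.one_right A) (fun _ _ => Commute.mul_right) k hF

end Products

theorem T_commute_T {i j : Fin (n - 1)} (h : (i : ℕ) + 1 < j ∨ (j : ℕ) + 1 < i) :
    Commute (T i) (T j) :=
  h.elim (fun h => T_comm h) fun h => (T_comm h).symm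

theorem Commute.Tinv_right {A : Op n} {i : Fin (n - 1)} (h : Commute A (T i)) :
    Commute A (Tinv i) :=
  ((Commute.one_right A).smul_right _).add_right (h.smul_right _)

theorem T_Tinv_Tinv {i j : Fin (n - 1)} (h : T i * T j * T i = T j * T i * T j) :
    T i * (Tinv j * Tinv i) = Tinv j * Tinv i * T j := by
  have h1 : ∀ A : Op n, Tinv j * (Tinv i * (T i * (T j * A))) = A := by
    intro A
    rw [← mul_assoc (Tinv i), Tinv_mul_T, one_mul, ← mul_assoc, Tinv_mul_T, one_mul]
  rw [← h1 (T i * (Tinv j * Tinv i)), ← mul_assoc (T j), ← mul_assoc (T i), ← mul_assoc (T i), h,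
    mul_assoc _ (T j), ← mul_assoc (T j) (Tinv j), T_mul_Tinv, one_mul, mul_assoc, T_mul_Tinv,
    mul_one, mul_assoc]

/-- A generator slides through the full ordered product by one braid move, losing one in its index.
Passing `ω` restores the index, which is why `Y 0` commutes with all generators but the first. -/
theorem T_mul_aboveProd {i j : Fin (n - 1)} (h : (j : ℕ) = i + 1) :
    T j * aboveProd T 0 = aboveProd T 0 * T i := by
  rw [← belowProd_mul_aboveProd T (k := i) (by omega), aboveProd_eq T i h,
    aboveProd_eq T j rfl]
  have h1 : Commute (T j) (belowProd T i) := commute_belowProd T fun k hk =>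
    T_commute_T (by omega)
  have h2 : Commute (T i) (aboveProd T (j + 1)) := commute_aboveProd T fun k hk =>
    T_commute_T (by omega)
  rw [← mul_assoc, h1.eq, mul_assoc, mul_assoc, mul_assoc, mul_assoc, ← h2.eq]
  simp only [← mul_assoc]
  rw [mul_assoc _ (T j) (T i), mul_assoc _ (T j * T i) (T j), ← T_braid h]
  simp only [mul_assoc]

/-! ### The operator `ω` -/

theorem val_zero_of_neZero [NeZero n] : ((0 : Fin n) : ℕ) = 0 := by simp

/-- The cyclic shift `j ↦ j - 1` of positions. -/
def rotDown [NeZero n] (j : Fin n) : Fin n :=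
  if (j : ℕ) = 0 then ⟨n - 1, Nat.sub_lt (NeZero.pos n) one_pos⟩ else ⟨j - 1, by omega⟩

theorem rotDown_val [NeZero n] (j : Fin n) :
    (rotDown j : ℕ) = if (j : ℕ) = 0 then n - 1 else j - 1 := by
  rw [rotDown]
  split_ifs <;> rfl

theorem belowProd_adjSwap_val {k : ℕ} (hk : k ≤ n - 1) (a : Fin n) :
    (belowProd adjSwap k a : ℕ) = if (a : ℕ) < k then (a : ℕ) + 1 else if (a : ℕ) = k then 0
      else a := by
  induction k generalizing a with
  | zero =>
    rw [belowProd_zero]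
    simp +contextual
  | succ k ih =>
    rw [belowProd_succ adjSwap ⟨k, hk⟩ rfl, Equiv.Perm.mul_apply, ih (by omega),
      adjSwap_val]
    dsimp only
    split_ifs <;> omega

theorem reverse_prod_sOp_apply [NeZero n] (f : Poly n) :
    ((List.finRange (n - 1)).reverse.map sOp).prod f = rename rotDown f := by
  have h1 : ∀ (l : List (Fin (n - 1))) (f : Poly n),
      (l.map sOp).prod f = rename ⇑(l.map adjSwap).prod f := by
    intro l
    induction l with
    | nil => intro f; simp
    | cons i l ih =>
      intro f
      rw [List.map_cons, List.prod_cons, Module.End.mul_apply, ih, List.map_cons, List.prod_cons,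
        Equiv.Perm.coe_mul, ← rename_rename]
      rfl
  rw [h1]
  congr 2
  funext a
  have h2 : ((List.finRange (n - 1)).reverse.map adjSwap).prod =
      (belowProd (adjSwap : Fin (n - 1) → Equiv.Perm (Fin n)) (n - 1))⁻¹ := by
    rw [belowProd_top _ le_rfl, List.prod_inv_reverse, List.map_map, List.map_reverse]
    congr 3
  rw [h2, Equiv.Perm.inv_eq_iff_eq]
  ext
  rw [belowProd_adjSwap_val le_rfl, rotDown_val]
  split_ifs <;> omega

/-- The operator `ω` as an algebra homomorphism. -/
def omegaHom [NeZero n] : Poly n →ₐ[QT] Poly n :=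
  (rename rotDown).comp (aeval (Function.update (X : Fin n → Poly n) 0 (C q * X 0)))

theorem omega_apply [NeZero n] (f : Poly n) : omega f = omegaHom f := by
  rw [omega, Module.End.mul_apply, reverse_prod_sOp_apply]
  rfl

theorem omegaHom_X_zero [NeZero n] : omegaHom (X (0 : Fin n)) = C q * X (rotDown 0) := by
  simp [omegaHom]

theorem omegaHom_X [NeZero n] {a : Fin n} (h : a ≠ 0) : omegaHom (X a) = X (rotDown a) := by
  simp [omegaHom, Function.update_of_ne h]

theorem omegaHom_C [NeZero n] (c : QT) : omegaHom (C c : Poly n) = C c :=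
  AlgHom.commutes _ c

theorem omegaHom_sOp [NeZero n] {i j : Fin (n - 1)} (h : (j : ℕ) = i + 1) (f : Poly n) :
    omegaHom (sOp j f) = sOp i (omegaHom f) := by
  have key : omegaHom.comp (rename (adjSwap j) : Poly n →ₐ[QT] Poly n) =
      (rename (adjSwap i)).comp omegaHom := by
    apply MvPolynomial.algHom_ext
    intro a
    rw [AlgHom.comp_apply, AlgHom.comp_apply, rename_X]
    rcases eq_or_ne a 0 with rfl | ha
    · have h0 : adjSwap j 0 = 0 := by
        apply adjSwap_of_ne <;> rw [Ne, Fin.ext_iff, val_zero_of_neZero] <;> simp only [lo, hi] <;> omega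
      rw [h0, omegaHom_X_zero, map_mul, rename_C, rename_X]
      congr 2
      ext
      simp only [adjSwap_val, rotDown_val, val_zero_of_neZero]
      split_ifs <;> omega
    · have ha' : (a : ℕ) ≠ 0 := fun h => ha (Fin.ext (h.trans val_zero_of_neZero.symm))
      have h1 : adjSwap j a ≠ 0 := by
        rw [Ne, Fin.ext_iff, adjSwap_val, val_zero_of_neZero]
        intro h0
        split_ifs at h0 <;> omega
      rw [omegaHom_X h1, omegaHom_X ha, rename_X]
      congr 1
      ext
      clear h1
      simp only [adjSwap_val, rotDown_val]
      split_ifs <;> first | contradiction | omega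
  exact congrArg (fun g : Poly n →ₐ[QT] Poly n => g f) key

theorem omega_mul_T [NeZero n] {i j : Fin (n - 1)} (h : (j : ℕ) = i + 1) :
    omega * T j = T i * omega := by
  refine LinearMap.ext fun f => ?_
  rw [Module.End.mul_apply, Module.End.mul_apply, omega_apply, omega_apply]
  have h1 := congrArg omegaHom (X_sub_mul_T j f)
  have e1 : omegaHom (X (lo j) : Poly n) = X (lo i) := by
    rw [omegaHom_X (by simp [lo, Fin.ext_iff]; omega)]
    congr 1
    ext
    rw [rotDown_val]
    simp [lo, h]
  have e2 : omegaHom (X (hi j) : Poly n) = X (hi i) := by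
    rw [omegaHom_X (by simp [hi, Fin.ext_iff])]
    congr 1
    ext
    rw [rotDown_val]
    simp [hi, h]
  simp only [map_mul, map_add, map_sub, map_one, omegaHom_C, e1, e2, omegaHom_sOp h] at h1
  apply mul_left_cancel₀ (X_sub_X_ne_zero i)
  rw [h1, X_sub_mul_T]

/-- The wrap-around relation: `ω²` carries the first two variables to the last two, each multiplied
by `q`. As `T` involves only a ratio of linear forms in the two variables, the common factor `q`
cancels. -/
theorem omega_sq_mul_T [NeZero n] {i j : Fin (n - 1)} (hi0 : (i : ℕ) = 0) (hj : (j : ℕ) + 2 = n) :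
    omega * omega * T i = T j * (omega * omega) := by
  have e1 : omegaHom (omegaHom (X (lo i) : Poly n)) = C q * X (lo j) := by
    rw [show lo i = 0 from Fin.ext hi0, omegaHom_X_zero, map_mul, omegaHom_C, omegaHom_X]
    · congr 2
      ext
      rw [rotDown_val, rotDown_val, val_zero_of_neZero]
      simp only [lo]
      split_ifs <;> omega
    · rw [Ne, Fin.ext_iff, rotDown_val, val_zero_of_neZero]
      simp only [if_true]
      omega
  have e2 : omegaHom (omegaHom (X (hi i) : Poly n)) = C q * X (hi j) := by
    rw [omegaHom_X (by simp [hi, Fin.ext_iff]), show rotDown (hi i) = 0 by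
      ext; rw [rotDown_val, val_zero_of_neZero]; simp [hi, hi0], omegaHom_X_zero]
    congr 2
    ext
    rw [rotDown_val]
    simp [hi]
    omega
  have e3 : ∀ f : Poly n, omegaHom (omegaHom (sOp i f)) = sOp j (omegaHom (omegaHom f)) := by
    intro f
    have key : (omegaHom.comp omegaHom).comp (rename (adjSwap i) : Poly n →ₐ[QT] Poly n) =
        (rename (adjSwap j)).comp (omegaHom.comp omegaHom) := by
      apply MvPolynomial.algHom_ext
      intro a
      simp only [AlgHom.comp_apply, rename_X]
      by_cases h1 : a = lo i
      · subst h1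
        rw [adjSwap_lo, e1, e2, map_mul, rename_C, rename_X, adjSwap_lo]
      by_cases h2 : a = hi i
      · subst h2
        rw [adjSwap_hi, e1, e2, map_mul, rename_C, rename_X, adjSwap_hi]
      rw [adjSwap_of_ne h1 h2]
      have h1' : (a : ℕ) ≠ 0 := fun h => h1 (Fin.ext (by simp [lo, h, hi0]))
      have h2' : (a : ℕ) ≠ 1 := fun h => h2 (Fin.ext (by simp [hi, h, hi0]))
      rw [omegaHom_X (fun h => h1' (by rw [h, val_zero_of_neZero])), omegaHom_X, rename_X, adjSwap_of_ne]
      · rw [Ne, Fin.ext_iff, rotDown_val, rotDown_val]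
        simp only [lo]
        split_ifs <;> omega
      · rw [Ne, Fin.ext_iff, rotDown_val, rotDown_val]
        simp only [hi]
        split_ifs <;> omega
      · rw [Ne, Fin.ext_iff, rotDown_val]
        rw [val_zero_of_neZero, if_neg h1']
        omega
    exact congrArg (fun g : Poly n →ₐ[QT] Poly n => g f) key
  refine LinearMap.ext fun f => ?_
  have h1 := congrArg (fun p => omegaHom (omegaHom p)) (X_sub_mul_T i f)
  simp only [map_mul, map_add, map_sub, map_one, omegaHom_C, e1, e2, e3] at h1
  simp only [Module.End.mul_apply, omega_apply]
  apply mul_left_cancel₀ (X_sub_X_ne_zero j)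
  apply mul_left_cancel₀ (show (C q : Poly n) ≠ 0 by simpa using q_ne_zero)
  have h2 := X_sub_mul_T j (omegaHom (omegaHom f))
  linear_combination h1 - C q * h2

theorem rotDown_rev_rotDown [NeZero n] (a : Fin n) : rotDown (rotDown a).rev = a.rev := by
  ext
  simp only [rotDown_val, Fin.val_rev]
  split_ifs <;> omega

/-- Conjugation by the reversal inverts the rotation of the variables, and `q ↦ q⁻¹` inverts the
shift. -/
theorem hatOp_omega_mul_omega [NeZero n] : hatOp omega * omega = (1 : Op n) := by
  refine LinearMap.ext fun f => ?_
  rw [Module.End.mul_apply, hatOp_apply, omega_apply, omega_apply, Module.End.one_apply]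
  have key : (hat.comp (omegaHom : Poly n →ₐ[QT] Poly n).toRingHom).comp
      (hat.comp (omegaHom : Poly n →ₐ[QT] Poly n).toRingHom) = RingHom.id (Poly n) := by
    apply MvPolynomial.ringHom_ext
    · intro c
      simp [hat_C, bar_bar]
    · intro a
      have hrev : ∀ b : Fin n, b.rev = 0 ↔ (b : ℕ) + 1 = n := by
        intro b
        rw [Fin.ext_iff, Fin.val_rev, val_zero_of_neZero]
        omega
      have hq : (C q : Poly n) * C q⁻¹ = 1 := by
        rw [← C_mul, mul_inv_cancel₀ q_ne_zero, C_1]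
      rcases eq_or_ne a 0 with rfl | ha
      · have h1 : (rotDown (0 : Fin n)).rev = 0 := by
          rw [hrev, rotDown_val]
          have := NeZero.pos n
          simp; omega
        have h2 := rotDown_rev_rotDown (0 : Fin n)
        rw [h1] at h2
        simp only [RingHom.comp_apply, AlgHom.toRingHom_eq_coe, RingHom.coe_coe, omegaHom_X_zero,
          map_mul, hat_C, hat_X, omegaHom_C, h2, Fin.rev_rev, RingHom.id_apply, bar_q,
          map_inv₀, inv_inv]
        rw [← mul_assoc, hq, one_mul]
      · have ha' : (a : ℕ) ≠ 0 := fun h => ha (Fin.ext (h.trans val_zero_of_neZero.symm))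
        have h1 : (rotDown a).rev ≠ 0 := by
          rw [Ne, hrev, rotDown_val, if_neg ha']
          omega
        simp only [RingHom.comp_apply, AlgHom.toRingHom_eq_coe, RingHom.coe_coe, omegaHom_X ha,
          hat_X, omegaHom_X h1, rotDown_rev_rotDown, Fin.rev_rev, RingHom.id_apply]
  exact congrArg (fun g : Poly n →+* Poly n => g f) key

theorem omega_mul_hatOp_omega [NeZero n] : omega * hatOp omega = (1 : Op n) := by
  have := congrArg hatOp (hatOp_omega_mul_omega (n := n))
  rwa [hatOp_mul, hatOp_hatOp, hatOp_one] at this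

/-! ### Relations of the Cherednik operators -/

theorem Y_eq [NeZero n] (i : Fin n) :
    Y i = t ^ (-(n : ℤ) + (i : ℤ) + 1) • (aboveProd T i * omega * belowProd Tinv i) := by
  rw [Y, aboveProd, belowProd]

theorem T_mul_Y_mul_T [NeZero n] (i : Fin (n - 1)) :
    T i * Y (hi i) * T i = t • Y (lo i) := by
  rw [Y_eq, Y_eq, mul_smul_comm, smul_mul_assoc, smul_smul]
  have h1 : (hi i : ℕ) = i + 1 := rfl
  have h2 : (lo i : ℕ) = i := rfl
  rw [h2, aboveProd_eq T i h1, belowProd_succ Tinv i h1]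
  refine congrArg₂ (· • ·) ?_ ?_
  · rw [← zpow_one_add₀ t_ne_zero, h1]
    congr 1
    push_cast
    ring
  · simp only [mul_assoc, Tinv_mul_T, mul_one]

theorem Y_hi [NeZero n] (i : Fin (n - 1)) : Y (hi i) = t • (Tinv i * Y (lo i) * Tinv i) := by
  rw [← smul_mul_assoc, ← mul_smul_comm, ← T_mul_Y_mul_T]
  simp only [← mul_assoc, Tinv_mul_T, one_mul]
  rw [mul_assoc, T_mul_Tinv, mul_one]

theorem aboveProd_mul_omega_commute [NeZero n] {i : Fin (n - 1)} (h : (i : ℕ) ≠ 0) :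
    Commute (T i) (aboveProd T 0 * omega) := by
  have hj : (i : ℕ) = (⟨i - 1, by omega⟩ : Fin (n - 1)) + 1 := by simp only; omega
  rw [Commute, SemiconjBy, ← mul_assoc, T_mul_aboveProd hj, mul_assoc, ← omega_mul_T hj, mul_assoc]

theorem Y_zero [NeZero n] :
    Y (0 : Fin n) = t ^ (-(n : ℤ) + 1) • (aboveProd T 0 * omega) := by
  rw [Y_eq, Fin.val_zero, belowProd_zero, mul_one, Nat.cast_zero, add_zero]

/-- Induction on `j`, writing each `Y` as a conjugate-like product of its predecessor through
`Y_hi`. The start is the commutation with `Y 0`. -/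
theorem T_commute_Y [NeZero n] {i : Fin (n - 1)} {j : Fin n} (h1 : j ≠ lo i) (h2 : j ≠ hi i) :
    Commute (T i) (Y j) := by
  obtain ⟨j, hj⟩ := j
  induction j using Nat.strong_induction_on generalizing i with
  | _ j ih =>
  have h1' : j ≠ i := fun h => h1 (Fin.ext h)
  have h2' : j ≠ i + 1 := fun h => h2 (Fin.ext h)
  rcases Nat.eq_zero_or_pos j with rfl | hpos
  · have : (⟨0, hj⟩ : Fin n) = 0 := rfl
    rw [this, Y_zero]
    exact (aboveProd_mul_omega_commute (by omega)).smul_right _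
  let k : Fin (n - 1) := ⟨j - 1, by omega⟩
  have hk : (⟨j, hj⟩ : Fin n) = hi k := by
    ext
    simp only [hi, k]
    omega
  have hlk : lo k = ⟨j - 1, by omega⟩ := rfl
  rw [hk, Y_hi]
  refine Commute.smul_right ?_ _
  -- Only here is the predecessor `Y (hi i)` out of reach of the induction hypothesis. Unfolding
  -- once more to `Y (lo i)`, the braid relation turns `T i` into `T k`, which does commute with `Y
  -- (lo i)`, and then back.
  by_cases hc : j = i + 2
  · have hki : lo k = hi i := by
      ext
      simp only [lo, hi, k]
      omega
    have hb := T_braid (i := i) (j := k) (by simp only [k]; omega)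
    have hY : Commute (T k) (Y (lo i)) := by
      have := ih i (by omega) (i := k) (by omega) (by simp [lo, k, Fin.ext_iff]; omega)
        (by simp [hi, k, Fin.ext_iff]; omega)
      exact this
    rw [hki, Y_hi]
    have key : Commute (T i) (Tinv k * (Tinv i * Y (lo i) * Tinv i) * Tinv k) := by
      rw [Commute, SemiconjBy]
      have e1 := T_Tinv_Tinv hb
      have e2 := T_Tinv_Tinv hb.symm
      calc T i * (Tinv k * (Tinv i * Y (lo i) * Tinv i) * Tinv k)
          = T i * (Tinv k * Tinv i) * Y (lo i) * (Tinv i * Tinv k) := by simp only [mul_assoc]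
        _ = Tinv k * Tinv i * (T k * Y (lo i)) * (Tinv i * Tinv k) := by
            rw [e1]; simp only [mul_assoc]
        _ = Tinv k * Tinv i * Y (lo i) * (T k * (Tinv i * Tinv k)) := by
            rw [hY.eq]; simp only [mul_assoc]
        _ = _ := by rw [e2]; simp only [mul_assoc]
    rw [mul_smul_comm, smul_mul_assoc]
    exact key.smul_right _
  · have hT : Commute (T i) (Tinv k) :=
      Commute.Tinv_right (T_commute_T (by simp only [k]; omega))
    refine (hT.mul_right ?_).mul_right hT
    rw [hlk]
    refine ih (j - 1) (by omega) _ ?_ ?_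
    · simp only [lo, ne_eq, Fin.ext_iff]; omega
    · simp only [hi, ne_eq, Fin.ext_iff]; omega

/-- The operator `∑ᵢ Yᵢ`. -/
def sumY (n : ℕ) [NeZero n] : Op n := ∑ i, Y i

/-- Only the two terms at `lo i` and `hi i` fail to commute with `T i`. Writing the first as `t⁻¹ Tᵢ
Y Tᵢ`, with `Y` the second, the quadratic relation makes their two commutators cancel. -/
theorem T_commute_sumY [NeZero n] (i : Fin (n - 1)) : Commute (T i) (sumY n) := by
  rw [Commute, SemiconjBy, ← sub_eq_zero, sumY, Finset.mul_sum, Finset.sum_mul]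
  refine (Finset.sum_sub_distrib (fun j : Fin n => T i * Y j) (fun j => Y j * T i)).symm.trans ?_
  rw [Finset.sum_eq_add (lo i) (hi i) (lo_ne_hi i)]
  · have h : Y (lo i) = t⁻¹ • (T i * Y (hi i) * T i) := by
      rw [T_mul_Y_mul_T, inv_smul_smul₀ t_ne_zero]
    have e1 : T i * Y (lo i) = t⁻¹ • ((t - 1) • (T i * Y (hi i) * T i) + t • (Y (hi i) * T i)) := by
      rw [h, mul_smul_comm, ← mul_assoc, ← mul_assoc, T_quadratic, add_mul, add_mul,
        smul_mul_assoc, smul_mul_assoc, smul_mul_assoc, smul_mul_assoc, one_mul]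
    have e2 : Y (lo i) * T i = t⁻¹ • ((t - 1) • (T i * Y (hi i) * T i) + t • (T i * Y (hi i))) := by
      rw [h, smul_mul_assoc, mul_assoc _ (T i) (T i), T_quadratic, mul_add, mul_smul_comm,
        mul_smul_comm, mul_one]
    rw [e1, e2, smul_add, smul_add, inv_smul_smul₀ t_ne_zero, inv_smul_smul₀ t_ne_zero]
    abel
  · rintro j - ⟨h1, h2⟩
    rw [sub_eq_zero]
    exact T_commute_Y h1 h2
  · simp
  · simp

/-- Factors cross `ω` one at a time, changing their index by one. -/
theorem belowProd_mul_omega_mul_aboveProd [NeZero n] {k : ℕ} (hk : k + 1 ≤ n - 1) :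
    (belowProd T k * omega * aboveProd T (k + 1) : Op n) = omega * aboveProd T 1 := by
  induction k with
  | zero => rw [belowProd_zero, one_mul]
  | succ k ih =>
    rw [← ih (by omega), belowProd_succ T ⟨k, by omega⟩ rfl,
      aboveProd_eq T (⟨k + 1, by omega⟩ : Fin (n - 1)) rfl, mul_assoc (belowProd T k),
      ← omega_mul_T (i := ⟨k, by omega⟩) (j := ⟨k + 1, by omega⟩) rfl]
    simp only [mul_assoc]

/-- From the second operator on, each further one arises by multiplying with inverse generators that
already commute with `Y 0`. -/
theorem Y_zero_commute_Y [NeZero n] (j : Fin n) : Commute (Y 0) (Y j) := by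
  obtain ⟨j, hj⟩ := j
  induction j with
  | zero => exact Commute.refl (Y (0 : Fin n))
  | succ k ih =>
    have hk : (⟨k + 1, hj⟩ : Fin n) = hi ⟨k, by omega⟩ := rfl
    have hlk : lo ⟨k, by omega⟩ = (⟨k, by omega⟩ : Fin n) := rfl
    rw [hk, Y_hi, hlk]
    refine Commute.smul_right ?_ _
    rcases Nat.eq_zero_or_pos k with rfl | hpos
    -- The first two operators: both orders of the product reduce to the same word in the `T`s
    -- followed by `ω²`, by means of the wrap-around relation.
    · let i : Fin (n - 1) := ⟨0, by omega⟩
      let l : Fin (n - 1) := ⟨n - 2, by omega⟩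
      have hl : (l : ℕ) + 2 = n := by simp only [l]; omega
      change Commute (Y 0) (Tinv i * Y 0 * Tinv i)
      rw [Y_zero, mul_smul_comm, smul_mul_assoc]
      refine (Commute.smul_left ?_ _).smul_right _
      have hA : aboveProd T 0 = T i * aboveProd T 1 := aboveProd_eq T i rfl
      have hB : Commute (aboveProd T 1) (aboveProd T 0 * omega : Op n) :=
        (commute_aboveProd T fun m hm =>
          (aboveProd_mul_omega_commute (i := m) (by omega)).symm).symm
      have hw : (omega * aboveProd T 1 : Op n) = belowProd T l * omega := by
        rw [← belowProd_mul_omega_mul_aboveProd (k := l) (by omega), aboveProd_top T (by omega),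
          mul_one]
      have hA' : aboveProd T 0 = belowProd T l * T l := by
        rw [← belowProd_succ T l rfl, ← belowProd_mul_aboveProd T le_rfl, aboveProd_top T le_rfl,
          mul_one]
        congr 1
        omega
      have hsq : omega * omega * Tinv i = Tinv l * (omega * omega) := by
        have h1 := omega_sq_mul_T (n := n) (i := i) (j := l) rfl hl
        rw [← one_mul (omega * omega * Tinv i), ← Tinv_mul_T l, mul_assoc (Tinv l),
          ← mul_assoc (T l), ← h1, mul_assoc (omega * omega), T_mul_Tinv, mul_one]
      have hTA : Tinv i * (aboveProd T 0 * omega) = aboveProd T 1 * omega := by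
        rw [hA, ← mul_assoc, ← mul_assoc, Tinv_mul_T, one_mul]
      rw [Commute, SemiconjBy, hTA]
      have e1 : aboveProd T 1 * omega * Tinv i * (aboveProd T 0 * omega)
          = aboveProd T 1 * (belowProd T l * (omega * omega)) := by
        rw [mul_assoc, hTA, mul_assoc, ← mul_assoc omega, hw]
        simp only [mul_assoc]
      have e2 : aboveProd T 0 * omega * (aboveProd T 1 * omega * Tinv i)
          = aboveProd T 1 * (belowProd T l * (omega * omega)) := by
        rw [← mul_assoc, ← mul_assoc, ← hB.eq, mul_assoc _ omega]
        rw [mul_assoc, mul_assoc, ← mul_assoc omega omega, hsq, ← mul_assoc (aboveProd T 0), hA',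
          mul_assoc (belowProd T l), T_mul_Tinv, mul_one]
      rw [e1, e2]
    · have hT : Commute (Y 0) (T (⟨k, by omega⟩ : Fin (n - 1))) := (T_commute_Y
        (by rw [Ne, Fin.ext_iff, val_zero_of_neZero]; simp only [lo]; omega)
        (by rw [Ne, Fin.ext_iff, val_zero_of_neZero]; simp only [hi]; omega)).symm
      exact ((Commute.Tinv_right hT).mul_right (ih (by omega))).mul_right (Commute.Tinv_right hT)

theorem Y_zero_commute_sumY [NeZero n] : Commute (Y 0) (sumY n) :=
  Commute.sum_right _ _ _ fun j _ => Y_zero_commute_Y j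

theorem symmetrizer_commute_sumY [NeZero n] (a : QT) :
    Commute (symmetrizer n a) (sumY n) := by
  refine Commute.sum_left _ _ _ fun σ _ => Commute.smul_left ?_ _
  refine List.prod_induction (fun A => Commute A (sumY n)) (fun _ _ => Commute.mul_left)
    (Commute.one_left _) ?_
  intro A hA
  obtain ⟨i, _, rfl⟩ := List.mem_map.mp hA
  exact T_commute_sumY i

theorem Y_zero_injective [NeZero n] : Function.Injective (Y (0 : Fin n)) := by
  have hT : ∀ i : Fin (n - 1), IsUnit (T i : Op n) := fun i =>
    ⟨⟨T i, Tinv i, T_mul_Tinv i, Tinv_mul_T i⟩, rfl⟩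
  have hω : IsUnit (omega : Op n) :=
    ⟨⟨omega, hatOp omega, omega_mul_hatOp_omega, hatOp_omega_mul_omega⟩, rfl⟩
  obtain ⟨u, hu⟩ : IsUnit (aboveProd T 0 * omega : Op n) :=
    (aboveProd_induction T (p := IsUnit) isUnit_one (fun _ _ => IsUnit.mul) 0
      fun j _ => hT j).mul hω
  intro f g h
  rw [Y_zero, LinearMap.smul_apply, LinearMap.smul_apply, ← hu] at h
  have h' := congrArg (↑u⁻¹ : Op n) (smul_right_injective _ (zpow_ne_zero _ t_ne_zero) h)
  rwa [← Module.End.mul_apply, ← Module.End.mul_apply, Units.inv_mul, Module.End.one_apply,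
    Module.End.one_apply] at h'

/-! ### Polynomials on which the Hecke algebra acts by a character -/

/-- All `Tᵢ` act on `f` by the scalar `χ`. -/
def IsType (χ : QT) (f : Poly n) : Prop := ∀ i, T i f = χ • f

theorem IsCharPair.isType_symmetrizer {a χ : QT} (h : IsCharPair a χ) (f : Poly n) :
    IsType χ (symmetrizer n a f) := fun i => by
  rw [← Module.End.mul_apply, h.T_mul_symmetrizer, LinearMap.smul_apply]

theorem IsType.sumY [NeZero n] {χ : QT} {f : Poly n} (h : IsType χ f) :
    IsType χ (sumY n f) := fun i => by
  rw [← Module.End.mul_apply, (T_commute_sumY i).eq, Module.End.mul_apply, h i, map_smul]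

theorem IsType.Tinv {χ : QT} (hχ : χ ≠ 0) {f : Poly n} (h : IsType χ f) (i : Fin (n - 1)) :
    Tinv i f = χ⁻¹ • f := by
  rw [← inv_smul_smul₀ hχ (Macdonald.Tinv i f), ← map_smul, ← h i, ← Module.End.mul_apply,
    Tinv_mul_T, Module.End.one_apply]

/-- The hat exchanges generators and inverses, and both admissible `χ` are fixed by `χ ↦ (bar χ)⁻¹`.
-/
theorem IsCharPair.isType_hat {a χ : QT} (h : IsCharPair a χ) {f : Poly n} (hf : IsType χ f) :
    IsType χ (hat f) := fun i => by
  rw [← Fin.rev_rev i, ← hatOp_Tinv, hatOp_hat, hf.Tinv h.ne_zero, hat_smul, map_inv₀, h.bar]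

theorem IsType.symmetrizer_apply {χ a : QT} {f : Poly n} (h : IsType χ f) :
    symmetrizer n a f = poincare n (a * χ) • f := by
  have h1 : ∀ σ : Equiv.Perm (Fin n), Tperm σ f = χ ^ len σ • f := by
    intro σ
    rw [Tperm, ← (isReducedWord_iff.mp (reducedWord_spec σ)).2]
    induction reducedWord σ with
    | nil => simp
    | cons i w ih =>
      rw [List.map_cons, List.prod_cons, Module.End.mul_apply, ih, map_smul, h, smul_smul,
        List.length_cons, pow_succ]
  simp only [symmetrizer, poincare, LinearMap.sum_apply, LinearMap.smul_apply, h1, smul_smul,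
    Finset.sum_smul, mul_pow]

theorem poincare_t_inv_ne_zero : poincare n t⁻¹ ≠ 0 := by
  rw [poincare_t_inv]
  exact mul_ne_zero (inv_ne_zero (pow_ne_zero _ t_ne_zero)) poincare_t_ne_zero

theorem IsCharPair.poincare_ne_zero {a χ : QT} (h : IsCharPair a χ) :
    poincare n (a * χ) ≠ 0 := by
  rcases h with ⟨rfl, rfl⟩ | ⟨rfl, rfl⟩
  · rw [one_mul]
    exact poincare_t_ne_zero
  · rw [inv_neg, neg_mul_neg, mul_one]
    exact poincare_t_inv_ne_zero

/-! ### Commutation of `∑ᵢ Yᵢ` with its hat on polynomials of a given type. -/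

theorem IsCharPair.exists_hatOp_symmetrizer {a χ : QT} (h : IsCharPair a χ) :
    ∃ c : QT, hatOp (symmetrizer n a) = c • symmetrizer n a :=
  ⟨(poincare n (a * χ))⁻¹ * poincare n (Macdonald.bar a * χ⁻¹), by
    rw [mul_smul, ← h.symmetrizer_hat, inv_smul_smul₀ h.poincare_ne_zero]⟩

/-- As `sumY n f` again has type `χ`, the symmetrizer multiplies it by a nonzero scalar. In each
symmetrized `Yᵢ f` the generators left of `ω` are absorbed by the symmetrizer and the inverse ones
right of `ω` by `f`. -/
theorem IsCharPair.exists_sumY_eq [NeZero n] {a χ : QT} (h : IsCharPair a χ) :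
    ∃ c : QT, ∀ f : Poly n, IsType χ f → sumY n f = c • symmetrizer n a (omega f) := by
  have h1 : ∀ k, ∃ c : QT, symmetrizer n a * aboveProd T k = c • symmetrizer n a := fun k =>
    aboveProd_induction T (p := fun A => ∃ c : QT, symmetrizer n a * A = c • symmetrizer n a)
      ⟨1, by simp⟩ (fun A B ⟨c, hc⟩ ⟨d, hd⟩ => ⟨c * d, by
        rw [← mul_assoc, hc, smul_mul_assoc, hd, smul_smul]⟩) k
      fun j _ => ⟨χ, h.symmetrizer_mul_T j⟩
  have h2 : ∀ k, ∃ c : QT, ∀ f : Poly n, IsType χ f → belowProd Tinv k f = c • f := fun k =>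
    belowProd_induction Macdonald.Tinv
      (p := fun A => ∃ c : QT, ∀ f : Poly n, IsType χ f → A f = c • f)
      ⟨1, by simp⟩ (fun A B ⟨c, hc⟩ ⟨d, hd⟩ => ⟨d * c, fun f hf => by
        rw [Module.End.mul_apply, hd f hf, map_smul, hc f hf, smul_smul]⟩) k
      fun j _ => ⟨χ⁻¹, fun f hf => hf.Tinv h.ne_zero j⟩
  choose c1 hc1 using h1
  choose c2 hc2 using h2
  refine ⟨(poincare n (a * χ))⁻¹ *
    ∑ i : Fin n, t ^ (-(n : ℤ) + (i : ℤ) + 1) * (c2 i * c1 i), fun f hf => ?_⟩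
  rw [mul_smul, eq_inv_smul_iff₀ h.poincare_ne_zero, ← hf.sumY.symmetrizer_apply,
    Macdonald.sumY, LinearMap.sum_apply, map_sum, Finset.sum_smul]
  refine Finset.sum_congr rfl fun i _ => ?_
  rw [Y_eq, LinearMap.smul_apply, map_smul, Module.End.mul_apply, hc2 i f hf, map_smul, map_smul,
    Module.End.mul_apply, ← Module.End.mul_apply, hc1, LinearMap.smul_apply, smul_smul, smul_smul, mul_assoc]

/-- On polynomials of type `χ` the operator `Y 0` undoes `ω⁻¹` up to a fixed scalar. Since it is
injective and commutes with `sumY`, applying it to both sides suffices. -/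
theorem sumY_hatOp_omega [NeZero n] {χ : QT} {f : Poly n} (hf : IsType χ f) :
    sumY n (hatOp omega f) = hatOp omega (sumY n f) := by
  obtain ⟨c, hc⟩ : ∃ c : QT, ∀ f : Poly n, IsType χ f → aboveProd T 0 f = c • f :=
    aboveProd_induction T (p := fun A => ∃ c : QT, ∀ f : Poly n, IsType χ f → A f = c • f)
      ⟨1, by simp⟩ (fun A B ⟨c, hc⟩ ⟨d, hd⟩ => ⟨d * c, fun f hf => by
        rw [Module.End.mul_apply, hd f hf, map_smul, hc f hf, smul_smul]⟩) 0
      fun j _ => ⟨χ, fun f hf => hf j⟩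
  have h1 : ∀ f : Poly n, IsType χ f →
      Y 0 (hatOp omega f) = (t ^ (-(n : ℤ) + 1) * c) • f := by
    intro f hf
    rw [Y_zero, LinearMap.smul_apply, Module.End.mul_apply, ← Module.End.mul_apply omega,
      omega_mul_hatOp_omega, Module.End.one_apply, hc f hf, smul_smul]
  apply Y_zero_injective
  rw [h1 _ hf.sumY, ← Module.End.mul_apply, Y_zero_commute_sumY.eq, Module.End.mul_apply, h1 f hf,
    map_smul]

theorem IsCharPair.sumY_hatOp_sumY [NeZero n] {a χ : QT} (h : IsCharPair a χ) {f : Poly n}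
    (hf : IsType χ f) :
    sumY n (hatOp (sumY n) f) = hatOp (sumY n) (sumY n f) := by
  obtain ⟨c, hc⟩ := h.exists_sumY_eq (n := n)
  obtain ⟨d, hd⟩ := h.exists_hatOp_symmetrizer (n := n)
  have h1 : ∀ f : Poly n, IsType χ f →
      hatOp (sumY n) f = (Macdonald.bar c * d) • symmetrizer n a (hatOp omega f) := by
    intro f hf
    rw [hatOp_apply, hc _ (h.isType_hat hf), hat_smul, ← hatOp_hat, ← hatOp_apply omega, hd,
      LinearMap.smul_apply, smul_smul]
  rw [h1 f hf, h1 _ hf.sumY, map_smul, ← Module.End.mul_apply, ← (symmetrizer_commute_sumY a).eq,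
    Module.End.mul_apply, sumY_hatOp_omega hf]

/-! ### A partial order on exponents -/

/-- `ν` is weakly below `κ`: the decreasing rearrangement of `ν` is dominated by that of `κ`. -/
def WeakBelow (κ ν : Fin n → ℕ) : Prop :=
  ∑ i, ν i = ∑ i, κ i ∧ ∀ c, ∑ i, (ν i - c) ≤ ∑ i, (κ i - c)

/-- `ν` is strictly below `κ`. -/
def Below (κ ν : Fin n → ℕ) : Prop :=
  WeakBelow κ ν ∧ ∃ c, ∑ i, (ν i - c) < ∑ i, (κ i - c)

theorem WeakBelow.refl (κ : Fin n → ℕ) : WeakBelow κ κ := ⟨rfl, fun _ => le_rfl⟩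

theorem WeakBelow.comp_perm {κ ν : Fin n → ℕ} (h : WeakBelow κ ν) (σ : Equiv.Perm (Fin n)) :
    WeakBelow κ (ν ∘ σ) :=
  ⟨(Equiv.sum_comp σ ν).trans h.1, fun c =>
    (Equiv.sum_comp σ fun i => ν i - c).le.trans (h.2 c)⟩

theorem Below.comp_perm {κ ν : Fin n → ℕ} (h : Below κ ν) (σ : Equiv.Perm (Fin n)) :
    Below κ (ν ∘ σ) :=
  ⟨h.1.comp_perm σ, h.2.imp fun c hc => (Equiv.sum_comp σ fun i => ν i - c).trans_lt hc⟩

theorem WeakBelow.trans_below {κ ν μ : Fin n → ℕ} (h : WeakBelow κ ν) (h' : Below ν μ) :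
    Below κ μ :=
  ⟨⟨h'.1.1.trans h.1, fun c => (h'.1.2 c).trans (h.2 c)⟩,
    h'.2.imp fun c hc => hc.trans_le (h.2 c)⟩

theorem sum_add_eq_of_agree {f g : Fin n → ℕ} {a b : Fin n} (hab : a ≠ b)
    (h : ∀ j, j ≠ a → j ≠ b → f j = g j) :
    ∑ i, f i + (g a + g b) = ∑ i, g i + (f a + f b) := by
  have h1 : ∀ u : Fin n → ℕ, ∑ i, u i = u a + (u b + ∑ i ∈ (Finset.univ.erase a).erase b, u i) := by
    intro u
    rw [Finset.add_sum_erase _ _ (Finset.mem_erase.mpr ⟨hab.symm, Finset.mem_univ _⟩),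
      Finset.add_sum_erase _ _ (Finset.mem_univ _)]
  have h2 : ∑ i ∈ (Finset.univ.erase a).erase b, f i
      = ∑ i ∈ (Finset.univ.erase a).erase b, g i := by
    refine Finset.sum_congr rfl fun i hi => ?_
    simp only [Finset.mem_erase] at hi
    exact h i hi.2.1 hi.1
  rw [h1 f, h1 g, h2]
  ring

theorem below_of_squeeze {ν μ : Fin n → ℕ} {a b : Fin n} (hab : a ≠ b)
    (h : ∀ j, j ≠ a → j ≠ b → μ j = ν j) (hs : μ a + μ b = ν a + ν b)
    (ha : μ a < ν a) (hb : μ b < ν a) : Below ν μ := by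
  have key := fun c => sum_add_eq_of_agree (f := fun i => μ i - c) (g := fun i => ν i - c) hab
    fun j h1 h2 => by simp only [h j h1 h2]
  -- At the cutoff `ν a - 1`, among the entries at `a` and `b` before and after the move, only `ν a`
  -- still contributes.
  refine ⟨⟨?_, fun c => ?_⟩, ν a - 1, ?_⟩
  · have := sum_add_eq_of_agree hab h
    omega
  · have := key c
    omega
  · have := key (ν a - 1)
    omega

/-- Cutting off at `κ p` bounds the partial sums up to `p`: for the decreasing `κ` the cut-off total
comes from these positions alone, and for `μ` it is an upper bound. No sorting of `μ` is needed. -/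
theorem Below.domLT {κ μ : Fin n → ℕ} (hκ : Antitone κ) (h : Below κ μ) : DomLT μ κ := by
  refine ⟨?_, h.1.1, fun p => ?_⟩
  · rintro rfl
    obtain ⟨c, hc⟩ := h.2
    exact lt_irrefl _ hc
  · have h1 : ∑ i ∈ Finset.Iic p, μ i ≤ ∑ i ∈ Finset.Iic p, ((μ i - κ p) + κ p) :=
      Finset.sum_le_sum fun i _ => by omega
    have h2 : ∑ i ∈ Finset.Iic p, (μ i - κ p) ≤ ∑ i, (μ i - κ p) :=
      Finset.sum_le_sum_of_subset (Finset.subset_univ _)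
    have h3 : ∑ i ∈ Finset.Iic p, κ i = ∑ i ∈ Finset.Iic p, ((κ i - κ p) + κ p) := by
      refine Finset.sum_congr rfl fun i hi => ?_
      have := hκ (Finset.mem_Iic.mp hi)
      omega
    have h4 : ∑ i, (κ i - κ p) = ∑ i ∈ Finset.Iic p, (κ i - κ p) := by
      symm
      refine Finset.sum_subset (Finset.subset_univ _) fun i _ hi => ?_
      have := hκ (not_le.mp (mt Finset.mem_Iic.mpr hi)).le
      omega
    have h5 := h.1.2 (κ p)
    rw [Finset.sum_add_distrib] at h1 h3
    omega

/-- A natural number which decreases along `Below`. -/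
def belowMeasure (ν : Fin n → ℕ) : ℕ := ∑ c ∈ Finset.range (∑ i, ν i), ∑ i, (ν i - c)

/-- Cutoffs at or above the total degree give zero, so a strict cutoff lies in the summation range.
-/
theorem Below.measure_lt {κ ν : Fin n → ℕ} (h : Below κ ν) : belowMeasure ν < belowMeasure κ := by
  obtain ⟨⟨h1, h2⟩, c, hc⟩ := h
  rw [belowMeasure, belowMeasure, h1]
  refine Finset.sum_lt_sum (fun c _ => h2 c) ⟨c, ?_, hc⟩
  rw [Finset.mem_range]
  by_contra hle
  have : ∑ i, (κ i - c) = 0 := by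
    refine Finset.sum_eq_zero fun i _ => ?_
    have := Finset.single_le_sum (f := κ) (fun _ _ => Nat.zero_le _) (Finset.mem_univ i)
    omega
  omega

/-- The span of the monomials with exponent strictly below `κ`. -/
def lowerSpan (κ : Fin n → ℕ) : Submodule QT (Poly n) :=
  Submodule.span QT {f | ∃ ν, Below κ ν ∧ f = xpow ν}

theorem xpow_mem_lowerSpan {κ ν : Fin n → ℕ} (h : Below κ ν) : xpow ν ∈ lowerSpan κ :=
  Submodule.subset_span ⟨ν, h, rfl⟩

theorem map_mem_of_lowerSpan {κ : Fin n → ℕ} {N : Submodule QT (Poly n)} {A : Op n}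
    (h : ∀ ν, Below κ ν → A (xpow ν) ∈ N) {f : Poly n} (hf : f ∈ lowerSpan κ) : A f ∈ N := by
  have : lowerSpan κ ≤ N.comap A := Submodule.span_le.mpr (by
    rintro _ ⟨ν, hν, rfl⟩
    exact h ν hν)
  exact this hf

/-! ### Action on monomials -/

/-- The product of the `sⱼ` with `j < k`, in increasing order. -/
abbrev belowCycle (n k : ℕ) : Equiv.Perm (Fin n) := belowProd adjSwap k

/-- The product of the `sⱼ` with `k ≤ j`, in increasing order. -/
abbrev aboveCycle (n k : ℕ) : Equiv.Perm (Fin n) := aboveProd adjSwap k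


theorem xpow_eq_mul {a b : Fin n} (hab : a ≠ b) (ν : Fin n → ℕ) :
    (xpow ν : Poly n) = (∏ i ∈ (Finset.univ.erase a).erase b, X i ^ ν i) * X a ^ ν a * X b ^ ν b := by
  rw [xpow, ← Finset.mul_prod_erase _ _ (Finset.mem_univ a),
    ← Finset.mul_prod_erase _ _ (Finset.mem_erase.mpr ⟨hab.symm, Finset.mem_univ b⟩)]
  ring

theorem rename_xpow (σ : Equiv.Perm (Fin n)) (ν : Fin n → ℕ) :
    rename σ (xpow ν : Poly n) = xpow (ν ∘ σ.symm) := by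
  rw [xpow, xpow, map_prod]
  conv_rhs => rw [← Equiv.prod_comp σ]
  simp

theorem sOp_xpow (i : Fin (n - 1)) (ν : Fin n → ℕ) :
    sOp i (xpow ν : Poly n) = xpow (ν ∘ adjSwap i) := rename_xpow (adjSwap i) ν

theorem T_eq_of_sOp_eq {i : Fin (n - 1)} {f : Poly n} (h : sOp i f = f) : T i f = t • f := by
  apply mul_left_cancel₀ (X_sub_X_ne_zero i)
  rw [X_sub_mul_T, h, smul_eq_C_mul]
  ring

theorem sOp_eq_of_T_eq {i : Fin (n - 1)} {f : Poly n} (h : T i f = t • f) : sOp i f = f := by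
  have h1 := X_sub_mul_T i f
  rw [h, smul_eq_C_mul] at h1
  have h2 : (C t * X (lo i) - X (hi i) : Poly n) ≠ 0 := by
    intro h0
    -- The coefficient of the second variable is `-1`.
    have := congrArg (coeff (Finsupp.single (hi i) 1)) h0
    rw [coeff_sub, coeff_C_mul, coeff_X, coeff_X, if_neg] at this
    · simp at this
    · intro h3
      exact lo_ne_hi i (Finsupp.single_left_injective one_ne_zero h3)
  apply mul_left_cancel₀ h2
  linear_combination -h1

/-- The sum of `f` and `sOp i f` is symmetric, so `T i` multiplies it by `t`. This reduces
increasing neighbouring exponents to decreasing ones. -/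
theorem T_sOp (i : Fin (n - 1)) (f : Poly n) : T i (sOp i f) = t • sOp i f + t • f - T i f := by
  apply mul_left_cancel₀ (X_sub_X_ne_zero i)
  rw [X_sub_mul_T, mul_sub, X_sub_mul_T, sOp_sOp, smul_eq_C_mul, smul_eq_C_mul]
  ring

theorem comp_adjSwap_eq {i : Fin (n - 1)} {ν : Fin n → ℕ} (h : ν (lo i) = ν (hi i)) :
    ν ∘ adjSwap i = ν := by
  funext j
  rw [Function.comp_apply]
  by_cases h1 : j = lo i
  · rw [h1, adjSwap_lo, h]
  by_cases h2 : j = hi i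
  · rw [h2, adjSwap_hi, h]
  rw [adjSwap_of_ne h1 h2]

theorem T_xpow_of_eq {i : Fin (n - 1)} {ν : Fin n → ℕ} (h : ν (lo i) = ν (hi i)) :
    T i (xpow ν : Poly n) = t • xpow ν :=
  T_eq_of_sOp_eq (by rw [sOp_xpow, comp_adjSwap_eq h])

/-- A geometric sum: besides the swapped monomial there remain only those whose two exponents lie
strictly between the original ones, and they are strictly lower. -/
theorem T_xpow_sub_mem {κ ν : Fin n → ℕ} (hν : WeakBelow κ ν) {i : Fin (n - 1)}
    (h : ν (hi i) < ν (lo i)) : T i (xpow ν) - xpow (ν ∘ adjSwap i) ∈ lowerSpan κ := by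
  obtain ⟨e, he⟩ := Nat.exists_eq_add_of_lt h
  set b := ν (hi i) with hb
  let μ : ℕ → Fin n → ℕ := fun k =>
    Function.update (Function.update ν (lo i) (b + 1 + k)) (hi i) (b + e - k)
  have hlo : ∀ k, μ k (lo i) = b + 1 + k := fun k => by
    simp [μ, Function.update_of_ne (lo_ne_hi i)]
  have hhi : ∀ k, μ k (hi i) = b + e - k := fun k => by simp [μ]
  have hother : ∀ k j, j ≠ lo i → j ≠ hi i → μ k j = ν j := fun k j h1 h2 => by
    simp [μ, Function.update_of_ne h1, Function.update_of_ne h2]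
  have key : T i (xpow ν) - xpow (ν ∘ adjSwap i)
      = (1 - t) • ∑ k ∈ Finset.range e, (xpow (μ k) : Poly n) := by
    set B : Poly n := ∏ j ∈ (Finset.univ.erase (lo i)).erase (hi i), X j ^ ν j with hB
    have hprod : ∀ μ : Fin n → ℕ, (∀ j, j ≠ lo i → j ≠ hi i → μ j = ν j) →
        (xpow μ : Poly n) = B * X (lo i) ^ μ (lo i) * X (hi i) ^ μ (hi i) := by
      intro μ hμ
      rw [xpow_eq_mul (lo_ne_hi i)]
      congr 2
      refine Finset.prod_congr rfl fun j hj => ?_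
      simp only [Finset.mem_erase] at hj
      rw [hμ j hj.2.1 hj.1]
    have e1 := hprod ν fun _ _ _ => rfl
    have e2 := hprod (ν ∘ adjSwap i) fun j h1 h2 => by
      rw [Function.comp_apply, adjSwap_of_ne h1 h2]
    have e3 := fun k => hprod (μ k) (hother k)
    simp only [Function.comp_apply, adjSwap_lo, adjSwap_hi, hlo, hhi, he, ← hb] at e1 e2 e3
    have e4 : ∑ k ∈ Finset.range e, (xpow (μ k) : Poly n) =
        B * (X (lo i) * X (hi i)) ^ (b + 1) *
          ∑ k ∈ Finset.range e, X (lo i) ^ k * X (hi i) ^ (e - 1 - k) := by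
      rw [Finset.mul_sum]
      refine Finset.sum_congr rfl fun k hk => ?_
      have := Finset.mem_range.mp hk
      rw [e3, show b + e - k = (b + 1) + (e - 1 - k) by omega]
      ring
    have e5 := geom_sum₂_mul (X (lo i) : Poly n) (X (hi i)) e
    apply mul_left_cancel₀ (X_sub_X_ne_zero i)
    rw [e4, mul_sub, X_sub_mul_T, sOp_xpow, e1, e2, smul_eq_C_mul, map_sub, map_one]
    linear_combination -(1 - C t) * B * (X (lo i) * X (hi i)) ^ (b + 1) * e5
  rw [key]
  refine Submodule.smul_mem _ _ (Submodule.sum_mem _ fun k hk => xpow_mem_lowerSpan ?_)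
  have := Finset.mem_range.mp hk
  refine hν.trans_below (below_of_squeeze (lo_ne_hi i) (hother k) ?_ ?_ ?_)
  · rw [hlo, hhi]; omega
  · rw [hlo]; omega
  · rw [hhi]; omega

theorem T_mem_lowerSpan {κ : Fin n → ℕ} (i : Fin (n - 1)) {f : Poly n} (hf : f ∈ lowerSpan κ) :
    T i f ∈ lowerSpan κ := by
  refine map_mem_of_lowerSpan (fun ν hν => ?_) hf
  have hs := xpow_mem_lowerSpan (hν.comp_perm (adjSwap i))
  rcases lt_trichotomy (ν (lo i)) (ν (hi i)) with h | h | h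
  · have h1 := T_xpow_sub_mem (hν.1.comp_perm (adjSwap i)) (i := i)
      (by simpa [adjSwap_lo, adjSwap_hi] using h)
    have h2 : xpow ν = sOp i (xpow (ν ∘ adjSwap i)) := by rw [← sOp_xpow, sOp_sOp]
    rw [h2, T_sOp, ← h2]
    refine Submodule.sub_mem _ (Submodule.add_mem _ (Submodule.smul_mem _ _
      (xpow_mem_lowerSpan hν)) (Submodule.smul_mem _ _ hs)) ?_
    have h3 := Submodule.add_mem _ h1 (xpow_mem_lowerSpan
      ((hν.comp_perm (adjSwap i)).comp_perm (adjSwap i)))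
    rwa [sub_add_cancel] at h3
  · rw [T_xpow_of_eq h]
    exact Submodule.smul_mem _ _ (xpow_mem_lowerSpan hν)
  · have h1 := Submodule.add_mem _ (T_xpow_sub_mem hν.1 h) hs
    rwa [sub_add_cancel] at h1

theorem Tinv_mem_lowerSpan {κ : Fin n → ℕ} (i : Fin (n - 1)) {f : Poly n}
    (hf : f ∈ lowerSpan κ) : Tinv i f ∈ lowerSpan κ :=
  Submodule.add_mem _ (Submodule.smul_mem _ _ hf) (Submodule.smul_mem _ _ (T_mem_lowerSpan i hf))

theorem T_xpow_congr {κ ν : Fin n → ℕ} (hν : WeakBelow κ ν) {i : Fin (n - 1)}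
    (h : ν (hi i) ≤ ν (lo i)) :
    T i (xpow ν) - (if ν (lo i) = ν (hi i) then t else 1) • xpow (ν ∘ adjSwap i)
      ∈ lowerSpan κ := by
  split_ifs with h1
  · rw [comp_adjSwap_eq h1, T_xpow_of_eq h1, sub_self]
    exact Submodule.zero_mem _
  · rw [one_smul]
    exact T_xpow_sub_mem hν (h.lt_of_ne (Ne.symm h1))

theorem Tinv_xpow_congr {κ ν : Fin n → ℕ} (hν : WeakBelow κ ν) {i : Fin (n - 1)}
    (h : ν (lo i) ≤ ν (hi i)) :
    Tinv i (xpow ν) - (if ν (lo i) = ν (hi i) then t⁻¹ else 1) • xpow (ν ∘ adjSwap i)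
      ∈ lowerSpan κ := by
  have h1 := Tinv_mem_lowerSpan i (T_xpow_congr (hν.comp_perm (adjSwap i)) (i := i)
      (by simpa [adjSwap_lo, adjSwap_hi] using h))
  have h2 : (ν ∘ adjSwap i) ∘ adjSwap i = ν := by
    funext j
    simp [adjSwap_adjSwap]
  rw [map_sub, map_smul, h2, ← Module.End.mul_apply, Tinv_mul_T, Module.End.one_apply] at h1
  simp only [Function.comp_apply, adjSwap_lo, adjSwap_hi, eq_comm (a := ν (hi i))] at h1
  split_ifs at h1 ⊢ with h3
  · have := Submodule.smul_mem _ (-t⁻¹) h1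
    rwa [smul_sub, neg_smul, neg_smul, inv_smul_smul₀ t_ne_zero, sub_neg_eq_add, add_comm,
      ← sub_eq_add_neg] at this
  · rw [one_smul] at h1 ⊢
    rw [← neg_sub]
    exact Submodule.neg_mem _ h1

theorem omega_xpow [NeZero n] (ν : Fin n → ℕ) :
    omega (xpow ν : Poly n) = q ^ ν 0 • xpow (ν ∘ belowCycle n (n - 1)) := by
  have hrot : ∀ a : Fin n, belowCycle n (n - 1) (rotDown a) = a := by
    intro a
    ext
    rw [belowProd_adjSwap_val le_rfl, rotDown_val]
    split_ifs <;> omega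
  have hX : ∀ a : Fin n, omegaHom (X a) = (if a = 0 then C q else 1) * X (rotDown a) := by
    intro a
    split_ifs with h
    · rw [h, omegaHom_X_zero]
    · rw [omegaHom_X h, one_mul]
  rw [omega_apply, xpow, map_prod]
  simp only [map_pow, hX, mul_pow, Finset.prod_mul_distrib]
  rw [smul_eq_C_mul, map_pow]
  congr 1
  · rw [Finset.prod_eq_single 0]
    · simp
    · intro b _ hb
      simp [hb]
    · simp
  · rw [xpow]
    conv_rhs => rw [← Equiv.prod_comp (belowCycle n (n - 1))⁻¹]
    refine Finset.prod_congr rfl fun a _ => ?_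
    have h1 : (belowCycle n (n - 1))⁻¹ a = rotDown a := by
      rw [Equiv.Perm.inv_eq_iff_eq, hrot]
    rw [h1, Function.comp_apply, hrot]

theorem omega_mem_lowerSpan [NeZero n] {κ : Fin n → ℕ} {f : Poly n} (hf : f ∈ lowerSpan κ) :
    omega f ∈ lowerSpan κ :=
  map_mem_of_lowerSpan (fun ν hν => by
    rw [omega_xpow]
    exact Submodule.smul_mem _ _ (xpow_mem_lowerSpan (hν.comp_perm _))) hf

theorem aboveProd_T_mem_lowerSpan {κ : Fin n → ℕ} (k : ℕ) {f : Poly n}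
    (hf : f ∈ lowerSpan κ) : aboveProd T k f ∈ lowerSpan κ :=
  aboveProd_induction T (p := fun A : Op n => ∀ f ∈ lowerSpan κ, A f ∈ lowerSpan κ)
    (fun _ h => h) (fun _ _ hA hB f hf => hA _ (hB f hf)) k
    (fun i _ _ => T_mem_lowerSpan i) f hf

theorem belowProd_Tinv_mem_lowerSpan {κ : Fin n → ℕ} (k : ℕ) {f : Poly n}
    (hf : f ∈ lowerSpan κ) : belowProd Tinv k f ∈ lowerSpan κ :=
  belowProd_induction Tinv (p := fun A : Op n => ∀ f ∈ lowerSpan κ, A f ∈ lowerSpan κ)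
    (fun _ h => h) (fun _ _ hA hB f hf => hA _ (hB f hf)) k
    (fun i _ _ => Tinv_mem_lowerSpan i) f hf

theorem sumY_mem_lowerSpan [NeZero n] {κ : Fin n → ℕ} {f : Poly n}
    (hf : f ∈ lowerSpan κ) : sumY n f ∈ lowerSpan κ := by
  rw [sumY, LinearMap.sum_apply]
  refine Submodule.sum_mem _ fun i _ => ?_
  rw [Y_eq]
  exact Submodule.smul_mem _ _ (aboveProd_T_mem_lowerSpan _ (omega_mem_lowerSpan
    (belowProd_Tinv_mem_lowerSpan _ hf)))

/-! ### Triangularity of the Cherednik operators -/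

/-- The inverse generators carry the entry at `k` to the front past entries that are no larger. Each
tie costs a factor `t⁻¹`. -/
theorem belowProd_Tinv_xpow {κ ν : Fin n → ℕ} (hν : WeakBelow κ ν) {k : ℕ} (hk : k < n)
    (h : ∀ j : Fin n, (j : ℕ) < k → ν j ≤ ν ⟨k, hk⟩) :
    belowProd Tinv k (xpow ν) - t⁻¹ ^ (Finset.univ.filter fun j : Fin n =>
        (j : ℕ) < k ∧ ν j = ν ⟨k, hk⟩).card • xpow (ν ∘ ((belowCycle n k)⁻¹ : Equiv.Perm (Fin n)))
      ∈ lowerSpan κ := by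
  induction k generalizing ν with
  | zero =>
    simp [belowProd_zero]
  | succ k ih =>
    let i : Fin (n - 1) := ⟨k, by omega⟩
    have hlo : (⟨k, by omega⟩ : Fin n) = lo i := rfl
    have hhi : (⟨k + 1, hk⟩ : Fin n) = hi i := rfl
    have hne : ∀ j : Fin n, (j : ℕ) < k → adjSwap i j = j := fun j hj => by
      apply adjSwap_of_ne <;> simp only [lo, hi, ne_eq, Fin.ext_iff, i] <;> omega
    have h0 := ih (hν.comp_perm (adjSwap i)) (by omega) (by
      intro j hj
      rw [hlo, Function.comp_apply, Function.comp_apply, adjSwap_lo, hne j hj]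
      exact h j (by omega))
    have hcard : (Finset.univ.filter fun j : Fin n => (j : ℕ) < k + 1 ∧ ν j = ν ⟨k + 1, hk⟩).card
        = (Finset.univ.filter fun j : Fin n => (j : ℕ) < k ∧
          (ν ∘ adjSwap i) j = (ν ∘ adjSwap i) ⟨k, by omega⟩).card +
          if ν (lo i) = ν (hi i) then 1 else 0 := by
      have e1 : (Finset.univ.filter fun j : Fin n => (j : ℕ) < k ∧
          (ν ∘ adjSwap i) j = (ν ∘ adjSwap i) ⟨k, by omega⟩)
          = Finset.univ.filter fun j : Fin n => (j : ℕ) < k ∧ ν j = ν (hi i) := by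
        refine Finset.filter_congr fun j _ => and_congr_right fun hj => ?_
        rw [hlo, Function.comp_apply, Function.comp_apply, adjSwap_lo, hne j hj]
      rw [e1, hhi]
      split_ifs with h1
      · rw [← Finset.card_insert_of_notMem (a := lo i) (by simp [lo, i])]
        congr 1
        ext j
        simp only [Finset.mem_filter, Finset.mem_univ, true_and, Finset.mem_insert]
        constructor
        · rintro ⟨h2, h3⟩
          rcases (Nat.lt_succ_iff.mp h2).eq_or_lt with h4 | h4
          · exact Or.inl (Fin.ext h4)
          · exact Or.inr ⟨h4, h3⟩
        · rintro (rfl | ⟨h2, h3⟩)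
          · exact ⟨Nat.lt_succ_self _, h1⟩
          · exact ⟨by omega, h3⟩
      · rw [add_zero]
        congr 1
        refine Finset.filter_congr fun j _ => ⟨fun ⟨h2, h3⟩ => ⟨?_, h3⟩, fun ⟨h2, h3⟩ =>
          ⟨by omega, h3⟩⟩
        refine (Nat.lt_succ_iff.mp h2).lt_of_ne fun h4 => h1 ?_
        rw [← h3, ← hlo]
        congr 1
        exact Fin.ext h4.symm
    have h1 := belowProd_Tinv_mem_lowerSpan k (Tinv_xpow_congr hν (i := i)
      (h (lo i) (Nat.lt_succ_self k)))
    rw [map_sub, map_smul] at h1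
    have e1 : belowProd Tinv (k + 1) = belowProd Tinv k * Tinv i := belowProd_succ Tinv i rfl
    have e2 : belowCycle n (k + 1) = belowCycle n k * adjSwap i := belowProd_succ adjSwap i rfl
    rw [e1, e2, Module.End.mul_apply, hcard, mul_inv_rev, adjSwap_inv, Equiv.Perm.coe_mul,
      ← Function.comp_assoc]
    have h2 := Submodule.add_mem _ h1 (Submodule.smul_mem _
      (if ν (lo i) = ν (hi i) then t⁻¹ else 1) h0)
    rw [smul_sub, sub_add_sub_cancel, smul_smul] at h2
    convert h2 using 3
    split_ifs
    · rw [pow_succ']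
    · rw [add_zero, one_mul]

/-- The generators carry the last entry back to position `k` past entries that are no smaller. Each
tie costs a factor `t`. -/
theorem aboveProd_T_xpow {κ ν : Fin n → ℕ} (hν : WeakBelow κ ν) (k : ℕ) (hk : k < n)
    (h : ∀ j : Fin n, k < (j : ℕ) → ν ⟨k, hk⟩ ≤ ν j) :
    aboveProd T k (xpow (ν ∘ aboveCycle n k)) - t ^ (Finset.univ.filter fun j : Fin n =>
        k < (j : ℕ) ∧ ν j = ν ⟨k, hk⟩).card • xpow ν ∈ lowerSpan κ := by
  obtain ⟨d, hd⟩ : ∃ d, n - 1 - k = d := ⟨_, rfl⟩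
  induction d generalizing k ν with
  | zero =>
    have hk' : n - 1 ≤ k := by omega
    have h1 : aboveCycle n k = 1 := aboveProd_top adjSwap hk'
    rw [aboveProd_top T hk', h1, Finset.filter_false_of_mem]
    · simp
    · intro j _
      omega
  | succ d ih =>
    let i : Fin (n - 1) := ⟨k, by omega⟩
    have hlo : (⟨k, hk⟩ : Fin n) = lo i := rfl
    have hhi : (⟨k + 1, by omega⟩ : Fin n) = hi i := rfl
    have hne : ∀ j : Fin n, k + 1 < (j : ℕ) → adjSwap i j = j := fun j hj => by
      apply adjSwap_of_ne <;> simp only [lo, hi, ne_eq, Fin.ext_iff, i] <;> omega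
    have h0 := ih (hν.comp_perm (adjSwap i)) (k + 1) (by omega) (by
      intro j hj
      rw [hhi, Function.comp_apply, Function.comp_apply, adjSwap_hi, hne j hj]
      exact h j (by omega)) (by omega)
    have hcard : (Finset.univ.filter fun j : Fin n => k < (j : ℕ) ∧ ν j = ν ⟨k, hk⟩).card
        = (Finset.univ.filter fun j : Fin n => k + 1 < (j : ℕ) ∧
          (ν ∘ adjSwap i) j = (ν ∘ adjSwap i) ⟨k + 1, by omega⟩).card +
          if ν (hi i) = ν (lo i) then 1 else 0 := by
      have e1 : (Finset.univ.filter fun j : Fin n => k + 1 < (j : ℕ) ∧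
          (ν ∘ adjSwap i) j = (ν ∘ adjSwap i) ⟨k + 1, by omega⟩)
          = Finset.univ.filter fun j : Fin n => k + 1 < (j : ℕ) ∧ ν j = ν (lo i) := by
        refine Finset.filter_congr fun j _ => and_congr_right fun hj => ?_
        rw [hhi, Function.comp_apply, Function.comp_apply, adjSwap_hi, hne j hj]
      rw [e1, hlo]
      split_ifs with h1
      · rw [← Finset.card_insert_of_notMem (a := hi i) (by simp [hi, i])]
        congr 1
        ext j
        simp only [Finset.mem_filter, Finset.mem_univ, true_and, Finset.mem_insert]
        constructor
        · rintro ⟨h2, h3⟩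
          rcases (Nat.succ_le_iff.mpr h2).eq_or_lt with h4 | h4
          · exact Or.inl (Fin.ext h4.symm)
          · exact Or.inr ⟨h4, h3⟩
        · rintro (rfl | ⟨h2, h3⟩)
          · exact ⟨Nat.lt_succ_self _, h1⟩
          · exact ⟨by omega, h3⟩
      · rw [add_zero]
        congr 1
        refine Finset.filter_congr fun j _ => ⟨fun ⟨h2, h3⟩ => ⟨?_, h3⟩, fun ⟨h2, h3⟩ =>
          ⟨by omega, h3⟩⟩
        refine (Nat.succ_le_iff.mpr h2).lt_of_ne fun h4 => h1 ?_
        rw [← h3, ← hhi]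
        congr 1
        exact Fin.ext h4
    have h1 := T_xpow_congr (hν.comp_perm (adjSwap i)) (i := i) (by
      rw [Function.comp_apply, Function.comp_apply, adjSwap_lo, adjSwap_hi]
      exact h (hi i) (Nat.lt_succ_self k))
    have hss : (ν ∘ adjSwap i) ∘ adjSwap i = ν := by
      funext j
      simp [adjSwap_adjSwap]
    rw [hss, Function.comp_apply, Function.comp_apply, adjSwap_lo, adjSwap_hi] at h1
    have h2 := Submodule.add_mem _ (T_mem_lowerSpan i h0) (Submodule.smul_mem _
      (t ^ (Finset.univ.filter fun j : Fin n => k + 1 < (j : ℕ) ∧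
          (ν ∘ adjSwap i) j = (ν ∘ adjSwap i) ⟨k + 1, by omega⟩).card) h1)
    rw [map_sub, map_smul, smul_sub, sub_add_sub_cancel, smul_smul] at h2
    have e1 : aboveProd T k = T i * aboveProd T (k + 1) := aboveProd_eq T i rfl
    have e2 : aboveCycle n k = adjSwap i * aboveCycle n (k + 1) :=
      aboveProd_eq adjSwap i rfl
    rw [e1, e2, Module.End.mul_apply, hcard, Equiv.Perm.coe_mul, ← Function.comp_assoc]
    convert h2 using 3
    split_ifs
    · rw [pow_succ]
    · rw [add_zero, mul_one]

/-- The entry at `i` travels to the front, is sent by `ω` to the end at the price of `q ^ ν i`, and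
returns to its place. For increasing exponents all comparisons on the way go in the favourable
direction. -/
theorem Y_xpow_of_monotone [NeZero n] {κ ν : Fin n → ℕ} (hν : WeakBelow κ ν) (hm : Monotone ν)
    (i : Fin n) : Y i (xpow ν) - eigval ν i • xpow ν ∈ lowerSpan κ := by
  have ha := belowProd_Tinv_xpow hν i.2 fun j hj => hm (Fin.le_def.mpr hj.le)
  have hb := aboveProd_T_xpow hν i i.2 fun j hj => hm (Fin.le_def.mpr hj.le)
  simp only [Fin.eta] at ha hb
  set A := (Finset.univ.filter fun j : Fin n => (j : ℕ) < i ∧ ν j = ν i).card with hA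
  set B := (Finset.univ.filter fun j : Fin n => (i : ℕ) < j ∧ ν j = ν i).card with hB
  have h1 := aboveProd_T_mem_lowerSpan (i : ℕ) (omega_mem_lowerSpan ha)
  have h0 : (belowCycle n i)⁻¹ (0 : Fin n) = i := by
    rw [Equiv.Perm.inv_eq_iff_eq]
    ext
    rw [belowProd_adjSwap_val (by omega), val_zero_of_neZero]
    simp
  have h2 : (ν ∘ ((belowCycle n i)⁻¹ : Equiv.Perm (Fin n))) ∘ belowCycle n (n - 1)
      = ν ∘ aboveCycle n i := by
    rw [Function.comp_assoc, ← Equiv.Perm.coe_mul]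
    congr 2
    rw [inv_mul_eq_iff_eq_mul, belowProd_mul_aboveProd _ (by omega),
      ← belowProd_mul_aboveProd adjSwap le_rfl, aboveProd_top _ le_rfl, mul_one]
  rw [map_sub, map_smul, omega_xpow, h2, Function.comp_apply, h0, map_sub, map_smul, map_smul] at h1
  have h3 := Submodule.smul_mem _ (t ^ (-(n : ℤ) + (i : ℤ) + 1)) (Submodule.add_mem _ h1
    (Submodule.smul_mem _ (t⁻¹ ^ A) (Submodule.smul_mem _ (q ^ ν i) hb)))
  rw [smul_sub, smul_sub, sub_add_sub_cancel, smul_sub, smul_smul, smul_smul, smul_smul] at h3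
  rw [Y_eq, LinearMap.smul_apply, Module.End.mul_apply, Module.End.mul_apply]
  convert h3 using 3
  -- For increasing exponents the leg colength counts the ties to the left and the entries to the
  -- right that are not ties.
  have hleg : (legColength ν i : ℤ) = A + ((n : ℤ) - 1 - i - B) := by
    have e1 : (Finset.univ.filter fun k : Fin n => k < i ∧ ν i ≤ ν k).card = A := by
      rw [hA]
      congr 1
      refine Finset.filter_congr fun j _ => and_congr_right fun hj => ?_
      exact ⟨fun h => le_antisymm (hm hj.le) h, fun h => h.ge⟩
    have e2 : (Finset.univ.filter fun k : Fin n => i < k ∧ ν i < ν k).card + B + i + 1 = n := by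
      have e3 : (Finset.univ.filter fun k : Fin n => i < k ∧ ν i < ν k).card + B
          = (Finset.Ioi i).card := by
        rw [hB, ← Finset.card_filter_add_card_filter_not (s := Finset.Ioi i) (fun k => ν i < ν k)]
        congr 2
        · ext k
          simp
        · ext k
          simp only [Finset.mem_filter, Finset.mem_univ, true_and, Finset.mem_Ioi, not_lt]
          refine and_congr_right fun hk => ⟨fun h => h.le, fun h => le_antisymm h (hm ?_)⟩
          exact (Fin.lt_def.mpr hk).le
      rw [e3, Fin.card_Ioi]
      omega
    rw [legColength, e1]
    push_cast
    omega
  rw [eigval, hleg]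
  have ht := t_ne_zero
  rw [← zpow_natCast t B, ← zpow_natCast t⁻¹ A, inv_zpow, ← zpow_neg,
    show -((A : ℤ) + ((n : ℤ) - 1 - i - B)) = (-(n : ℤ) + i + 1) + -(A : ℤ) + B by ring,
    zpow_add₀ ht, zpow_add₀ ht]
  ring

/-- The leg colength is a rank: entries are ordered by decreasing value, ties by position. Swapping
two unequal neighbours leaves the relative position of equal entries alone. -/
theorem legColength_comp_adjSwap {η : Fin n → ℕ} {i : Fin (n - 1)} (h : η (lo i) ≠ η (hi i))
    (j : Fin n) : legColength (η ∘ adjSwap i) j = legColength η (adjSwap i j) := by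
  have hunion : ∀ (η : Fin n → ℕ) (j : Fin n), legColength η j =
      (Finset.univ.filter fun k : Fin n => (k < j ∧ η j ≤ η k) ∨ (j < k ∧ η j < η k)).card := by
    intro η j
    rw [legColength, ← Finset.card_union_of_disjoint, Finset.filter_or]
    rw [Finset.disjoint_filter]
    rintro k _ ⟨h1, _⟩ ⟨h2, _⟩
    exact lt_asymm h1 h2
  rw [hunion, hunion]
  have key : ∀ k, ((k < j ∧ η (adjSwap i j) ≤ η (adjSwap i k)) ∨
      (j < k ∧ η (adjSwap i j) < η (adjSwap i k))) ↔
      ((adjSwap i k < adjSwap i j ∧ η (adjSwap i j) ≤ η (adjSwap i k)) ∨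
        (adjSwap i j < adjSwap i k ∧ η (adjSwap i j) < η (adjSwap i k))) := by
    intro k
    have h0 := lo_lt_hi i
    by_cases h1 : k = lo i ∧ j = hi i
    · obtain ⟨rfl, rfl⟩ := h1
      simp only [adjSwap_lo, adjSwap_hi, h0, h0.not_gt, true_and, false_and, or_false, false_or]
      exact ⟨fun h' => h'.lt_of_ne h, le_of_lt⟩
    by_cases h2 : k = hi i ∧ j = lo i
    · obtain ⟨rfl, rfl⟩ := h2
      simp only [adjSwap_lo, adjSwap_hi, h0, h0.not_gt, true_and, false_and, or_false, false_or]
      exact ⟨le_of_lt, fun h' => h'.lt_of_ne h.symm⟩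
    rw [adjSwap_lt_iff h1 h2, adjSwap_lt_iff (fun h => h2 h.symm) (fun h => h1 h.symm)]
  refine Finset.card_bij' (fun k _ => adjSwap i k) (fun k _ => adjSwap i k) ?_ ?_ ?_ ?_
  · intro k hk
    rw [Finset.mem_filter] at hk ⊢
    exact ⟨Finset.mem_univ _, (key k).mp hk.2⟩
  · intro k hk
    rw [Finset.mem_filter] at hk ⊢
    refine ⟨Finset.mem_univ _, (key _).mpr ?_⟩
    rw [adjSwap_adjSwap]
    exact hk.2
  · intro k _
    exact adjSwap_adjSwap _ _
  · intro k _
    exact adjSwap_adjSwap _ _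

theorem sum_eigval_comp_perm (η : Fin n → ℕ) (σ : Equiv.Perm (Fin n)) :
    ∑ i, eigval (η ∘ σ) i = ∑ i, eigval η i := by
  obtain ⟨w, rfl⟩ := exists_word σ
  induction w using List.reverseRecOn generalizing η with
  | nil => simp
  | append_singleton w i ih =>
    rw [List.map_append, List.prod_append, List.map_singleton, List.prod_singleton,
      Equiv.Perm.coe_mul, ← Function.comp_assoc, ← ih η]
    generalize η ∘ ⇑(List.map adjSwap w).prod = η
    by_cases h : η (lo i) = η (hi i)
    · rw [comp_adjSwap_eq h]
    · rw [← Equiv.sum_comp (adjSwap i)]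
      refine Finset.sum_congr rfl fun j _ => ?_
      rw [eigval, legColength_comp_adjSwap h, adjSwap_adjSwap, Function.comp_apply,
        adjSwap_adjSwap, eigval]

/-! ### Images of monomials under the symmetrizers -/

/-- The image of `lowerSpan κ` under a symmetrizer. -/
def symLower (a : QT) (κ : Fin n → ℕ) : Submodule QT (Poly n) :=
  (lowerSpan κ).map (symmetrizer n a)

theorem symmetrizer_mem_symLower {a : QT} {κ : Fin n → ℕ} {f : Poly n} (hf : f ∈ lowerSpan κ) :
    symmetrizer n a f ∈ symLower a κ :=
  Submodule.mem_map_of_mem hf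

theorem IsCharPair.symmetrizer_T {a χ : QT} (h : IsCharPair a χ) (i : Fin (n - 1)) (f : Poly n) :
    symmetrizer n a (T i f) = χ • symmetrizer n a f := by
  rw [← Module.End.mul_apply, h.symmetrizer_mul_T, LinearMap.smul_apply]

theorem comp_adjSwap_comp (i : Fin (n - 1)) (ν : Fin n → ℕ) :
    (ν ∘ adjSwap i) ∘ adjSwap i = ν := by
  funext j
  simp [adjSwap_adjSwap]

theorem IsCharPair.symmetrizer_xpow_swap {a χ : QT} (h : IsCharPair a χ) {κ ν : Fin n → ℕ}
    (hν : WeakBelow κ ν) {i : Fin (n - 1)} (hi : ν (Macdonald.hi i) < ν (lo i)) :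
    symmetrizer n a (xpow (ν ∘ adjSwap i)) - χ • symmetrizer n a (xpow ν) ∈ symLower a κ := by
  rw [← h.symmetrizer_T i, ← map_sub, ← neg_sub, map_neg]
  exact Submodule.neg_mem _ (symmetrizer_mem_symLower (T_xpow_sub_mem hν hi))

theorem exists_symmetrizer_xpow_comp {a χ : QT} (h : IsCharPair a χ) {κ : Fin n → ℕ}
    (σ : Equiv.Perm (Fin n)) {ν : Fin n → ℕ} (hν : WeakBelow κ ν) :
    ∃ c : QT, symmetrizer n a (xpow (ν ∘ σ)) - c • symmetrizer n a (xpow ν) ∈ symLower a κ := by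
  obtain ⟨w, rfl⟩ := exists_word σ
  induction w using List.reverseRecOn generalizing ν with
  | nil => exact ⟨1, by simp⟩
  | append_singleton w i ih =>
    obtain ⟨c, hc⟩ := ih hν
    rw [List.map_append, List.prod_append, List.map_singleton, List.prod_singleton,
      Equiv.Perm.coe_mul, ← Function.comp_assoc]
    have hw := hν.comp_perm (List.map adjSwap w).prod
    generalize ν ∘ ⇑(List.map adjSwap w).prod = μ at hc hw
    obtain ⟨d, hd⟩ : ∃ d : QT, symmetrizer n a (xpow (μ ∘ adjSwap i))
        - d • symmetrizer n a (xpow μ) ∈ symLower a κ := by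
      rcases lt_trichotomy (μ (lo i)) (μ (hi i)) with h1 | h1 | h1
      · have h2 := h.symmetrizer_xpow_swap (hw.comp_perm (adjSwap i)) (i := i)
          (by simpa [adjSwap_lo, adjSwap_hi] using h1)
        rw [comp_adjSwap_comp] at h2
        refine ⟨χ⁻¹, ?_⟩
        have h3 := Submodule.smul_mem _ (-χ⁻¹) h2
        rwa [smul_sub, neg_smul, neg_smul, inv_smul_smul₀ h.ne_zero, sub_neg_eq_add, add_comm,
          ← sub_eq_add_neg] at h3
      · exact ⟨1, by rw [comp_adjSwap_eq h1, one_smul, sub_self]; exact Submodule.zero_mem _⟩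
      · exact ⟨χ, h.symmetrizer_xpow_swap hw h1⟩
    refine ⟨d * c, ?_⟩
    have h1 := Submodule.add_mem _ hd (Submodule.smul_mem _ d hc)
    rwa [smul_sub, sub_add_sub_cancel, smul_smul] at h1

theorem t_ne_neg_one : t ≠ -1 := by
  intro h
  have h1 : algebraMap (MvPolynomial (Fin 2) ℚ) QT (X 1 + 1) = 0 := by
    rw [map_add, map_one]
    exact (congrArg (· + 1) h).trans (neg_add_cancel 1)
  have h2 := IsFractionRing.injective (MvPolynomial (Fin 2) ℚ) QT (h1.trans (map_zero _).symm)
  have h3 := congrArg (eval fun _ => (1 : ℚ)) h2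
  norm_num at h3

theorem symmetrizer_xpow_eq_zero {ν : Fin n → ℕ} {i : Fin (n - 1)} (h : ν (lo i) = ν (hi i)) :
    symmetrizer n (-t)⁻¹ (xpow ν : Poly n) = 0 := by
  have h1 := isCharPair_minus.symmetrizer_T i (xpow ν : Poly n)
  rw [T_xpow_of_eq h, map_smul, ← sub_eq_zero, ← sub_smul] at h1
  refine (smul_eq_zero.mp h1).resolve_left fun h2 => ?_
  exact t_ne_neg_one (sub_eq_zero.mp h2)

/-- The exact sign is needed for the hat of `m'_κ`. Swapping equal neighbours is harmless because
the antisymmetrized monomial is then zero. -/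
theorem symmetrizer_minus_xpow_comp {κ : Fin n → ℕ} (σ : Equiv.Perm (Fin n)) {ν : Fin n → ℕ}
    (hν : WeakBelow κ ν) :
    symmetrizer n (-t)⁻¹ (xpow (ν ∘ σ)) - (-1 : QT) ^ len σ • symmetrizer n (-t)⁻¹ (xpow ν)
      ∈ symLower (-t)⁻¹ κ := by
  obtain ⟨w, hw, hl⟩ := exists_word_length_eq_len σ
  rw [← hl, ← hw]
  clear hw hl
  induction w using List.reverseRecOn generalizing ν with
  | nil => simp
  | append_singleton w i ih =>
    have hc := ih hν
    rw [List.map_append, List.prod_append, List.map_singleton, List.prod_singleton,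
      Equiv.Perm.coe_mul, ← Function.comp_assoc]
    have hw := hν.comp_perm (List.map adjSwap w).prod
    generalize ν ∘ ⇑(List.map adjSwap w).prod = μ at hc hw
    have hd : symmetrizer n (-t)⁻¹ (xpow (μ ∘ adjSwap i))
        - (-1 : QT) • symmetrizer n (-t)⁻¹ (xpow μ) ∈ symLower (-t)⁻¹ κ := by
      rcases lt_trichotomy (μ (lo i)) (μ (hi i)) with h1 | h1 | h1
      · have h2 := isCharPair_minus.symmetrizer_xpow_swap (hw.comp_perm (adjSwap i)) (i := i)
          (by simpa [adjSwap_lo, adjSwap_hi] using h1)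
        rw [comp_adjSwap_comp] at h2
        rw [neg_one_smul, sub_neg_eq_add] at h2 ⊢
        rwa [add_comm]
      · rw [comp_adjSwap_eq h1, symmetrizer_xpow_eq_zero h1, smul_zero, sub_zero]
        exact Submodule.zero_mem _
      · exact isCharPair_minus.symmetrizer_xpow_swap hw h1
    have h1 := Submodule.add_mem _ hd (Submodule.smul_mem _ (-1 : QT) hc)
    rw [smul_sub, sub_add_sub_cancel, smul_smul, ← pow_succ'] at h1
    rw [List.length_append, List.length_singleton]
    exact h1

theorem symLower_sumY [NeZero n] {a : QT} {κ : Fin n → ℕ} {f : Poly n} (hf : f ∈ symLower a κ) :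
    sumY n f ∈ symLower a κ := by
  obtain ⟨g, hg, rfl⟩ := hf
  rw [← Module.End.mul_apply, ← (symmetrizer_commute_sumY a).eq, Module.End.mul_apply]
  exact symmetrizer_mem_symLower (sumY_mem_lowerSpan hg)

theorem monotone_comp_rev {κ : Fin n → ℕ} (hκ : Antitone κ) : Monotone (κ ∘ Fin.revPerm) :=
  fun _ _ h => hκ (Fin.rev_le_rev.mpr h)

/-- The diagonal entry is known only for the increasing rearrangement of `κ`. As `sumY` commutes
with the symmetrizer, it passes to everything congruent to a multiple of that symmetrized monomial.
-/
theorem sumY_sub_mem_symLower [NeZero n] {a : QT} {κ : Fin n → ℕ} (hκ : Antitone κ) {f : Poly n}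
    {c : QT} (hf : f - c • symmetrizer n a (xpow (κ ∘ Fin.revPerm)) ∈ symLower a κ) :
    sumY n f - (∑ i, eigval κ i) • f ∈ symLower a κ := by
  set g : Poly n := xpow (κ ∘ Fin.revPerm) with hg
  have h1 : sumY n g - (∑ i, eigval κ i) • g ∈ lowerSpan κ := by
    rw [← sum_eigval_comp_perm κ Fin.revPerm, sumY, LinearMap.sum_apply, Finset.sum_smul,
      ← Finset.sum_sub_distrib]
    exact Submodule.sum_mem _ fun i _ =>
      Y_xpow_of_monotone ((WeakBelow.refl κ).comp_perm _) (monotone_comp_rev hκ) i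
  have h2 := symmetrizer_mem_symLower (a := a) h1
  rw [map_sub, map_smul, ← Module.End.mul_apply, (symmetrizer_commute_sumY a).eq,
    Module.End.mul_apply] at h2
  have h3 := Submodule.sub_mem _ (symLower_sumY hf)
    (Submodule.smul_mem _ (∑ i, eigval κ i) hf)
  have h4 := Submodule.add_mem _ h3 (Submodule.smul_mem _ c h2)
  rw [map_sub, map_smul] at h4
  convert h4 using 1
  rw [smul_sub, smul_sub, smul_comm c]
  abel

/-- Every tuple has a weakly decreasing rearrangement. -/
theorem exists_antitone_comp (ν : Fin n → ℕ) : ∃ σ : Equiv.Perm (Fin n), Antitone (ν ∘ σ) :=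
  ⟨Tuple.sort ν * Fin.revPerm, fun _ _ h =>
    Tuple.monotone_sort ν (Fin.rev_le_rev.mpr h)⟩

/-! ### The symmetric case -/

/-- The span of the `mon μ` with `μ < κ` satisfying `p`. -/
def dominatedSpan (p : (Fin n → ℕ) → Prop) (mon : (Fin n → ℕ) → Poly n) (κ : Fin n → ℕ) :
    Submodule QT (Poly n) :=
  Submodule.span QT {f : Poly n | ∃ μ : Fin n → ℕ, p μ ∧ DomLT μ κ ∧ f = mon μ}

theorem sum_xpow_comp_perm (μ : Fin n → ℕ) :
    ∑ σ : Equiv.Perm (Fin n), (xpow (μ ∘ σ) : Poly n)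
      = ((Finset.univ.filter fun σ : Equiv.Perm (Fin n) => μ ∘ σ = μ).card : QT) • msymm μ := by
  rw [Finset.sum_comp (fun η : Fin n → ℕ => (xpow η : Poly n)), msymm, Finset.smul_sum]
  refine Finset.sum_congr rfl fun η hη => ?_
  obtain ⟨τ, _, rfl⟩ := Finset.mem_image.mp hη
  rw [← Nat.cast_smul_eq_nsmul QT]
  congr 2
  refine Finset.card_bij' (fun σ _ => σ * τ⁻¹) (fun σ _ => σ * τ) ?_ ?_ ?_ ?_
  · intro σ hσ
    rw [Finset.mem_filter] at hσ ⊢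
    refine ⟨Finset.mem_univ _, ?_⟩
    rw [Equiv.Perm.coe_mul, ← Function.comp_assoc, hσ.2, Function.comp_assoc,
      ← Equiv.Perm.coe_mul, mul_inv_cancel]
    rfl
  · intro σ hσ
    rw [Finset.mem_filter] at hσ ⊢
    refine ⟨Finset.mem_univ _, ?_⟩
    rw [Equiv.Perm.coe_mul, ← Function.comp_assoc, hσ.2]
  · simp
  · simp

theorem rename_msymm (σ : Equiv.Perm (Fin n)) (μ : Fin n → ℕ) :
    rename σ (msymm μ) = msymm μ := by
  rw [msymm, map_sum]
  simp only [rename_xpow]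
  refine Finset.sum_bij' (fun η _ => η ∘ σ.symm) (fun η _ => η ∘ σ) ?_ ?_ ?_ ?_ ?_
  · intro η hη
    obtain ⟨τ, _, rfl⟩ := Finset.mem_image.mp hη
    exact Finset.mem_image.mpr ⟨τ * σ.symm, Finset.mem_univ _, rfl⟩
  · intro η hη
    obtain ⟨τ, _, rfl⟩ := Finset.mem_image.mp hη
    exact Finset.mem_image.mpr ⟨τ * σ, Finset.mem_univ _, rfl⟩
  · intro η _
    funext j
    simp
  · intro η _
    funext j
    simp
  · intro η _
    rfl

theorem isType_msymm (μ : Fin n → ℕ) : IsType t (msymm μ : Poly n) := fun i =>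
  T_eq_of_sOp_eq (rename_msymm (adjSwap i) μ)

theorem IsType.rename_eq {f : Poly n} (h : IsType t f) (σ : Equiv.Perm (Fin n)) :
    rename σ f = f := by
  obtain ⟨w, rfl⟩ := exists_word σ
  induction w with
  | nil => exact rename_id_apply f
  | cons i w ih =>
    rw [List.map_cons, List.prod_cons, Equiv.Perm.coe_mul, ← rename_rename, ih]
    exact sOp_eq_of_T_eq (h i)

theorem sum_rename_mem {κ : Fin n → ℕ} (hκ : Antitone κ) {f : Poly n} (hf : f ∈ lowerSpan κ) :
    ∑ σ : Equiv.Perm (Fin n), rename σ f ∈ dominatedSpan Antitone msymm κ := by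
  let A : Op n := ∑ σ : Equiv.Perm (Fin n), (rename σ : Poly n →ₐ[QT] Poly n).toLinearMap
  have hA : ∀ f, A f = ∑ σ : Equiv.Perm (Fin n), rename σ f := fun f => by
    simp only [A, LinearMap.sum_apply, AlgHom.toLinearMap_apply]
  rw [← hA]
  refine map_mem_of_lowerSpan (fun ν hν => ?_) hf
  obtain ⟨τ, hτ⟩ := exists_antitone_comp ν
  have h1 : A (xpow ν) = ∑ σ : Equiv.Perm (Fin n), xpow ((ν ∘ τ) ∘ σ) := by
    rw [hA]
    simp only [rename_xpow]
    rw [← Equiv.sum_comp (Equiv.inv (Equiv.Perm (Fin n))), ← Equiv.sum_comp (Equiv.mulLeft τ)]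
    rfl
  rw [h1, sum_xpow_comp_perm]
  exact Submodule.smul_mem _ _ (Submodule.subset_span
    ⟨ν ∘ τ, hτ, (hν.comp_perm τ).domLT hκ, rfl⟩)

theorem symmetrizer_mem_lowerSpan {a : QT} {κ : Fin n → ℕ} {f : Poly n} (hf : f ∈ lowerSpan κ) :
    symmetrizer n a f ∈ lowerSpan κ := by
  rw [symmetrizer, LinearMap.sum_apply]
  refine Submodule.sum_mem _ fun σ _ => Submodule.smul_mem _ _ ?_
  rw [Tperm]
  induction reducedWord σ with
  | nil => exact hf
  | cons i w ih =>
    rw [List.map_cons, List.prod_cons]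
    exact T_mem_lowerSpan i ih

/-- Images of the symmetrizer are symmetric polynomials, hence equal to their average over all
permutations, and the average of a lower monomial is a multiple of some `m_μ`. -/
theorem symLower_plus_le {κ : Fin n → ℕ} (hκ : Antitone κ) :
    symLower 1 κ ≤ dominatedSpan Antitone msymm κ := by
  rintro _ ⟨f, hf, rfl⟩
  have h1 := sum_rename_mem hκ (symmetrizer_mem_lowerSpan (a := 1) hf)
  simp only [(isCharPair_plus.isType_symmetrizer f).rename_eq, Finset.sum_const,
    Finset.card_univ, Fintype.card_perm, Fintype.card_fin] at h1
  rw [← Nat.cast_smul_eq_nsmul QT] at h1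
  exact (Submodule.smul_mem_iff _ (Nat.cast_ne_zero.mpr (Nat.factorial_ne_zero n))).mp h1

theorem exists_msymm_sub_mem {κ : Fin n → ℕ} :
    ∃ c : QT, msymm κ - c • symmetrizer n 1 (xpow (κ ∘ Fin.revPerm)) ∈ symLower 1 κ := by
  have h1 : ∀ η ∈ Finset.univ.image fun σ : Equiv.Perm (Fin n) => κ ∘ σ,
      ∃ c : QT, symmetrizer n 1 (xpow η) - c • symmetrizer n 1 (xpow (κ ∘ Fin.revPerm))
        ∈ symLower 1 κ := by
    intro η hη
    obtain ⟨σ, _, rfl⟩ := Finset.mem_image.mp hη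
    have := exists_symmetrizer_xpow_comp isCharPair_plus (Fin.revPerm * σ)
      ((WeakBelow.refl κ).comp_perm Fin.revPerm)
    have h2 : (κ ∘ (Fin.revPerm : Equiv.Perm (Fin n))) ∘ ⇑((Fin.revPerm : Equiv.Perm (Fin n)) * σ) = κ ∘ σ := by
      funext j
      simp
    rwa [h2] at this
  choose! c hc using h1
  refine ⟨(poincare n t)⁻¹ * ∑ η ∈ Finset.univ.image fun σ : Equiv.Perm (Fin n) => κ ∘ σ, c η, ?_⟩
  have h3 := Submodule.smul_mem _ (poincare n t)⁻¹ (Submodule.sum_mem _ hc)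
  rw [Finset.sum_sub_distrib, ← map_sum, ← msymm, (isType_msymm κ).symmetrizer_apply, one_mul,
    smul_sub, inv_smul_smul₀ poincare_t_ne_zero, ← Finset.sum_smul, smul_smul] at h3
  exact h3

theorem sumY_msymm [NeZero n] {κ : Fin n → ℕ} (hκ : Antitone κ) :
    sumY n (msymm κ) - (∑ i, eigval κ i) • msymm κ ∈ dominatedSpan Antitone msymm κ := by
  obtain ⟨c, hc⟩ := exists_msymm_sub_mem (κ := κ)
  exact symLower_plus_le hκ (sumY_sub_mem_symLower hκ hc)

/-! ### The antisymmetric case -/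

theorem masymm_eq (κ : Fin n → ℕ) : masymm κ = symmetrizer n (-t)⁻¹ (xpow κ) := by
  rw [masymm, Uminus_eq]

theorem strictAnti_of_forall_lt {μ : Fin n → ℕ} (h : ∀ i, μ (hi i) < μ (lo i)) :
    StrictAnti μ := by
  cases n with
  | zero => exact fun a => a.elim0
  | succ m => exact Fin.strictAnti_iff_succ_lt.mpr fun i => h i

/-- Induction along the order: sorting the exponents costs a sign and strictly lower terms. The
sorted monomial gives zero if a part repeats and some `m'_μ` otherwise. -/
theorem symmetrizer_minus_xpow_mem {κ : Fin n → ℕ} (hκ : Antitone κ) {ν : Fin n → ℕ}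
    (hν : Below κ ν) :
    symmetrizer n (-t)⁻¹ (xpow ν) ∈ dominatedSpan StrictAnti masymm κ := by
  induction hk : belowMeasure ν using Nat.strong_induction_on generalizing ν with
  | _ k ih =>
  subst hk
  obtain ⟨σ, hσ⟩ := exists_antitone_comp ν
  have hw := (WeakBelow.refl ν).comp_perm σ
  have h1 := symmetrizer_minus_xpow_comp σ⁻¹ hw
  have h2 : (ν ∘ σ) ∘ ⇑σ⁻¹ = ν := by
    funext j
    simp
  rw [h2] at h1
  have h3 : symLower (-t)⁻¹ ν ≤ dominatedSpan StrictAnti masymm κ := by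
    rintro _ ⟨f, hf, rfl⟩
    exact map_mem_of_lowerSpan (fun μ hμ => ih _ hμ.measure_lt (hν.1.trans_below hμ) rfl) hf
  have h4 : symmetrizer n (-t)⁻¹ (xpow (ν ∘ σ)) ∈ dominatedSpan StrictAnti masymm κ := by
    by_cases h5 : ∃ i, (ν ∘ σ) (lo i) = (ν ∘ σ) (hi i)
    · obtain ⟨i, hi⟩ := h5
      rw [symmetrizer_xpow_eq_zero hi]
      exact Submodule.zero_mem _
    · push Not at h5
      rw [← masymm_eq]
      exact Submodule.subset_span ⟨_, strictAnti_of_forall_lt fun i =>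
        (hσ (lo_lt_hi i).le).lt_of_ne (h5 i).symm, (hν.comp_perm σ).domLT hκ, rfl⟩
  have h5 := Submodule.add_mem _ (h3 h1) (Submodule.smul_mem _ ((-1 : QT) ^ len σ⁻¹) h4)
  rwa [sub_add_cancel] at h5

theorem symLower_minus_le {κ : Fin n → ℕ} (hκ : Antitone κ) :
    symLower (-t)⁻¹ κ ≤ dominatedSpan StrictAnti masymm κ := by
  rintro _ ⟨f, hf, rfl⟩
  exact map_mem_of_lowerSpan (fun ν hν => symmetrizer_minus_xpow_mem hκ hν) hf

theorem sumY_masymm [NeZero n] {κ : Fin n → ℕ} (hκ : StrictAnti κ) :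
    sumY n (masymm κ) - (∑ i, eigval κ i) • masymm κ ∈ dominatedSpan StrictAnti masymm κ := by
  obtain ⟨c, hc⟩ := exists_symmetrizer_xpow_comp isCharPair_minus Fin.revPerm
    ((WeakBelow.refl κ).comp_perm Fin.revPerm)
  have h2 : (κ ∘ (Fin.revPerm : Equiv.Perm (Fin n))) ∘ ⇑(Fin.revPerm : Equiv.Perm (Fin n)) = κ := by
    funext j
    simp
  rw [h2, ← masymm_eq] at hc
  exact symLower_minus_le hκ.antitone (sumY_sub_mem_symLower hκ.antitone hc)

/-! ### The spectrum of a triangular operator -/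

theorem eq_of_sum_Iic_eq {μ κ : Fin n → ℕ}
    (h : ∀ p, ∑ i ∈ Finset.Iic p, μ i = ∑ i ∈ Finset.Iic p, κ i) : μ = κ := by
  funext p
  induction p using WellFoundedLT.induction with
  | _ p ih =>
    have h1 := h p
    rw [← Finset.Iio_insert, Finset.sum_insert Finset.notMem_Iio_self,
      Finset.sum_insert Finset.notMem_Iio_self,
      Finset.sum_congr rfl fun i hi => ih i (Finset.mem_Iio.mp hi)] at h1
    exact Nat.add_right_cancel h1

theorem DomLT.trans {μ ν κ : Fin n → ℕ} (h : DomLT μ ν) (h' : DomLT ν κ) : DomLT μ κ := by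
  refine ⟨?_, h.2.1.trans h'.2.1, fun p => (h.2.2 p).trans (h'.2.2 p)⟩
  rintro rfl
  exact h.1 (eq_of_sum_Iic_eq fun p => le_antisymm (h.2.2 p) (h'.2.2 p))

/-- A natural number which increases along the dominance order. -/
def domMeasure (μ : Fin n → ℕ) : ℕ := ∑ p, ∑ i ∈ Finset.Iic p, μ i

theorem DomLT.measure_lt {μ κ : Fin n → ℕ} (h : DomLT μ κ) : domMeasure μ < domMeasure κ := by
  refine Finset.sum_lt_sum (fun p _ => h.2.2 p) ?_
  by_contra! hc
  exact h.1 (eq_of_sum_Iic_eq fun p => le_antisymm (h.2.2 p) (hc p (Finset.mem_univ p)))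

theorem finite_domLT (κ : Fin n → ℕ) : {μ : Fin n → ℕ | DomLT μ κ}.Finite := by
  refine (Set.finite_Iic fun _ : Fin n => ∑ i, κ i).subset fun μ hμ i => ?_
  rw [← hμ.2.1]
  exact Finset.single_le_sum (f := μ) (fun _ _ => Nat.zero_le _) (Finset.mem_univ i)

section Spectrum

variable {p : (Fin n → ℕ) → Prop} {mon : (Fin n → ℕ) → Poly n} {D : Op n}
  {e : (Fin n → ℕ) → QT}

theorem dominatedSpan_mono {μ κ : Fin n → ℕ} (h : DomLT μ κ) :
    dominatedSpan p mon μ ≤ dominatedSpan p mon κ :=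
  Submodule.span_mono fun _ ⟨ν, h1, h2, h3⟩ => ⟨ν, h1, h2.trans h, h3⟩

theorem mon_mem_dominatedSpan {μ κ : Fin n → ℕ} (hp : p μ) (h : DomLT μ κ) :
    mon μ ∈ dominatedSpan p mon κ :=
  Submodule.subset_span ⟨μ, hp, h, rfl⟩

instance finite_dominatedSpan (κ : Fin n → ℕ) : Module.Finite QT (dominatedSpan p mon κ) := by
  refine Module.Finite.span_of_finite QT (((finite_domLT κ).image mon).subset ?_)
  rintro _ ⟨μ, _, h, rfl⟩
  exact ⟨μ, h, rfl⟩

theorem map_mem_dominatedSpan (hD : ∀ κ, p κ → D (mon κ) - e κ • mon κ ∈ dominatedSpan p mon κ)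
    {κ : Fin n → ℕ} {f : Poly n} (hf : f ∈ dominatedSpan p mon κ) :
    D f ∈ dominatedSpan p mon κ := by
  have : dominatedSpan p mon κ ≤ (dominatedSpan p mon κ).comap D := Submodule.span_le.mpr (by
    rintro _ ⟨μ, hp, hμ, rfl⟩
    have h1 := Submodule.add_mem _ (dominatedSpan_mono hμ (hD μ hp))
      (Submodule.smul_mem _ (e μ) (mon_mem_dominatedSpan hp hμ))
    rwa [sub_add_cancel] at h1)
  exact this hf

/-- Back substitution: `D - c` maps `mon μ` to a nonzero multiple of itself plus lower terms, and
those are already attained by induction. -/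
theorem exists_sub_smul_eq (hD : ∀ κ, p κ → D (mon κ) - e κ • mon κ ∈ dominatedSpan p mon κ)
    {c : QT} (κ : Fin n → ℕ) (hc : ∀ μ, p μ → DomLT μ κ → e μ ≠ c) {f : Poly n}
    (hf : f ∈ dominatedSpan p mon κ) : ∃ g ∈ dominatedSpan p mon κ, D g - c • g = f := by
  induction hk : domMeasure κ using Nat.strong_induction_on generalizing κ f with
  | _ k ih =>
  subst hk
  have : dominatedSpan p mon κ ≤ (dominatedSpan p mon κ).map (D - c • 1) :=
    Submodule.span_le.mpr (by
      rintro _ ⟨μ, hp, hμ, rfl⟩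
      obtain ⟨g, hg, hg'⟩ := ih _ hμ.measure_lt μ (fun ν hν h => hc ν hν (h.trans hμ)) (hD μ hp) rfl
      refine ⟨(e μ - c)⁻¹ • (mon μ - g), Submodule.smul_mem _ _ (Submodule.sub_mem _
        (mon_mem_dominatedSpan hp hμ) (dominatedSpan_mono hμ hg)), ?_⟩
      rw [map_smul, inv_smul_eq_iff₀ (sub_ne_zero.mpr (hc μ hp hμ)), map_sub,
        LinearMap.sub_apply, LinearMap.sub_apply, LinearMap.smul_apply, LinearMap.smul_apply,
        Module.End.one_apply, Module.End.one_apply, hg', sub_smul]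
      abel)
  obtain ⟨g, hg, hg'⟩ := this hf
  exact ⟨g, hg, hg'⟩

/-- On a finite-dimensional space the surjective `D - c` is injective. Linear independence of the
`mon μ` is thus never required. -/
theorem eq_zero_of_eigen (hD : ∀ κ, p κ → D (mon κ) - e κ • mon κ ∈ dominatedSpan p mon κ)
    {c : QT} {κ : Fin n → ℕ} (hc : ∀ μ, p μ → DomLT μ κ → e μ ≠ c) {f : Poly n}
    (hf : f ∈ dominatedSpan p mon κ) (h : D f = c • f) : f = 0 := by
  let A : Module.End QT (dominatedSpan p mon κ) := (D - c • 1).restrict fun g hg =>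
    Submodule.sub_mem _ (map_mem_dominatedSpan hD hg) (Submodule.smul_mem _ c hg)
  have hA : Function.Surjective A := by
    rintro ⟨g, hg⟩
    obtain ⟨g', hg', h'⟩ := exists_sub_smul_eq hD κ hc hg
    exact ⟨⟨g', hg'⟩, Subtype.ext h'⟩
  have h0 : A ⟨f, hf⟩ = 0 := Subtype.ext (sub_eq_zero.mpr h)
  have hinj : Function.Injective A := OrzechProperty.injective_of_surjective_endomorphism A hA
  have h1 := hinj (h0.trans (map_zero A).symm)
  exact congrArg Subtype.val h1

theorem existsUnique_eigen (hD : ∀ κ, p κ → D (mon κ) - e κ • mon κ ∈ dominatedSpan p mon κ)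
    (he : ∀ κ μ, p κ → p μ → e κ = e μ → κ = μ) {κ : Fin n → ℕ} (hκ : p κ) :
    ∃! f, D f = e κ • f ∧ f - mon κ ∈ dominatedSpan p mon κ := by
  have hc : ∀ μ, p μ → DomLT μ κ → e μ ≠ e κ := fun μ hp hμ h => hμ.1 (he μ κ hp hκ h)
  obtain ⟨g, hg, hg'⟩ := exists_sub_smul_eq hD κ hc (hD κ hκ)
  refine ⟨mon κ - g, ⟨?_, ?_⟩, ?_⟩
  · rw [← sub_eq_zero, map_sub, smul_sub, sub_sub_sub_comm, hg', sub_self]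
  · rw [sub_sub_cancel_left]
    exact Submodule.neg_mem _ hg
  · rintro f ⟨h1, h2⟩
    rw [← sub_eq_zero]
    refine eq_zero_of_eigen hD hc (κ := κ) ?_ ?_
    · have h3 := Submodule.add_mem _ h2 hg
      convert h3 using 1
      abel
    · have h4 : D (mon κ - g) = e κ • (mon κ - g) := by
        rw [← sub_eq_zero, map_sub, smul_sub, sub_sub_sub_comm, hg', sub_self]
      rw [map_sub, h1, h4, ← smul_sub]

/-- The defect `D f - e κ • f` has no leading term, and by commutation it is an eigenvector of the
hat of `D` for `bar (e κ)`. Its hat is then an eigenvector of `D` for `e κ` inside the lower span,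
where this eigenvalue does not occur. -/
theorem eigen_of_hat_eigen (hD : ∀ κ, p κ → D (mon κ) - e κ • mon κ ∈ dominatedSpan p mon κ)
    (he : ∀ κ μ, p κ → p μ → e κ = e μ → κ = μ) {κ : Fin n → ℕ} (hκ : p κ)
    (hhat : ∀ f ∈ dominatedSpan p mon κ, hat f ∈ dominatedSpan p mon κ) {f : Poly n}
    (hf : f - mon κ ∈ dominatedSpan p mon κ) (hcomm : D (hatOp D f) = hatOp D (D f))
    (h : hatOp D f = bar (e κ) • f) : D f = e κ • f := by
  have hc : ∀ μ, p μ → DomLT μ κ → e μ ≠ e κ := fun μ hp hμ h => hμ.1 (he μ κ hp hκ h)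
  have hr : D f - e κ • f ∈ dominatedSpan p mon κ := by
    have h1 := Submodule.add_mem _ (Submodule.sub_mem _ (map_mem_dominatedSpan hD hf)
      (Submodule.smul_mem _ (e κ) hf)) (hD κ hκ)
    convert h1 using 1
    rw [map_sub, smul_sub]
    abel
  have h2 : hatOp D (D f - e κ • f) = bar (e κ) • (D f - e κ • f) := by
    rw [map_sub, ← hcomm, map_smul, h, map_smul, smul_sub, smul_comm (e κ)]
  have h3 : D (hat (D f - e κ • f)) = e κ • hat (D f - e κ • f) := by
    rw [hatOp_apply] at h2
    have h4 := congrArg hat h2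
    rwa [hat_hat, hat_smul, bar_bar] at h4
  have h5 := eq_zero_of_eigen hD hc (hhat _ hr) h3
  have h6 := congrArg hat h5
  rw [hat_hat, map_zero] at h6
  exact sub_eq_zero.mp h6

end Spectrum

/-! ### Separation of the eigenvalues. -/

theorem legColength_of_antitone {κ : Fin n → ℕ} (hκ : Antitone κ) (i : Fin n) :
    legColength κ i = i := by
  have e1 : (Finset.univ.filter fun k : Fin n => k < i ∧ κ i ≤ κ k) = Finset.Iio i := by
    ext k
    simp only [Finset.mem_filter, Finset.mem_univ, true_and, Finset.mem_Iio, and_iff_left_iff_imp]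
    exact fun h => hκ h.le
  have e2 : (Finset.univ.filter fun k : Fin n => i < k ∧ κ i < κ k) = ∅ := by
    rw [Finset.filter_eq_empty_iff]
    rintro k - ⟨h, h'⟩
    exact (hκ h.le).not_gt h'
  rw [legColength, e1, e2, Fin.card_Iio, Finset.card_empty, add_zero]

/-- After multiplication by `t ^ n` the eigenvalue is a sum of monomials in `q` and `t` with
distinct powers of `t`. The power of `t` identifies the index and the power of `q` reads off the
part. -/
theorem sum_eigval_injective {κ μ : Fin n → ℕ} (hκ : Antitone κ) (hμ : Antitone μ)
    (h : ∑ i, eigval κ i = ∑ i, eigval μ i) : κ = μ := by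
  let F : (Fin n → ℕ) → MvPolynomial (Fin 2) ℚ := fun κ =>
    ∑ i : Fin n, monomial (Finsupp.single 0 (κ i) + Finsupp.single 1 (n - (i : ℕ))) 1
  have hF : ∀ κ : Fin n → ℕ, Antitone κ →
      algebraMap (MvPolynomial (Fin 2) ℚ) QT (F κ) = t ^ n * ∑ i, eigval κ i := by
    intro κ hκ
    rw [map_sum, Finset.mul_sum]
    refine Finset.sum_congr rfl fun i _ => ?_
    have h1 : (monomial (Finsupp.single 0 (κ i) + Finsupp.single 1 (n - (i : ℕ))) 1 :
        MvPolynomial (Fin 2) ℚ) = X 0 ^ κ i * X 1 ^ (n - (i : ℕ)) := by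
      rw [X_pow_eq_monomial, X_pow_eq_monomial, monomial_mul, one_mul]
    rw [h1, map_mul, map_pow, map_pow, eigval, legColength_of_antitone hκ]
    change q ^ κ i * t ^ (n - (i : ℕ)) = _
    rw [mul_left_comm, ← zpow_natCast t n, ← zpow_add₀ t_ne_zero, ← zpow_natCast t (n - (i : ℕ)),
      Nat.cast_sub i.2.le, sub_eq_add_neg]
  have h2 : F κ = F μ := IsFractionRing.injective (MvPolynomial (Fin 2) ℚ) QT (by
    rw [hF κ hκ, hF μ hμ, h])
  funext i
  have h3 := congrArg (coeff (Finsupp.single 0 (κ i) + Finsupp.single 1 (n - (i : ℕ)))) h2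
  have h4 : ∀ (κ μ : Fin n → ℕ) (i j : Fin n),
      (Finsupp.single (0 : Fin 2) (μ j) + Finsupp.single 1 (n - (j : ℕ)) =
        Finsupp.single 0 (κ i) + Finsupp.single 1 (n - (i : ℕ))) ↔ j = i ∧ μ j = κ i := by
    intro κ μ i j
    constructor
    · intro h
      have h5 := DFunLike.congr_fun h 0
      have h6 := DFunLike.congr_fun h 1
      simp at h5 h6
      exact ⟨Fin.ext (by omega), h5⟩
    · rintro ⟨rfl, h⟩
      rw [h]
  simp only [F, coeff_sum, coeff_monomial, h4] at h3
  by_contra hne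
  rw [Finset.sum_eq_single i, Finset.sum_eq_zero] at h3
  · simp at h3
  · rintro j -
    rw [if_neg]
    rintro ⟨rfl, h⟩
    exact hne h.symm
  · rintro j - hj
    rw [if_neg fun h => hj h.1]
  · simp

/-! ### Hats of Macdonald polynomials -/

theorem hat_eq_rename (f : Poly n) : hat f = rename Fin.revPerm (invertParams f) := rfl

theorem rename_invertParams (σ : Equiv.Perm (Fin n)) (f : Poly n) :
    rename σ (invertParams f) = invertParams (rename σ f) :=
  (map_rename bar σ f).symm

theorem IsType.hat_eq {f : Poly n} (h : IsType t f) : hat f = invertParams f := by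
  rw [hat_eq_rename, rename_invertParams, h.rename_eq]

theorem hat_xpow (ν : Fin n → ℕ) : hat (xpow ν : Poly n) = xpow (ν ∘ Fin.revPerm) := by
  have h : invertParams (xpow ν : Poly n) = xpow ν := by simp [invertParams, xpow]
  rw [hat_eq_rename, h, rename_xpow]
  rfl

theorem hat_msymm (μ : Fin n → ℕ) : hat (msymm μ : Poly n) = msymm μ := by
  rw [(isType_msymm μ).hat_eq]
  simp [invertParams, msymm, xpow]

theorem hat_mem_dominatedSpan {p : (Fin n → ℕ) → Prop} {mon : (Fin n → ℕ) → Poly n}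
    {κ : Fin n → ℕ} (h : ∀ μ, p μ → DomLT μ κ → hat (mon μ) ∈ dominatedSpan p mon κ)
    {f : Poly n} (hf : f ∈ dominatedSpan p mon κ) : hat f ∈ dominatedSpan p mon κ := by
  induction hf using Submodule.span_induction with
  | mem f hf =>
    obtain ⟨μ, hp, hμ, rfl⟩ := hf
    exact h μ hp hμ
  | zero => rw [map_zero]; exact Submodule.zero_mem _
  | add f g _ _ hf hg => rw [map_add]; exact Submodule.add_mem _ hf hg
  | smul c f _ hf => rw [hat_smul]; exact Submodule.smul_mem _ _ hf

/-- The power of `t` comes from the hat of `U⁻`. The sign comes from sorting the reversed exponents,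
a permutation of maximal length. -/
theorem hat_masymm {μ : Fin n → ℕ} (hμ : Antitone μ) :
    (-t) ^ (-((n * (n - 1) / 2 : ℕ) : ℤ)) • hat (masymm μ) - masymm μ
      ∈ dominatedSpan StrictAnti masymm μ := by
  have h1 := symLower_minus_le hμ (symmetrizer_minus_xpow_comp Fin.revPerm (WeakBelow.refl μ))
  rw [len_rev, ← masymm_eq μ] at h1
  have h2 : hat (masymm μ) =
      t ^ (n * (n - 1) / 2) • symmetrizer n (-t)⁻¹ (xpow (μ ∘ Fin.revPerm)) := by
    rw [masymm, ← hatOp_hat, hatOp_Uminus, hat_xpow, LinearMap.smul_apply, Uminus_eq]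
  have h3 : (-t) ^ (-((n * (n - 1) / 2 : ℕ) : ℤ)) * t ^ (n * (n - 1) / 2)
      = (-1 : QT) ^ (n * (n - 1) / 2) := by
    have ht := pow_ne_zero (n * (n - 1) / 2) t_ne_zero
    rw [zpow_neg, zpow_natCast, neg_pow t, mul_inv, mul_assoc, inv_mul_cancel₀ ht, mul_one,
      ← inv_pow, inv_neg, inv_one]
  rw [h2, smul_smul, h3]
  have h4 := Submodule.smul_mem _ ((-1 : QT) ^ (n * (n - 1) / 2)) h1
  rwa [smul_sub, smul_smul, ← mul_pow, neg_mul_neg, one_mul, one_pow, one_smul] at h4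

/-! ### Existence, uniqueness and hat invariance of both families. -/

theorem isType_of_sub_mem {p : (Fin n → ℕ) → Prop} {mon : (Fin n → ℕ) → Poly n} {χ : QT}
    (hmon : ∀ μ, IsType χ (mon μ)) {κ : Fin n → ℕ} {f : Poly n}
    (hf : f - mon κ ∈ dominatedSpan p mon κ) : IsType χ f := by
  have h1 : ∀ g ∈ dominatedSpan p mon κ, IsType χ g := by
    intro g hg
    induction hg using Submodule.span_induction with
    | mem f hf =>
      obtain ⟨μ, _, _, rfl⟩ := hf
      exact hmon μ
    | zero => exact fun i => by rw [map_zero, smul_zero]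
    | add f g _ _ hf hg => exact fun i => by rw [map_add, hf i, hg i, smul_add]
    | smul c f _ hf => exact fun i => by rw [map_smul, hf i, smul_comm]
  intro i
  have h2 := h1 _ hf i
  rw [map_sub, hmon κ i, smul_sub] at h2
  exact sub_left_injective h2

theorem isSymmMacdonald_iff [NeZero n] {κ : Fin n → ℕ} {P : Poly n} :
    IsSymmMacdonald κ P ↔ sumY n P = (∑ i, eigval κ i) • P ∧
      P - msymm κ ∈ dominatedSpan Antitone msymm κ :=
  ⟨fun h => ⟨h.1, h.2⟩, fun h => ⟨h.1, h.2⟩⟩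

theorem isAsymmMacdonald_iff [NeZero n] {κ : Fin n → ℕ} {S : Poly n} :
    IsAsymmMacdonald κ S ↔ sumY n S = (∑ i, eigval κ i) • S ∧
      S - masymm κ ∈ dominatedSpan StrictAnti masymm κ :=
  ⟨fun h => ⟨h.1, h.2⟩, fun h => ⟨h.1, h.2⟩⟩

theorem existsUnique_isSymmMacdonald [NeZero n] {κ : Fin n → ℕ} (hκ : Antitone κ) :
    ∃! P : Poly n, IsSymmMacdonald κ P := by
  simp only [isSymmMacdonald_iff]
  exact existsUnique_eigen (D := sumY n) (e := fun κ => ∑ i, eigval κ i) (fun κ => sumY_msymm)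
    (fun _ _ => sum_eigval_injective) hκ

theorem existsUnique_isAsymmMacdonald [NeZero n] {κ : Fin n → ℕ} (hκ : StrictAnti κ) :
    ∃! S : Poly n, IsAsymmMacdonald κ S := by
  simp only [isAsymmMacdonald_iff]
  exact existsUnique_eigen (D := sumY n) (e := fun κ => ∑ i, eigval κ i) (fun κ => sumY_masymm)
    (fun _ _ h h' => sum_eigval_injective h.antitone h'.antitone) hκ

theorem IsSymmMacdonald.isType [NeZero n] {κ : Fin n → ℕ} {P : Poly n}
    (h : IsSymmMacdonald κ P) : IsType t P :=
  isType_of_sub_mem isType_msymm (isSymmMacdonald_iff.mp h).2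

theorem hatOp_apply_hat_eq {D : Op n} {f : Poly n} {c : QT} (h : D f = c • f) :
    hatOp D (hat f) = bar c • hat f := by
  rw [hatOp_hat, h, hat_smul]

theorem IsSymmMacdonald.hat_eq [NeZero n] {κ : Fin n → ℕ} (hκ : Antitone κ) {P : Poly n}
    (h : IsSymmMacdonald κ P) : P = hat P := by
  have h1 := isSymmMacdonald_iff.mp h
  have hhat : ∀ f ∈ dominatedSpan Antitone msymm κ, hat f ∈ dominatedSpan Antitone msymm κ :=
    fun f => hat_mem_dominatedSpan fun μ hp hμ => by
      rw [hat_msymm]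
      exact mon_mem_dominatedSpan hp hμ
  have h2 : hat P - msymm κ ∈ dominatedSpan Antitone msymm κ := by
    have := hhat _ h1.2
    rwa [map_sub, hat_msymm] at this
  refine (existsUnique_isSymmMacdonald hκ).unique h (isSymmMacdonald_iff.mpr ⟨?_, h2⟩)
  exact eigen_of_hat_eigen (D := sumY n) (e := fun κ => ∑ i, eigval κ i) (fun κ => sumY_msymm)
    (fun _ _ => sum_eigval_injective) hκ hhat h2
    (isCharPair_plus.sumY_hatOp_sumY (isCharPair_plus.isType_hat h.isType))
    (hatOp_apply_hat_eq h1.1)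

/-- The scalar is the one that makes the leading term of the hat equal to `m'_κ`. Being a scalar, it
does not affect the eigenvector property. -/
theorem IsAsymmMacdonald.hat_eq [NeZero n] {κ : Fin n → ℕ} (hκ : StrictAnti κ) {S : Poly n}
    (h : IsAsymmMacdonald κ S) :
    S = (-t) ^ (-((n * (n - 1) / 2 : ℕ) : ℤ)) • hat S := by
  have h1 := isAsymmMacdonald_iff.mp h
  have ht : (-t) ^ (-((n * (n - 1) / 2 : ℕ) : ℤ)) ≠ 0 := zpow_ne_zero _ (neg_ne_zero.mpr t_ne_zero)
  have hhat : ∀ f ∈ dominatedSpan StrictAnti masymm κ,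
      hat f ∈ dominatedSpan StrictAnti masymm κ :=
    fun f => hat_mem_dominatedSpan fun μ hp hμ => by
      have h2 := Submodule.add_mem _ (dominatedSpan_mono hμ (hat_masymm hp.antitone))
        (mon_mem_dominatedSpan hp hμ)
      rw [sub_add_cancel] at h2
      exact (Submodule.smul_mem_iff _ ht).mp h2
  have h2 : (-t) ^ (-((n * (n - 1) / 2 : ℕ) : ℤ)) • hat S - masymm κ
      ∈ dominatedSpan StrictAnti masymm κ := by
    have h3 := Submodule.add_mem _ (Submodule.smul_mem _
      ((-t) ^ (-((n * (n - 1) / 2 : ℕ) : ℤ))) (hhat _ h1.2)) (hat_masymm hκ.antitone)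
    rwa [map_sub, smul_sub, sub_add_sub_cancel] at h3
  have hmon : ∀ μ : Fin n → ℕ, IsType (-1) (masymm μ) := fun μ => by
    rw [masymm_eq]
    exact isCharPair_minus.isType_symmetrizer _
  refine (existsUnique_isAsymmMacdonald hκ).unique h (isAsymmMacdonald_iff.mpr ⟨?_, h2⟩)
  exact eigen_of_hat_eigen (D := sumY n) (e := fun κ => ∑ i, eigval κ i) (fun κ => sumY_masymm)
    (fun _ _ h h' => sum_eigval_injective h.antitone h'.antitone) hκ hhat h2
    (isCharPair_minus.sumY_hatOp_sumY (isType_of_sub_mem hmon h2))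
    (by rw [map_smul, hatOp_apply_hat_eq h1.1, smul_comm])

end Macdonald

end

open Macdonald in
theorem lemmaL4p1 (n : ℕ) [NeZero n] :
    hatOp (Uplus n) = t ^ (-((n * (n - 1) / 2 : ℕ) : ℤ)) • Uplus n ∧
    hatOp (Uminus n) = t ^ (n * (n - 1) / 2) • Uminus n ∧
    (∀ κ : Fin n → ℕ, Antitone κ →
      (∃! P : Poly n, IsSymmMacdonald κ P) ∧
      ∀ P : Poly n, IsSymmMacdonald κ P → P = hat P ∧ hat P = invertParams P) ∧
    (∀ κ : Fin n → ℕ, StrictAnti κ →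
      (∃! S : Poly n, IsAsymmMacdonald κ S) ∧
      ∀ S : Poly n, IsAsymmMacdonald κ S →
        S = (-t) ^ (-((n * (n - 1) / 2 : ℕ) : ℤ)) • hat S) :=
  ⟨hatOp_Uplus, hatOp_Uminus,
    fun _ hκ => ⟨existsUnique_isSymmMacdonald hκ, fun _ hP => ⟨hP.hat_eq hκ, hP.isType.hat_eq⟩⟩,
    fun _ hκ => ⟨existsUnique_isAsymmMacdonald hκ, fun _ hS => hS.hat_eq hκ⟩⟩
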